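/- Let $L\ge 1$ be fixed. For every sample size $K$ let $N=N(K)$, let $\mathbf R_N\in\mathbb C^{N\times N}$ be Hermitian with exactly $L$ distinct eigenvalues $\lambda_1<\dots<\lambda_L$ (depending on $N$) of respective multiplicities $N_1,\dots,N_L$, $\sum_i N_i=N$, and assume: (A1) there are constants $0<\lambda_{\min}<\lambda_{\max}<\infty$ with $\lambda_{\min}<\lambda_1$ and $\lambda_L<\lambda_{\max}$ for all large $K$; (A2) as $K\to\infty$, $c_K:=N/K\to c\in(0,1)$ and $N_i/K\to c_i\in(0,1)$ for $1\le i\le L$; (A3) $\mathbf Y=K^{-1/2}\,\mathbf R_N^{1/2}\mathbf X$, where $\mathbf X\in\mathbb C^{N\times K}$ has i.i.d. circularly symmetric complex Gaussian entries with zero mean and unit variance (real and imaginary parts independent $\mathcal N(0,1/2)$). Let $\hat{\mathbf R}=\mathbf Y\mathbf Y^H$ have eigenvalues $\hat\sigma_1,\dots,\hat\sigma_N$, and put $b_{\hat{\mathbf R}}(z)=\frac1N\sum_{i=1}^N\frac1{\hat\sigma_i-z}$ for $z\in\mathbb C\setminus\mathbb R$. For all large $K$ there is a probability measure $F_K$ on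 $\mathbb R$ whose Stieltjes transform $b_K(z)=\int_{\mathbb R}\frac{dF_K(\lambda)}{\lambda-z}$ satisfies, for every $z\in\mathbb C\setminus\mathbb R$, $$ b=\frac1N\sum_{i=1}^L N_i\,\frac{1}{\lambda_i(1-c_K-c_K z b)-z}\qquad\text{with } b=b_K(z), $$ and $b_K(z)$ is the only solution $b$ of this equation with $\operatorname{Im} b\cdot\operatorname{Im} z>0$. Then there are real polynomials $P_9,P_{12},P_{15},P_{20}$ with nonnegative coefficients, of degrees $9,12,15,20$, which do not depend on $K$ or on $z$, such that for all large $K$ and all $z\in\mathbb C\setminus\mathbb R$ $$ \bigl|\mathbb E\, b_{\hat{\mathbf R}}(z)-b_K(z)\bigr|\le \frac1{K^2}\,P_9(|z|)\,P_{12}(|\operatorname{Im} z|^{-1}), $$ $$ \bigl|\mathbb E\, b_{\hat{\mathbf R}}'(z)-b_K'(z)\bigr|\le \frac1{K^2}\,P_{15}(|z|)\,P_{20}(|\operatorname{Im} z|^{-1}), $$ where $'$ denotes the derivative in $z$, $b_{\hat{\mathbf R}}(z)$ and $b_{\hat{\mathbf R}}'(z)$ are integrable, and $b_K$ is complex differentiable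 at $z$. -/

import Mathlib

open MeasureTheory ProbabilityTheory Filter Topology Matrix Polynomial

noncomputable section

/-- The law of a (circularly symmetric) complex Gaussian variable with mean zero and unit variance:
real and imaginary parts are independent real Gaussians with mean zero and variance `1/2`. -/
def stdComplexGaussian : Measure ℂ :=
  ((gaussianReal 0 (1 / 2)).prod (gaussianReal 0 (1 / 2))).map
    (fun p : ℝ × ℝ => (p.1 : ℂ) + (p.2 : ℂ) * Complex.I)

/-- `R` is Hermitian, its distinct eigenvalues are `ev 0 < ev 1 < ⋯ < ev (L - 1)`, and `ev i`
has multiplicity `mult i`; the multiplicities add up to the size of `R`. -/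
def HasDistinctEigenvalues {N L : ℕ} (R : Matrix (Fin N) (Fin N) ℂ)
    (ev : Fin L → ℝ) (mult : Fin L → ℕ) : Prop :=
  StrictMono ev ∧ (∀ i, 0 < mult i) ∧ ∑ i, mult i = N ∧
    ∃ hR : R.IsHermitian,
      ∀ i, (Finset.univ.filter (fun j : Fin N => hR.eigenvalues j = ev i)).card = mult i

/-- The normalized observation matrix `Y = K^{-1/2} R^{1/2} X`, where `R^{1/2}` is the Hermitian
square root of `R`. -/
def observationMatrix {N K : ℕ} (R : Matrix (Fin N) (Fin N) ℂ) (X : Matrix (Fin N) (Fin K) ℂ) :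
    Matrix (Fin N) (Fin K) ℂ :=
  ((1 / Real.sqrt (K : ℝ) : ℝ) : ℂ) • (cfc Real.sqrt R * X)

/-- The sample covariance matrix `Y Yᴴ`. -/
def sampleCov {N K : ℕ} (R : Matrix (Fin N) (Fin N) ℂ) (X : Matrix (Fin N) (Fin K) ℂ) :
    Matrix (Fin N) (Fin N) ℂ :=
  observationMatrix R X * (observationMatrix R X)ᴴ

theorem sampleCov_isHermitian {N K : ℕ} (R : Matrix (Fin N) (Fin N) ℂ)
    (X : Matrix (Fin N) (Fin K) ℂ) : (sampleCov R X).IsHermitian :=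
  Matrix.isHermitian_mul_conjTranspose_self _

/-- The Stieltjes transform of the empirical eigenvalue distribution of the sample covariance
matrix, `z ↦ N⁻¹ ∑ᵢ 1 / (σᵢ - z)`. -/
def sampleStieltjes {N K : ℕ} (R : Matrix (Fin N) (Fin N) ℂ) (X : Matrix (Fin N) (Fin K) ℂ)
    (z : ℂ) : ℂ :=
  (1 / (N : ℂ)) * ∑ i, 1 / (((sampleCov_isHermitian R X).eigenvalues i : ℂ) - z)

/-- The Stieltjes transform of a measure on the real line. -/
def stieltjesTransform (F : Measure ℝ) (z : ℂ) : ℂ :=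
  resolventTransform F z

theorem stieltjesTransform_eq (F : Measure ℝ) (z : ℂ) :
    stieltjesTransform F z = ∫ x : ℝ, 1 / ((x : ℂ) - z) ∂F := by
  simp [stieltjesTransform, resolventTransform_apply, resolvent, Ring.inverse_eq_inv']

/-- The Marchenko-Pastur type equation
`b = N⁻¹ ∑ᵢ Nᵢ / (λᵢ (1 - c - c z b) - z)` with `c = N / K`. -/
def MPEquation {L : ℕ} (N K : ℕ) (ev : Fin L → ℝ) (mult : Fin L → ℕ) (z b : ℂ) : Prop :=
  b = (1 / (N : ℂ)) * ∑ i, (mult i : ℂ) *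
    (1 / ((ev i : ℂ) * (1 - (N : ℂ) / (K : ℂ) - (N : ℂ) / (K : ℂ) * z * b) - z))

/-- `F` is a probability measure on the real line whose Stieltjes transform solves the
Marchenko-Pastur type equation off the real axis. -/
def IsMPMeasure {L : ℕ} (N K : ℕ) (ev : Fin L → ℝ) (mult : Fin L → ℕ) (F : Measure ℝ) : Prop :=
  IsProbabilityMeasure F ∧
    ∀ z : ℂ, z.im ≠ 0 → MPEquation N K ev mult z (stieltjesTransform F z)

open Classical in
/-- The deterministic equivalent `F_K` of the empirical eigenvalue distribution: the probability
measure singled out by `IsMPMeasure` (the zero measure if there is none). -/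
def mpMeasure {L : ℕ} (N K : ℕ) (ev : Fin L → ℝ) (mult : Fin L → ℕ) : Measure ℝ :=
  if h : ∃ F : Measure ℝ, IsMPMeasure N K ev mult F then h.choose else 0

/-- The deterministic equivalent `b_K`, the Stieltjes transform of `F_K`. -/
def mpStieltjes {L : ℕ} (N K : ℕ) (ev : Fin L → ℝ) (mult : Fin L → ℕ) (z : ℂ) : ℂ :=
  stieltjesTransform (mpMeasure N K ev mult) z

/-- A real polynomial of degree `m` with nonnegative coefficients. -/
def IsNonnegPoly (m : ℕ) (p : ℝ[X]) : Prop :=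
  p.natDegree = m ∧ ∀ k, 0 ≤ p.coeff k

end

/-! Write S for the square root of R, Q = (R̂ − z)⁻¹ and β = N⁻¹ E tr Q. The plan is to show that β
solves the deterministic equation up to an error O(K⁻²), and that this equation is stable, so that
its exact solution b_K is equally close to β.

Both Gaussian inputs come from one fact: for a centred Gaussian measure μ, the product μ ⊗ μ is
invariant under (x, y) ↦ (cos t x + sin t y, −sin t x + cos t y). Following f along a quarter turn
from x to y gives a Poincaré inequality (`lintegral_sub_sq_le`). The fact that a derivative along
the rotation has mean zero serves as integration by parts (`integral_rotation_deriv_eq_zero`).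

Put w = 1 − c − c z β and T = (w R − z)⁻¹. Integration by parts shows that the residual of β in the
equation is exactly z / (N K) times Cov(tr Q, tr (T R Q)). The Poincaré inequality bounds this
covariance by a multiple of N / K, with no further dependence on the dimension, and K⁻² results
(`norm_meanStieltjes_sub_mpMap_le`).

For stability one passes to the companion m = c b − (1 − c) / z, for which the equation reads ψ(m) =
z with the explicit function ψ = `companionInv`. Taking imaginary parts shows that the contraction
factor at an exact solution is less than 1 by a quantitative gap, and Cauchy–Schwarz transfers this
gap to the divided difference of ψ (`norm_sub_le_of_mpMap`). Zero residual gives uniqueness.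

Existence of F_K follows from the same estimate: repeating every eigenvalue and every sample m times
preserves the equation but sends the residual to 0, and the expected spectral measures are tight, so
any limit point solves the equation (`exists_isProbabilityMeasure_mpMap_eq`). The bound for
derivatives is Cauchy's estimate on a circle of radius |Im z| / 2. The bounds obtained have
exponents (5, 8) and (5, 9) in 1 + |z| and 1 + |Im z|⁻¹, and are then weakened to the stated
degrees. -/

open scoped ComplexConjugate ENNReal

/-! ### Moments of complex Gaussian vectors. -/

section ComplexGaussian

instance isGaussian_stdComplexGaussian : IsGaussian stdComplexGaussian := by
  have h : (fun p : ℝ × ℝ => (p.1 : ℂ) + (p.2 : ℂ) * Complex.I)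
      = Complex.equivRealProdCLM.symm := by
    ext p
    exact (Complex.equivRealProd_symm_apply p).symm
  rw [stdComplexGaussian, h]
  infer_instance

theorem integral_stdComplexGaussian {f : ℂ → ℂ} (hf : Continuous f) :
    ∫ z, f z ∂stdComplexGaussian
      = ∫ p : ℝ × ℝ, f ((p.1 : ℂ) + (p.2 : ℂ) * Complex.I)
        ∂((gaussianReal 0 (1 / 2)).prod (gaussianReal 0 (1 / 2))) := by
  rw [stdComplexGaussian, integral_map (by fun_prop) hf.aestronglyMeasurable]

theorem integral_sq_gaussianReal (v : NNReal) :
    ∫ x : ℝ, x ^ 2 ∂(gaussianReal 0 v) = v := by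
  have h := variance_fun_id_gaussianReal (μ := 0) (v := v)
  rw [variance_of_integral_eq_zero (by fun_prop) (by simp)] at h
  exact h

theorem integral_id_stdComplexGaussian : ∫ z, z ∂stdComplexGaussian = 0 := by
  rw [integral_stdComplexGaussian continuous_id']
  have h1 : Integrable (fun x : ℝ => (x : ℂ)) (gaussianReal 0 (1 / 2)) :=
    (IsGaussian.integrable_id (μ := gaussianReal 0 (1 / 2))).ofReal
  have h2 : ∫ x : ℝ, (x : ℂ) ∂gaussianReal 0 (1 / 2) = 0 := by
    rw [integral_complex_ofReal]; simp
  rw [integral_add (h1.comp_fst _) ((h1.mul_const _).comp_snd _),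
    integral_fun_fst (fun x : ℝ => (x : ℂ)),
    integral_fun_snd (fun x : ℝ => (x : ℂ) * Complex.I), integral_mul_const, h2]
  simp

theorem integrable_sq_gaussianReal_half :
    Integrable (fun x : ℝ => (x : ℂ) ^ 2) (gaussianReal 0 (1 / 2)) := by
  have := (IsGaussian.memLp_two_id (μ := gaussianReal 0 (1 / 2))).integrable_sq.ofReal (𝕜 := ℂ)
  simpa using this

theorem integral_ofReal_sq_gaussianReal_half :
    ∫ x : ℝ, (x : ℂ) ^ 2 ∂(gaussianReal 0 (1 / 2)) = 1 / 2 := by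
  have h := integral_sq_gaussianReal (1 / 2)
  have h2 := integral_complex_ofReal (μ := gaussianReal 0 (1 / 2)) (f := fun x => x ^ 2)
  rw [h] at h2
  push_cast at h2
  simpa using h2

theorem integral_mul_conj_stdComplexGaussian :
    ∫ z, z * conj z ∂stdComplexGaussian = 1 := by
  rw [integral_stdComplexGaussian (by fun_prop)]
  have e : ∀ p : ℝ × ℝ, ((p.1 : ℂ) + (p.2 : ℂ) * Complex.I) *
      conj ((p.1 : ℂ) + (p.2 : ℂ) * Complex.I) = (p.1 : ℂ) ^ 2 + (p.2 : ℂ) ^ 2 := by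
    intro p
    simp only [map_add, map_mul, Complex.conj_ofReal, Complex.conj_I]
    linear_combination -(p.2 : ℂ) ^ 2 * Complex.I_sq
  simp_rw [e]
  rw [integral_add (integrable_sq_gaussianReal_half.comp_fst _)
      (integrable_sq_gaussianReal_half.comp_snd _),
    integral_fun_fst (fun x : ℝ => (x : ℂ) ^ 2), integral_fun_snd (fun x : ℝ => (x : ℂ) ^ 2),
    integral_ofReal_sq_gaussianReal_half]
  simp
  norm_num

/-- Circular symmetry: real and imaginary parts have equal variance and are uncorrelated. This is
what later removes the terms quadratic in v without a conjugate. -/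
theorem integral_mul_self_stdComplexGaussian :
    ∫ z, z * z ∂stdComplexGaussian = 0 := by
  rw [integral_stdComplexGaussian (by fun_prop)]
  have e : ∀ p : ℝ × ℝ, ((p.1 : ℂ) + (p.2 : ℂ) * Complex.I) *
      ((p.1 : ℂ) + (p.2 : ℂ) * Complex.I)
        = ((p.1 : ℂ) ^ 2 - (p.2 : ℂ) ^ 2) + 2 * Complex.I * ((p.1 : ℂ) * (p.2 : ℂ)) := by
    intro p
    linear_combination (p.2 : ℂ) ^ 2 * Complex.I_sq
  simp_rw [e]
  have h1 : Integrable (fun x : ℝ => (x : ℂ)) (gaussianReal 0 (1 / 2)) :=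
    (IsGaussian.integrable_id (μ := gaussianReal 0 (1 / 2))).ofReal
  have h2 : ∫ x : ℝ, (x : ℂ) ∂gaussianReal 0 (1 / 2) = 0 := by
    rw [integral_complex_ofReal]; simp
  rw [integral_add, integral_sub (integrable_sq_gaussianReal_half.comp_fst _)
      (integrable_sq_gaussianReal_half.comp_snd _),
    integral_fun_fst (fun x : ℝ => (x : ℂ) ^ 2), integral_fun_snd (fun x : ℝ => (x : ℂ) ^ 2),
    integral_const_mul, integral_prod_mul (fun x : ℝ => (x : ℂ)) (fun x : ℝ => (x : ℂ)), h2]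
  · simp
  · exact (integrable_sq_gaussianReal_half.comp_fst _).sub
      (integrable_sq_gaussianReal_half.comp_snd _)
  · exact (h1.mul_prod h1).const_mul _

/-- The law of a finite family of independent standard complex Gaussian variables. -/
noncomputable def complexGaussianPi (ι : Type*) [Fintype ι] : Measure (ι → ℂ) :=
  Measure.pi fun _ => stdComplexGaussian

variable {ι : Type*} [Fintype ι]

instance isProbabilityMeasure_complexGaussianPi : IsProbabilityMeasure (complexGaussianPi ι) := by
  unfold complexGaussianPi; infer_instance

theorem hasLaw_eval_complexGaussianPi (i : ι) :
    HasLaw (fun x : ι → ℂ => x i) stdComplexGaussian (complexGaussianPi ι) :=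
  (measurePreserving_eval (fun _ : ι => stdComplexGaussian) i).hasLaw

theorem iIndepFun_eval_complexGaussianPi :
    iIndepFun (fun (i : ι) (x : ι → ℂ) => x i) (complexGaussianPi ι) :=
  iIndepFun_pi (μ := fun _ : ι => stdComplexGaussian) (X := fun _ x => x)
    (fun _ => aemeasurable_id)

instance isGaussian_complexGaussianPi : IsGaussian (complexGaussianPi ι) := by
  have h := iIndepFun.hasGaussianLaw
    (fun i => (hasLaw_eval_complexGaussianPi i).hasGaussianLaw)
    (iIndepFun_eval_complexGaussianPi (ι := ι))
  have := h.isGaussian_map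
  simpa using this

theorem integral_id_complexGaussianPi : (complexGaussianPi ι)[id] = 0 := by
  ext i
  rw [eval_integral (fun j => ?_)]
  · have := (hasLaw_eval_complexGaussianPi i).integral_eq
    simpa [integral_id_stdComplexGaussian] using this
  · exact (((ContinuousLinearMap.proj (R := ℝ) (φ := fun _ : ι => ℂ) j)).integrable_comp
      (IsGaussian.integrable_id (μ := complexGaussianPi ι)))

theorem memLp_eval_complexGaussianPi (i : ι) :
    MemLp (fun x : ι → ℂ => x i) 2 (complexGaussianPi ι) :=
  ((ContinuousLinearMap.proj (R := ℝ) (φ := fun _ : ι => ℂ) i)).comp_memLp'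
    (IsGaussian.memLp_two_id (μ := complexGaussianPi ι))

theorem integral_eval_complexGaussianPi (i : ι) :
    ∫ x, x i ∂(complexGaussianPi ι) = 0 := by
  have := (hasLaw_eval_complexGaussianPi i).integral_eq
  simpa [integral_id_stdComplexGaussian] using this

theorem integral_eval_mul_complexGaussianPi (i j : ι) :
    ∫ x, x i * x j ∂(complexGaussianPi ι) = 0 := by
  by_cases h : i = j
  · subst h
    rw [← integral_mul_self_stdComplexGaussian]
    exact (hasLaw_eval_complexGaussianPi i).integral_comp (f := fun z => z * z) (by fun_prop)
  · have hi := iIndepFun_eval_complexGaussianPi.indepFun h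
    have := hi.integral_fun_mul_eq_mul_integral
      (continuous_apply i).aestronglyMeasurable (continuous_apply j).aestronglyMeasurable
    rw [this, integral_eval_complexGaussianPi]
    simp

theorem integral_eval_mul_conj_complexGaussianPi [DecidableEq ι] (i j : ι) :
    ∫ x, x i * conj (x j) ∂(complexGaussianPi ι) = if i = j then 1 else 0 := by
  split_ifs with h
  · subst h
    rw [← integral_mul_conj_stdComplexGaussian]
    exact (hasLaw_eval_complexGaussianPi i).integral_comp (f := fun z => z * conj z) (by fun_prop)
  · have hi := (iIndepFun_eval_complexGaussianPi.indepFun h).comp measurable_id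
      (Complex.continuous_conj.measurable)
    have := hi.integral_fun_mul_eq_mul_integral
      (continuous_apply i).aestronglyMeasurable
      (Complex.continuous_conj.comp (continuous_apply j)).aestronglyMeasurable
    simp only [Function.comp_apply, id] at this
    rw [this, integral_eval_complexGaussianPi]
    simp

end ComplexGaussian

/-! ### Rotation invariance: Poincaré inequality and integration by parts. -/

section Rotation

section

variable {E : Type*} [NormedAddCommGroup E] [NormedSpace ℝ E]

/-- The rotation of angle `t` in `E × E`. -/
noncomputable def gaussRotation (t : ℝ) (p : E × E) : E × E :=
  (Real.cos t • p.1 + Real.sin t • p.2, -Real.sin t • p.1 + Real.cos t • p.2)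

theorem continuous_rotation_uncurry :
    Continuous fun q : ℝ × (E × E) => gaussRotation q.1 q.2 := by
  unfold gaussRotation
  fun_prop

theorem continuous_rotation_left (p : E × E) : Continuous fun t : ℝ => gaussRotation t p :=
  continuous_rotation_uncurry.comp (by fun_prop : Continuous fun t : ℝ => (t, p))

theorem continuous_rotation_right (t : ℝ) : Continuous (gaussRotation (E := E) t) :=
  continuous_rotation_uncurry.comp (by fun_prop : Continuous fun p : E × E => (t, p))

theorem rotation_zero_apply (p : E × E) : gaussRotation 0 p = p := by
  simp [gaussRotation]

theorem rotation_pi_div_two_apply (p : E × E) :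
    gaussRotation (Real.pi / 2) p = (p.2, -p.1) := by
  simp [gaussRotation]

end

variable {E : Type*} [NormedAddCommGroup E] [NormedSpace ℝ E] [MeasurableSpace E] [BorelSpace E]
  [CompleteSpace E] [SecondCountableTopology E] {μ : Measure E} [IsGaussian μ]

theorem measurePreserving_rotation (hμ : μ[id] = 0) (θ : ℝ) :
    MeasurePreserving (gaussRotation θ) (μ.prod μ) (μ.prod μ) := by
  refine ⟨(continuous_rotation_right θ).measurable, ?_⟩
  conv_rhs => rw [← IsGaussian.map_rotation_eq_self hμ θ]
  rfl

/-- A Gaussian Poincaré inequality: the oscillation of `f` under a centred Gaussian measure is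
controlled by its directional derivative `G (x, y)` at `x` in the direction `y`. -/
theorem lintegral_sub_sq_le (hμ : μ[id] = 0) {f : E → ℂ} {G : E × E → ℂ} (hG : Continuous G)
    (hd : ∀ (p : E × E) (t : ℝ), HasDerivAt (fun s => f (gaussRotation s p).1)
      (G (gaussRotation t p)) t) :
    ∫⁻ p, ‖f p.2 - f p.1‖ₑ ^ 2 ∂(μ.prod μ)
      ≤ ENNReal.ofReal ((Real.pi / 2) ^ 2) * ∫⁻ p, ‖G p‖ₑ ^ 2 ∂(μ.prod μ) := by
  have hpi : (0 : ℝ) ≤ Real.pi / 2 := by positivity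
  have key : ∀ p : E × E, ‖f p.2 - f p.1‖ₑ ^ 2 ≤ ENNReal.ofReal (Real.pi / 2) *
      ∫⁻ t in Set.Ioc 0 (Real.pi / 2), ‖G (gaussRotation t p)‖ₑ ^ 2 := by
    intro p
    have hc : Continuous fun t : ℝ => G (gaussRotation t p) :=
      hG.comp (continuous_rotation_left p)
    have h1 := intervalIntegral.integral_eq_sub_of_hasDerivAt
      (a := 0) (b := Real.pi / 2) (f := fun t => f (gaussRotation t p).1)
      (f' := fun t => G (gaussRotation t p)) (fun t _ => hd p t) (hc.intervalIntegrable _ _)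
    rw [rotation_zero_apply, rotation_pi_div_two_apply] at h1
    simp only at h1
    rw [← h1, intervalIntegral.integral_of_le hpi]
    have h2 := enorm_integral_le_lintegral_enorm
      (μ := volume.restrict (Set.Ioc 0 (Real.pi / 2)))
      (fun t : ℝ => G (gaussRotation t p))
    -- Cauchy–Schwarz against the constant 1 on an interval of length π/2. The time integration
    -- further down contributes the second factor π/2.
    have h3 := ENNReal.lintegral_mul_le_Lp_mul_Lq (volume.restrict (Set.Ioc 0 (Real.pi / 2)))
      (Real.HolderConjugate.two_two) (f := fun _ => 1)
      (g := fun t : ℝ => ‖G (gaussRotation t p)‖ₑ) (by fun_prop)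
      hc.enorm.measurable.aemeasurable
    simp only [Pi.mul_apply, one_mul, ENNReal.one_rpow, lintegral_const, Measure.restrict_apply,
      MeasurableSet.univ, Set.univ_inter, Real.volume_Ioc, sub_zero] at h3
    have h4 := pow_le_pow_left' (h2.trans h3) 2
    refine h4.trans (le_of_eq ?_)
    rw [mul_pow, ← ENNReal.rpow_natCast, ← ENNReal.rpow_natCast, ← ENNReal.rpow_mul,
      ← ENNReal.rpow_mul]
    norm_num
  calc ∫⁻ p, ‖f p.2 - f p.1‖ₑ ^ 2 ∂(μ.prod μ)
      ≤ ∫⁻ p, ENNReal.ofReal (Real.pi / 2) *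
        (∫⁻ t : ℝ in Set.Ioc 0 (Real.pi / 2), ‖G (gaussRotation t p)‖ₑ ^ 2)
          ∂(μ.prod μ) := lintegral_mono key
    _ = ENNReal.ofReal (Real.pi / 2) * ∫⁻ t : ℝ in Set.Ioc 0 (Real.pi / 2), (∫⁻ p,
        ‖G (gaussRotation t p)‖ₑ ^ 2 ∂(μ.prod μ)) := by
      have hc : Continuous fun q : (E × E) × ℝ =>
          ‖G (gaussRotation q.2 q.1)‖ₑ ^ 2 :=
        ENNReal.continuous_pow 2 |>.comp
          (hG.comp (continuous_rotation_uncurry.comp continuous_swap)).enorm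
      rw [lintegral_const_mul' _ _ (by simp)]
      congr 1
      exact lintegral_lintegral_swap
        (f := fun p (t : ℝ) => ‖G (gaussRotation t p)‖ₑ ^ 2) hc.measurable.aemeasurable
    _ = ENNReal.ofReal (Real.pi / 2) * ∫⁻ _t : ℝ in Set.Ioc 0 (Real.pi / 2), (∫⁻ p,
        ‖G p‖ₑ ^ 2 ∂(μ.prod μ)) := by
      congr 2
      funext t
      exact (measurePreserving_rotation hμ t).lintegral_comp
        (f := fun p => ‖G p‖ₑ ^ 2) (hG.enorm.measurable.pow_const 2)
    _ = _ := by
      simp only [lintegral_const, Measure.restrict_apply, MeasurableSet.univ, Set.univ_inter,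
        Real.volume_Ioc, sub_zero]
      rw [sq, ENNReal.ofReal_mul hpi]
      ring

/-- Integration by parts for a centred Gaussian measure, stated through the rotational invariance
of its square: a rotational derivative has mean zero. -/
theorem integral_rotation_deriv_eq_zero (hμ : μ[id] = 0) {H H' : E × E → ℂ}
    (hH : Integrable H (μ.prod μ)) (hH'c : Continuous H') (hH' : Integrable H' (μ.prod μ))
    (hd : ∀ (p : E × E) (t : ℝ), HasDerivAt (fun s => H (gaussRotation s p))
      (H' (gaussRotation t p)) t) :
    ∫ p, H' p ∂(μ.prod μ) = 0 := by
  have hrot : ∀ t : ℝ, ∫ p, H' (gaussRotation t p) ∂(μ.prod μ)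
      = ∫ p, H' p ∂(μ.prod μ) := fun t => by
    have h := (measurePreserving_rotation hμ t).map_eq
    conv_rhs => rw [← h, integral_map (continuous_rotation_right t).aemeasurable hH'c.aestronglyMeasurable]
  have hcomp : Continuous fun q : ℝ × (E × E) => H' (gaussRotation q.1 q.2) :=
    hH'c.comp continuous_rotation_uncurry
  have hint : Integrable (Function.uncurry fun (t : ℝ) (p : E × E) =>
      H' (gaussRotation t p))
      ((volume.restrict (Set.Ioc 0 1)).prod (μ.prod μ)) := by
    have hm : AEStronglyMeasurable (Function.uncurry fun (t : ℝ) (p : E × E) =>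
        H' (gaussRotation t p)) ((volume.restrict (Set.Ioc 0 1)).prod (μ.prod μ)) :=
      Continuous.aestronglyMeasurable hcomp
    rw [integrable_prod_iff hm]
    constructor
    · exact ae_of_all _ fun t => (measurePreserving_rotation hμ t).integrable_comp_of_integrable hH'
    · have : ∀ t : ℝ, ∫ p, ‖Function.uncurry (fun (t : ℝ) (p : E × E) =>
          H' (gaussRotation t p)) (t, p)‖ ∂(μ.prod μ)
          = ∫ p, ‖H' p‖ ∂(μ.prod μ) := fun t => by
        have h := (measurePreserving_rotation hμ t).map_eq
        conv_rhs => rw [← h, integral_map (continuous_rotation_right t).aemeasurable hH'c.norm.aestronglyMeasurable]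
        rfl
      simp_rw [this]
      exact integrable_const _
  have h1 : ∀ p : E × E, ∫ t in Set.Ioc (0 : ℝ) 1, H' (gaussRotation t p)
      = H (gaussRotation 1 p) - H p := by
    intro p
    have hc : Continuous fun t : ℝ => H' (gaussRotation t p) :=
      hH'c.comp (continuous_rotation_left p)
    have h1 := intervalIntegral.integral_eq_sub_of_hasDerivAt
      (a := 0) (b := 1) (f := fun t => H (gaussRotation t p))
      (f' := fun t => H' (gaussRotation t p)) (fun t _ => hd p t) (hc.intervalIntegrable _ _)
    rw [rotation_zero_apply] at h1
    rw [← h1, intervalIntegral.integral_of_le zero_le_one]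
  -- The interval [0, 1] is arbitrary. By invariance the time average of the mean of H' is that mean
  -- itself, while the fundamental theorem of calculus makes it a difference of two equal means of
  -- H.
  have h2 := integral_integral_swap hint
  simp_rw [hrot, h1] at h2
  have hH1 : Integrable (fun p => H (gaussRotation 1 p)) (μ.prod μ) :=
    (measurePreserving_rotation hμ 1).integrable_comp_of_integrable hH
  rw [integral_sub hH1 hH] at h2
  have h3 : ∫ p, H (gaussRotation 1 p) ∂(μ.prod μ) = ∫ p, H p ∂(μ.prod μ) := by
    have h := (measurePreserving_rotation hμ 1).map_eq
    conv_rhs => rw [← h]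
    rw [integral_map (continuous_rotation_right 1).aemeasurable
      (by rw [h]; exact hH.aestronglyMeasurable)]
  rw [h3] at h2
  simpa using h2

/-- Gaussian measures have moments of all orders, so polynomial growth suffices. The functions in
the integration by parts are not bounded. -/
theorem integrable_of_norm_le_pow {F : E × E → ℂ} (hF : Continuous F) (C : ℝ) (k : ℕ)
    (h : ∀ p, ‖F p‖ ≤ C * (1 + ‖p‖) ^ k) : Integrable F (μ.prod μ) := by
  have h0 : MemLp (fun p : E × E => ‖p‖) k (μ.prod μ) :=
    (IsGaussian.memLp_id (μ.prod μ) k (by simp)).norm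
  have hm : MemLp (fun p : E × E => 1 + ‖p‖) k (μ.prod μ) := (memLp_const (1 : ℝ)).add h0
  have hi : Integrable (fun p : E × E => (1 + ‖p‖) ^ k) (μ.prod μ) := by
    refine hm.integrable_norm_pow'.congr (ae_of_all _ fun p => ?_)
    simp only
    rw [Real.norm_of_nonneg (by positivity)]
  exact Integrable.mono' (hi.const_mul C) hF.aestronglyMeasurable (ae_of_all _ h)

end Rotation

open scoped Matrix.Norms.L2Operator

/-! ### Matrices diagonal in a fixed unitary basis. -/

section UnitaryDiagonal

variable {ι : Type*} [Fintype ι] [DecidableEq ι]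

/-- The normal matrix with eigenvectors the columns of `U` and eigenvalues `d`. -/
noncomputable def unitaryDiagonal (U : Matrix.unitaryGroup ι ℂ) (d : ι → ℂ) : Matrix ι ι ℂ :=
  (U : Matrix ι ι ℂ) * diagonal d * star (U : Matrix ι ι ℂ)

variable (U : Matrix.unitaryGroup ι ℂ)

theorem unitaryDiagonal_mul (d e : ι → ℂ) :
    unitaryDiagonal U d * unitaryDiagonal U e = unitaryDiagonal U (fun i => d i * e i) := by
  have h : star (U : Matrix ι ι ℂ) * (U : Matrix ι ι ℂ) = 1 := Unitary.coe_star_mul_self U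
  unfold unitaryDiagonal
  rw [← diagonal_mul_diagonal]
  calc _ = (U : Matrix ι ι ℂ) * diagonal d * (star (U : Matrix ι ι ℂ) * (U : Matrix ι ι ℂ))
        * diagonal e * star (U : Matrix ι ι ℂ) := by simp only [Matrix.mul_assoc]
    _ = _ := by rw [h]; simp only [Matrix.mul_assoc, Matrix.mul_one]

theorem unitaryDiagonal_one : unitaryDiagonal U (fun _ => 1) = 1 := by
  have h : (U : Matrix ι ι ℂ) * star (U : Matrix ι ι ℂ) = 1 := Unitary.coe_mul_star_self U
  unfold unitaryDiagonal
  rw [diagonal_one, Matrix.mul_one, h]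

theorem unitaryDiagonal_sub (d e : ι → ℂ) :
    unitaryDiagonal U d - unitaryDiagonal U e = unitaryDiagonal U (fun i => d i - e i) := by
  unfold unitaryDiagonal
  rw [← Matrix.sub_mul, ← Matrix.mul_sub, diagonal_sub]

theorem smul_unitaryDiagonal (c : ℂ) (d : ι → ℂ) :
    c • unitaryDiagonal U d = unitaryDiagonal U (fun i => c * d i) := by
  unfold unitaryDiagonal
  rw [← Matrix.smul_mul, ← Matrix.mul_smul, ← diagonal_smul]
  rfl

theorem trace_unitaryDiagonal (d : ι → ℂ) : (unitaryDiagonal U d).trace = ∑ i, d i := by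
  have h : star (U : Matrix ι ι ℂ) * (U : Matrix ι ι ℂ) = 1 := Unitary.coe_star_mul_self U
  unfold unitaryDiagonal
  rw [Matrix.trace_mul_comm, ← Matrix.mul_assoc, h, Matrix.one_mul, trace_diagonal]

theorem norm_unitaryDiagonal_le (d : ι → ℂ) {C : ℝ} (hC : 0 ≤ C) (h : ∀ i, ‖d i‖ ≤ C) :
    ‖unitaryDiagonal U d‖ ≤ C := by
  unfold unitaryDiagonal
  rw [← Unitary.coe_star, CStarRing.norm_mul_coe_unitary, CStarRing.norm_coe_unitary_mul,
    l2_opNorm_diagonal]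
  exact (pi_norm_le_iff_of_nonneg hC).2 h

theorem conjTranspose_unitaryDiagonal (d : ι → ℂ) :
    (unitaryDiagonal U d)ᴴ = unitaryDiagonal U (fun i => conj (d i)) := by
  unfold unitaryDiagonal
  simp only [conjTranspose_mul, diagonal_conjTranspose, star_eq_conjTranspose,
    conjTranspose_conjTranspose, Matrix.mul_assoc]
  rfl

theorem unitaryDiagonal_sub_smul_one_mul_inv {d : ι → ℂ} {z : ℂ} (h : ∀ i, d i - z ≠ 0) :
    (unitaryDiagonal U d - z • 1) * unitaryDiagonal U (fun i => (d i - z)⁻¹) = 1 := by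
  rw [← unitaryDiagonal_one U, smul_unitaryDiagonal, unitaryDiagonal_sub, unitaryDiagonal_mul]
  congr 1
  funext i
  rw [mul_one, mul_inv_cancel₀ (h i)]

theorem Matrix.IsHermitian.eq_unitaryDiagonal {A : Matrix ι ι ℂ} (hA : A.IsHermitian) :
    A = unitaryDiagonal hA.eigenvectorUnitary (fun i => (hA.eigenvalues i : ℂ)) := by
  conv_lhs => rw [hA.spectral_theorem]
  rfl

theorem Matrix.IsHermitian.cfc_eq_unitaryDiagonal {A : Matrix ι ι ℂ} (hA : A.IsHermitian)
    (f : ℝ → ℝ) :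
    cfc f A = unitaryDiagonal hA.eigenvectorUnitary (fun i => (f (hA.eigenvalues i) : ℂ)) := by
  rw [hA.cfc_eq]
  rfl

end UnitaryDiagonal

/-! ### Resolvents of Hermitian matrices. -/

section Resolvent

variable {ι : Type*} [Fintype ι] [DecidableEq ι]

/-- The resolvent `(A - z)⁻¹` of a square matrix. -/
noncomputable def matResolvent (A : Matrix ι ι ℂ) (z : ℂ) : Matrix ι ι ℂ := (A - z • 1)⁻¹

theorem ofReal_sub_ne_zero_of_im_ne_zero {z : ℂ} (hz : z.im ≠ 0) (a : ℝ) : (a : ℂ) - z ≠ 0 := by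
  intro h
  have := congrArg Complex.im h
  simp at this
  exact hz this

theorem norm_inv_ofReal_sub_le {z : ℂ} (hz : z.im ≠ 0) (a : ℝ) :
    ‖((a : ℂ) - z)⁻¹‖ ≤ |z.im|⁻¹ := by
  have h : 0 < |z.im| := abs_pos.2 hz
  rw [norm_inv]
  gcongr
  simpa using Complex.abs_im_le_norm ((a : ℂ) - z)

variable {A : Matrix ι ι ℂ} {z : ℂ}

theorem matResolvent_eq_unitaryDiagonal (hA : A.IsHermitian) (hz : z.im ≠ 0) :
    matResolvent A z = unitaryDiagonal hA.eigenvectorUnitary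
      (fun i => ((hA.eigenvalues i : ℂ) - z)⁻¹) := by
  unfold matResolvent
  refine Matrix.inv_eq_right_inv ?_
  conv_lhs => enter [1, 1]; rw [hA.eq_unitaryDiagonal]
  exact unitaryDiagonal_sub_smul_one_mul_inv _ fun i => ofReal_sub_ne_zero_of_im_ne_zero hz _

theorem sub_smul_one_mul_matResolvent (hA : A.IsHermitian) (hz : z.im ≠ 0) :
    (A - z • 1) * matResolvent A z = 1 := by
  rw [matResolvent_eq_unitaryDiagonal hA hz]
  conv_lhs => enter [1, 1]; rw [hA.eq_unitaryDiagonal]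
  exact unitaryDiagonal_sub_smul_one_mul_inv _ fun i => ofReal_sub_ne_zero_of_im_ne_zero hz _

theorem isUnit_sub_smul_one (hA : A.IsHermitian) (hz : z.im ≠ 0) : IsUnit (A - z • 1) :=
  IsUnit.of_mul_eq_one _ (sub_smul_one_mul_matResolvent hA hz)

theorem matResolvent_mul_sub_smul_one (hA : A.IsHermitian) (hz : z.im ≠ 0) :
    matResolvent A z * (A - z • 1) = 1 :=
  mul_eq_one_comm.1 (sub_smul_one_mul_matResolvent hA hz)

/-- This identity makes A times its resolvent bounded in terms of z alone, so no bound on the norm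
of the random matrix A is ever needed in the quantitative estimates. -/
theorem mul_matResolvent (hA : A.IsHermitian) (hz : z.im ≠ 0) :
    A * matResolvent A z = 1 + z • matResolvent A z := by
  rw [← sub_smul_one_mul_matResolvent hA hz, Matrix.sub_mul, Matrix.smul_mul, Matrix.one_mul,
    sub_add_cancel]

theorem matResolvent_mul (hA : A.IsHermitian) (hz : z.im ≠ 0) :
    matResolvent A z * A = 1 + z • matResolvent A z := by
  rw [← matResolvent_mul_sub_smul_one hA hz, Matrix.mul_sub, Matrix.mul_smul, Matrix.mul_one,
    sub_add_cancel]

theorem norm_matResolvent_le (hA : A.IsHermitian) (hz : z.im ≠ 0) :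
    ‖matResolvent A z‖ ≤ |z.im|⁻¹ := by
  rw [matResolvent_eq_unitaryDiagonal hA hz]
  exact norm_unitaryDiagonal_le _ _ (by positivity) fun i => norm_inv_ofReal_sub_le hz _

theorem trace_matResolvent (hA : A.IsHermitian) (hz : z.im ≠ 0) :
    (matResolvent A z).trace = ∑ i, ((hA.eigenvalues i : ℂ) - z)⁻¹ := by
  rw [matResolvent_eq_unitaryDiagonal hA hz, trace_unitaryDiagonal]

theorem hasDerivAt_matResolvent {A : ℝ → Matrix ι ι ℂ} {A' : Matrix ι ι ℂ} {t : ℝ}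
    (hd : HasDerivAt A A' t) (hA : (A t).IsHermitian) (hz : z.im ≠ 0) :
    HasDerivAt (fun s => matResolvent (A s) z)
      (-(matResolvent (A t) z * A' * matResolvent (A t) z)) t := by
  obtain ⟨u, hu⟩ := isUnit_sub_smul_one hA hz
  have h1 : HasDerivAt (fun s => A s - z • (1 : Matrix ι ι ℂ)) A' t := hd.sub_const _
  have h2 := hasFDerivAt_ringInverse (𝕜 := ℝ) u
  rw [hu] at h2
  have h3 := h2.comp_hasDerivAt t h1
  have hinv : (↑u⁻¹ : Matrix ι ι ℂ) = matResolvent (A t) z := by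
    rw [matResolvent, ← hu, Matrix.coe_units_inv]
  simp only [matResolvent, Matrix.nonsing_inv_eq_ringInverse] at hinv ⊢
  refine h3.congr_deriv ?_
  simp [hinv]

theorem continuous_matResolvent {X : Type*} [TopologicalSpace X] {A : X → Matrix ι ι ℂ}
    (hc : Continuous A) (hA : ∀ x, (A x).IsHermitian) (hz : z.im ≠ 0) :
    Continuous fun x => matResolvent (A x) z := by
  rw [continuous_iff_continuousAt]
  intro x
  obtain ⟨u, hu⟩ := isUnit_sub_smul_one (hA x) hz
  have h2 := NormedRing.inverse_continuousAt u
  rw [hu] at h2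
  simp only [matResolvent, Matrix.nonsing_inv_eq_ringInverse]
  exact ContinuousAt.comp (f := fun x => A x - z • (1 : Matrix ι ι ℂ)) h2
    (hc.sub continuous_const).continuousAt

omit [DecidableEq ι] in
theorem norm_apply_le_l2_opNorm {κ : Type*} [Fintype κ] [DecidableEq κ]
    (B : Matrix ι κ ℂ) (i : ι) (j : κ) : ‖B i j‖ ≤ ‖B‖ := by
  have h := l2_opNorm_mulVec B (EuclideanSpace.single j 1)
  rw [PiLp.norm_single, norm_one, mul_one] at h
  refine le_trans ?_ h
  have h2 := PiLp.norm_apply_le (WithLp.toLp 2 (B *ᵥ (EuclideanSpace.single j (1 : ℂ)).ofLp)) i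
  refine le_trans (le_of_eq ?_) h2
  simp

theorem norm_trace_le (B : Matrix ι ι ℂ) : ‖B.trace‖ ≤ Fintype.card ι * ‖B‖ := by
  refine (norm_sum_le _ _).trans ?_
  refine (Finset.sum_le_sum fun i _ => norm_apply_le_l2_opNorm B i i).trans ?_
  simp

end Resolvent

/-! ### Second moments of traces in a Gaussian matrix. -/

section MatrixMoments

variable {ι κ : Type*}

/-- The matrix with entries the coordinates of `x`. -/
def pairMatrix (x : ι × κ → ℂ) : Matrix ι κ ℂ := fun i j => x (i, j)

theorem pairMatrix_add (x y : ι × κ → ℂ) : pairMatrix (x + y) = pairMatrix x + pairMatrix y := rfl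

theorem pairMatrix_smul (c : ℝ) (x : ι × κ → ℂ) : pairMatrix (c • x) = c • pairMatrix x := rfl

theorem continuous_pairMatrix : Continuous (pairMatrix : (ι × κ → ℂ) → Matrix ι κ ℂ) := by
  unfold pairMatrix
  fun_prop

variable [Fintype ι] [Fintype κ]

theorem integrable_eval_mul_conj (p q : ι × κ) :
    Integrable (fun x : ι × κ → ℂ => x p * conj (x q)) (complexGaussianPi (ι × κ)) :=
  (memLp_eval_complexGaussianPi p).integrable_mul (memLp_eval_complexGaussianPi q).star

theorem integrable_eval_mul (p q : ι × κ) :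
    Integrable (fun x : ι × κ → ℂ => x p * x q) (complexGaussianPi (ι × κ)) :=
  (memLp_eval_complexGaussianPi p).integrable_mul (memLp_eval_complexGaussianPi q)

theorem trace_mul_pairMatrix_mul_conjTranspose (P : Matrix ι ι ℂ) (C : Matrix κ κ ℂ)
    (x : ι × κ → ℂ) : (P * pairMatrix x * C * (pairMatrix x)ᴴ).trace
      = ∑ a, ∑ l, ∑ k, ∑ b, P a b * C k l * (x (b, k) * conj (x (a, l))) := by
  simp only [Matrix.trace, Matrix.diag_apply, Matrix.mul_apply, Finset.sum_mul,
    conjTranspose_apply, pairMatrix]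
  refine Finset.sum_congr rfl fun a _ => Finset.sum_congr rfl fun l _ =>
    Finset.sum_congr rfl fun k _ => Finset.sum_congr rfl fun b _ => ?_
  rw [← starRingEnd_apply]
  ring

theorem integrable_trace_mul_pairMatrix_mul_conjTranspose (P : Matrix ι ι ℂ) (C : Matrix κ κ ℂ) :
    Integrable (fun x => (P * pairMatrix x * C * (pairMatrix x)ᴴ).trace)
      (complexGaussianPi (ι × κ)) := by
  simp_rw [trace_mul_pairMatrix_mul_conjTranspose]
  exact integrable_finsetSum _ fun a _ => integrable_finsetSum _ fun l _ =>
    integrable_finsetSum _ fun k _ => integrable_finsetSum _ fun b _ =>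
    (integrable_eval_mul_conj _ _).const_mul _

theorem integral_trace_mul_pairMatrix_mul_conjTranspose (P : Matrix ι ι ℂ) (C : Matrix κ κ ℂ) :
    ∫ x, (P * pairMatrix x * C * (pairMatrix x)ᴴ).trace ∂(complexGaussianPi (ι × κ))
      = P.trace * C.trace := by
  classical
  simp_rw [trace_mul_pairMatrix_mul_conjTranspose]
  have hi : ∀ a l k b, Integrable (fun x : ι × κ → ℂ =>
      P a b * C k l * (x (b, k) * conj (x (a, l)))) (complexGaussianPi (ι × κ)) :=
    fun a l k b => (integrable_eval_mul_conj _ _).const_mul _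
  rw [integral_finsetSum _ fun a _ => integrable_finsetSum _ fun l _ =>
    integrable_finsetSum _ fun k _ => integrable_finsetSum _ fun b _ => hi a l k b]
  simp_rw [Matrix.trace, Matrix.diag_apply, Finset.sum_mul_sum]
  refine Finset.sum_congr rfl fun a _ => ?_
  rw [integral_finsetSum _ fun l _ =>
    integrable_finsetSum _ fun k _ => integrable_finsetSum _ fun b _ => hi a l k b]
  refine Finset.sum_congr rfl fun l _ => ?_
  rw [integral_finsetSum _ fun k _ => integrable_finsetSum _ fun b _ => hi a l k b,
    Finset.sum_eq_single l, integral_finsetSum _ fun b _ => hi a l l b, Finset.sum_eq_single a]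
  · rw [integral_const_mul, integral_eval_mul_conj_complexGaussianPi]
    simp
  · intro b _ hb
    rw [integral_const_mul, integral_eval_mul_conj_complexGaussianPi]
    simp [hb]
  · simp
  · intro k _ hk
    rw [integral_finsetSum _ fun b _ => hi a l k b]
    refine Finset.sum_eq_zero fun b _ => ?_
    rw [integral_const_mul, integral_eval_mul_conj_complexGaussianPi]
    simp [hk]
  · simp

theorem trace_mul_pairMatrix_mul_pairMatrix (P : Matrix κ ι ℂ) (D : Matrix κ ι ℂ)
    (x : ι × κ → ℂ) : (P * pairMatrix x * D * pairMatrix x).trace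
      = ∑ a, ∑ l, ∑ k, ∑ b, P a b * D k l * (x (b, k) * x (l, a)) := by
  simp only [Matrix.trace, Matrix.diag_apply, Matrix.mul_apply, Finset.sum_mul, pairMatrix]
  refine Finset.sum_congr rfl fun a _ => Finset.sum_congr rfl fun l _ =>
    Finset.sum_congr rfl fun k _ => Finset.sum_congr rfl fun b _ => ?_
  ring

theorem integrable_trace_mul_pairMatrix_mul_pairMatrix (P : Matrix κ ι ℂ) (D : Matrix κ ι ℂ) :
    Integrable (fun x => (P * pairMatrix x * D * pairMatrix x).trace)
      (complexGaussianPi (ι × κ)) := by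
  simp_rw [trace_mul_pairMatrix_mul_pairMatrix]
  exact integrable_finsetSum _ fun a _ => integrable_finsetSum _ fun l _ =>
    integrable_finsetSum _ fun k _ => integrable_finsetSum _ fun b _ =>
    (integrable_eval_mul _ _).const_mul _

/-- Without a conjugate every pair of entries, equal or not, has E[x_p x_q] = 0. -/
theorem integral_trace_mul_pairMatrix_mul_pairMatrix (P : Matrix κ ι ℂ) (D : Matrix κ ι ℂ) :
    ∫ x, (P * pairMatrix x * D * pairMatrix x).trace ∂(complexGaussianPi (ι × κ)) = 0 := by
  simp_rw [trace_mul_pairMatrix_mul_pairMatrix]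
  have hi : ∀ a l k b, Integrable (fun x : ι × κ → ℂ =>
      P a b * D k l * (x (b, k) * x (l, a))) (complexGaussianPi (ι × κ)) :=
    fun a l k b => (integrable_eval_mul _ _).const_mul _
  rw [integral_finsetSum _ fun a _ => integrable_finsetSum _ fun l _ =>
    integrable_finsetSum _ fun k _ => integrable_finsetSum _ fun b _ => hi a l k b]
  refine Finset.sum_eq_zero fun a _ => ?_
  rw [integral_finsetSum _ fun l _ =>
    integrable_finsetSum _ fun k _ => integrable_finsetSum _ fun b _ => hi a l k b]
  refine Finset.sum_eq_zero fun l _ => ?_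
  rw [integral_finsetSum _ fun k _ => integrable_finsetSum _ fun b _ => hi a l k b]
  refine Finset.sum_eq_zero fun k _ => ?_
  rw [integral_finsetSum _ fun b _ => hi a l k b]
  refine Finset.sum_eq_zero fun b _ => ?_
  rw [integral_const_mul, integral_eval_mul_complexGaussianPi, mul_zero]

theorem trace_mul_pairMatrix (B : Matrix κ ι ℂ) (x : ι × κ → ℂ) :
    (B * pairMatrix x).trace = ∑ a, ∑ b, B a b * x (b, a) := by
  simp only [Matrix.trace, Matrix.diag_apply, Matrix.mul_apply, pairMatrix]

theorem memLp_trace_mul_pairMatrix (B : Matrix κ ι ℂ) :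
    MemLp (fun x => (B * pairMatrix x).trace) 2 (complexGaussianPi (ι × κ)) := by
  simp_rw [trace_mul_pairMatrix]
  exact memLp_finsetSum _ fun a _ => memLp_finsetSum _ fun b _ =>
    (memLp_eval_complexGaussianPi _).const_mul _

/-- The entries are orthonormal in L², so a linear form has second moment equal to the squared
Hilbert–Schmidt norm of its coefficients. -/
theorem integral_normSq_trace_mul_pairMatrix (B : Matrix κ ι ℂ) :
    ∫ x, ((B * pairMatrix x).trace * conj (B * pairMatrix x).trace) ∂(complexGaussianPi (ι × κ))
      = (B * Bᴴ).trace := by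
  classical
  have hi : ∀ a b c d, Integrable (fun x : ι × κ → ℂ =>
      B a b * conj (B c d) * (x (b, a) * conj (x (d, c)))) (complexGaussianPi (ι × κ)) :=
    fun a l k b => (integrable_eval_mul_conj _ _).const_mul _
  have e : ∀ x : ι × κ → ℂ, (B * pairMatrix x).trace * conj (B * pairMatrix x).trace
      = ∑ a, ∑ b, ∑ c, ∑ d, B a b * conj (B c d) * (x (b, a) * conj (x (d, c))) := by
    intro x
    rw [trace_mul_pairMatrix]
    simp only [map_sum, map_mul, Finset.sum_mul_sum]
    refine Finset.sum_congr rfl fun a _ => ?_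
    rw [Finset.sum_comm]
    refine Finset.sum_congr rfl fun b _ => Finset.sum_congr rfl fun c _ =>
      Finset.sum_congr rfl fun d _ => ?_
    ring
  simp_rw [e]
  rw [integral_finsetSum _ fun a _ => integrable_finsetSum _ fun l _ =>
    integrable_finsetSum _ fun k _ => integrable_finsetSum _ fun b _ => hi a l k b]
  simp_rw [Matrix.trace, Matrix.diag_apply, Matrix.mul_apply, conjTranspose_apply]
  refine Finset.sum_congr rfl fun a _ => ?_
  rw [integral_finsetSum _ fun l _ =>
    integrable_finsetSum _ fun k _ => integrable_finsetSum _ fun b _ => hi a l k b]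
  refine Finset.sum_congr rfl fun b _ => ?_
  rw [integral_finsetSum _ fun k _ => integrable_finsetSum _ fun d _ => hi a b k d,
    Finset.sum_eq_single a, integral_finsetSum _ fun d _ => hi a b a d, Finset.sum_eq_single b]
  · rw [integral_const_mul, integral_eval_mul_conj_complexGaussianPi]
    simp
  · intro d _ hd
    rw [integral_const_mul, integral_eval_mul_conj_complexGaussianPi]
    simp [hd.symm]
  · simp
  · intro k _ hk
    rw [integral_finsetSum _ fun d _ => hi a b k d]
    refine Finset.sum_eq_zero fun d _ => ?_
    rw [integral_const_mul, integral_eval_mul_conj_complexGaussianPi]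
    simp [hk.symm]
  · simp

theorem lintegral_enorm_sq_trace_mul_pairMatrix (B : Matrix κ ι ℂ) :
    ∫⁻ x, ‖(B * pairMatrix x).trace‖ₑ ^ 2 ∂(complexGaussianPi (ι × κ))
      = ENNReal.ofReal ((B * Bᴴ).trace).re := by
  have h1 : ∀ x : ι × κ → ℂ, ‖(B * pairMatrix x).trace‖ₑ ^ 2
      = ENNReal.ofReal (‖(B * pairMatrix x).trace‖ ^ 2) := fun x => by
    rw [← ofReal_norm, ENNReal.ofReal_pow (norm_nonneg _)]
  have hint := (memLp_trace_mul_pairMatrix B).integrable_norm_pow (by norm_num)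
  simp_rw [h1]
  rw [← ofReal_integral_eq_lintegral_ofReal (by simpa using hint)
    (ae_of_all _ fun x => by positivity), ← integral_normSq_trace_mul_pairMatrix]
  congr 1
  simp_rw [Complex.mul_conj, Complex.normSq_eq_norm_sq]
  rw [integral_complex_ofReal, Complex.ofReal_re]

theorem lintegral_enorm_sq_trace_conjTranspose_mul (C : Matrix ι κ ℂ) :
    ∫⁻ x, ‖((pairMatrix x)ᴴ * C).trace‖ₑ ^ 2 ∂(complexGaussianPi (ι × κ))
      = ENNReal.ofReal ((Cᴴ * C).trace).re := by
  have h := lintegral_enorm_sq_trace_mul_pairMatrix Cᴴ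
  rw [conjTranspose_conjTranspose] at h
  rw [← h]
  congr 1
  funext x
  have : ((pairMatrix x)ᴴ * C) = (Cᴴ * pairMatrix x)ᴴ := by
    rw [conjTranspose_mul, conjTranspose_conjTranspose]
  rw [this, trace_conjTranspose, ← ofReal_norm, ← ofReal_norm, norm_star]

end MatrixMoments

/-! ### The sample covariance matrix and its derivative along rotations. -/

section GramCov

variable {ι κ : Type*} [Fintype κ] [Fintype ι]

/-- The sesquilinear version `K⁻¹ S x yᴴ S` of the sample covariance matrix. -/
noncomputable def gramCov (S : Matrix ι ι ℂ) (x y : ι × κ → ℂ) : Matrix ι ι ℂ :=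
  ((Fintype.card κ : ℂ)⁻¹) • (S * pairMatrix x * (pairMatrix y)ᴴ * S)

theorem gramCov_add_smul (S : Matrix ι ι ℂ) (a b c d : ℝ) (x y : ι × κ → ℂ) :
    gramCov S (a • x + b • y) (c • x + d • y)
      = (a * c) • gramCov S x x + (a * d) • gramCov S x y + (b * c) • gramCov S y x
        + (b * d) • gramCov S y y := by
  simp only [gramCov, pairMatrix_add, pairMatrix_smul, conjTranspose_add, conjTranspose_smul,
    star_trivial, Matrix.mul_add, Matrix.add_mul, Matrix.mul_smul, Matrix.smul_mul]
  module

theorem Continuous.gramCov {X : Type*} [TopologicalSpace X] (S : Matrix ι ι ℂ)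
    {f g : X → ι × κ → ℂ} (hf : Continuous f) (hg : Continuous g) :
    Continuous fun a => gramCov S (f a) (g a) := by
  have h1 : Continuous fun a => pairMatrix (f a) := continuous_pairMatrix.comp hf
  have h2 : Continuous fun a => pairMatrix (g a) := continuous_pairMatrix.comp hg
  have h3 : Continuous fun a => S * pairMatrix (f a) * (pairMatrix (g a))ᴴ * S :=
    ((continuous_const.matrix_mul h1).matrix_mul h2.matrix_conjTranspose).matrix_mul
      continuous_const
  exact h3.const_smul ((Fintype.card κ : ℂ)⁻¹)

variable {S : Matrix ι ι ℂ}

theorem conjTranspose_gramCov (hS : S.IsHermitian) (x y : ι × κ → ℂ) :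
    (gramCov S x y)ᴴ = gramCov S y x := by
  simp [gramCov, conjTranspose_smul, conjTranspose_mul, hS.eq, Matrix.mul_assoc]

theorem isHermitian_gramCov (hS : S.IsHermitian) (x : ι × κ → ℂ) :
    (gramCov S x x).IsHermitian := conjTranspose_gramCov hS x x

variable [DecidableEq ι] [DecidableEq κ]

omit [DecidableEq ι] in
-- The constant depends on the dimensions. It is used for integrability only and never enters a
-- final bound.
theorem exists_norm_pairMatrix_le :
    ∃ C : ℝ, 0 ≤ C ∧ ∀ x : ι × κ → ℂ, ‖pairMatrix x‖ ≤ C * ‖x‖ := by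
  let L : (ι × κ → ℂ) →ₗ[ℝ] Matrix ι κ ℂ :=
    { toFun := pairMatrix, map_add' := pairMatrix_add, map_smul' := pairMatrix_smul }
  obtain ⟨C, hC, h⟩ := (LinearMap.toContinuousLinearMap L).bound
  exact ⟨C, hC.le, h⟩

theorem exists_norm_gramCov_le (S : Matrix ι ι ℂ) :
    ∃ C : ℝ, 0 ≤ C ∧ ∀ x y : ι × κ → ℂ, ‖gramCov S x y‖ ≤ C * (‖x‖ * ‖y‖) := by
  obtain ⟨C, hC, h⟩ := exists_norm_pairMatrix_le (ι := ι) (κ := κ)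
  refine ⟨‖(Fintype.card κ : ℂ)⁻¹‖ * (‖S‖ * C * C * ‖S‖), by positivity, fun x y => ?_⟩
  unfold gramCov
  rw [norm_smul, mul_assoc]
  gcongr
  calc ‖S * pairMatrix x * (pairMatrix y)ᴴ * S‖
      ≤ ‖S * pairMatrix x * (pairMatrix y)ᴴ‖ * ‖S‖ := l2_opNorm_mul _ _
    _ ≤ ‖S * pairMatrix x‖ * ‖(pairMatrix y)ᴴ‖ * ‖S‖ := by gcongr; exact l2_opNorm_mul _ _
    _ ≤ ‖S‖ * ‖pairMatrix x‖ * ‖(pairMatrix y)ᴴ‖ * ‖S‖ := by gcongr; exact l2_opNorm_mul _ _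
    _ ≤ ‖S‖ * (C * ‖x‖) * (C * ‖y‖) * ‖S‖ := by
      rw [l2_opNorm_conjTranspose]
      gcongr
      · exact h x
      · exact h y
    _ = _ := by ring

omit [DecidableEq κ] in
-- Along the rotation the first component moves with velocity the second, and the second with
-- velocity minus the first. Hence u uᴴ has derivative v uᴴ + u vᴴ.
theorem hasDerivAt_gramCov_rotation (S : Matrix ι ι ℂ) (p : (ι × κ → ℂ) × (ι × κ → ℂ)) (t : ℝ) :
    HasDerivAt (fun s => gramCov S (gaussRotation s p).1 (gaussRotation s p).1)
      (gramCov S (gaussRotation t p).2 (gaussRotation t p).1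
        + gramCov S (gaussRotation t p).1 (gaussRotation t p).2) t := by
  obtain ⟨x, y⟩ := p
  simp only [gaussRotation, gramCov_add_smul]
  have hs := Real.hasDerivAt_sin t
  have hc := Real.hasDerivAt_cos t
  refine (((((hc.mul hc).smul_const (gramCov S x x)).add
    ((hc.mul hs).smul_const (gramCov S x y))).add
    ((hs.mul hc).smul_const (gramCov S y x))).add
    ((hs.mul hs).smul_const (gramCov S y y))).congr_deriv ?_
  module

omit [DecidableEq κ] in
theorem hasDerivAt_gramCov_rotation_snd_fst (S : Matrix ι ι ℂ)
    (p : (ι × κ → ℂ) × (ι × κ → ℂ)) (t : ℝ) :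
    HasDerivAt (fun s => gramCov S (gaussRotation s p).2 (gaussRotation s p).1)
      (gramCov S (gaussRotation t p).2 (gaussRotation t p).2
        - gramCov S (gaussRotation t p).1 (gaussRotation t p).1) t := by
  obtain ⟨x, y⟩ := p
  simp only [gaussRotation, gramCov_add_smul]
  have hs := Real.hasDerivAt_sin t
  have hc := Real.hasDerivAt_cos t
  have hs' : HasDerivAt (fun t => -Real.sin t) (-Real.cos t) t := hs.neg
  refine (((((hs'.mul hc).smul_const (gramCov S x x)).add
    ((hs'.mul hs).smul_const (gramCov S x y))).add
    ((hc.mul hc).smul_const (gramCov S y x))).add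
    ((hc.mul hs).smul_const (gramCov S y y))).congr_deriv ?_
  module

/-- The resolvent of the sample covariance matrix. -/
noncomputable def gramResolvent (S : Matrix ι ι ℂ) (z : ℂ) (x : ι × κ → ℂ) : Matrix ι ι ℂ :=
  matResolvent (gramCov S x x) z

variable {z : ℂ}

omit [DecidableEq κ] in
theorem continuous_gramResolvent (hS : S.IsHermitian) (hz : z.im ≠ 0) :
    Continuous (gramResolvent S z : (ι × κ → ℂ) → Matrix ι ι ℂ) :=
  continuous_matResolvent (Continuous.gramCov S continuous_id' continuous_id') (isHermitian_gramCov hS) hz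

omit [DecidableEq κ] in
theorem norm_gramResolvent_le (hS : S.IsHermitian) (hz : z.im ≠ 0) (x : ι × κ → ℂ) :
    ‖gramResolvent S z x‖ ≤ |z.im|⁻¹ := norm_matResolvent_le (isHermitian_gramCov hS x) hz

omit [DecidableEq κ] in
theorem hasDerivAt_gramResolvent_rotation (hS : S.IsHermitian) (hz : z.im ≠ 0)
    (p : (ι × κ → ℂ) × (ι × κ → ℂ)) (t : ℝ) :
    HasDerivAt (fun s => gramResolvent S z (gaussRotation s p).1)
      (-(gramResolvent S z (gaussRotation t p).1 *
        (gramCov S (gaussRotation t p).2 (gaussRotation t p).1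
          + gramCov S (gaussRotation t p).1 (gaussRotation t p).2) *
        gramResolvent S z (gaussRotation t p).1)) t :=
  hasDerivAt_matResolvent (hasDerivAt_gramCov_rotation S p t) (isHermitian_gramCov hS _) hz

omit [DecidableEq ι] in
theorem HasDerivAt.matrix_trace {B : ℝ → Matrix ι ι ℂ} {B' : Matrix ι ι ℂ} {t : ℝ}
    (h : HasDerivAt B B' t) : HasDerivAt (fun s => (B s).trace) B'.trace t :=
  HasDerivAt.fun_sum fun i _ => hasDerivAt_pi.1 (hasDerivAt_pi.1 h i) i

end GramCov

/-! ### Dimension-free variance bounds for traces of the resolvent. -/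

section Variance

variable {ι κ : Type*} [Fintype κ] [Fintype ι] [DecidableEq ι]
  {S : Matrix ι ι ℂ} {z : ℂ}

theorem trace_re_le_card_mul_norm (B : Matrix ι ι ℂ) : B.trace.re ≤ Fintype.card ι * ‖B‖ :=
  (Complex.re_le_norm _).trans (norm_trace_le B)

theorem norm_conjTranspose_gramResolvent_mul_le [DecidableEq κ]
    (hS : S.IsHermitian) (hz : z.im ≠ 0) (u : ι × κ → ℂ) :
    ‖(gramResolvent S z u)ᴴ * gramCov S u u * gramResolvent S z u‖
      ≤ |z.im|⁻¹ * (1 + ‖z‖ * |z.im|⁻¹) := by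
  rcases isEmpty_or_nonempty ι with h | h
  · rw [Subsingleton.elim ((gramResolvent S z u)ᴴ * _ * _) 0, norm_zero]; positivity
  rw [Matrix.mul_assoc, gramResolvent, mul_matResolvent (isHermitian_gramCov hS u) hz]
  have hQ := norm_gramResolvent_le hS hz u
  rw [gramResolvent] at hQ
  refine (norm_mul_le _ _).trans ?_
  rw [l2_opNorm_conjTranspose]
  gcongr
  refine (norm_add_le _ _).trans ?_
  rw [norm_one, norm_smul]
  gcongr

theorem norm_gramResolvent_mul_conjTranspose_le [DecidableEq κ]
    (hS : S.IsHermitian) (hz : z.im ≠ 0) (u : ι × κ → ℂ) :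
    ‖gramResolvent S z u * gramCov S u u * (gramResolvent S z u)ᴴ‖
      ≤ |z.im|⁻¹ * (1 + ‖z‖ * |z.im|⁻¹) := by
  rcases isEmpty_or_nonempty ι with h | h
  · rw [Subsingleton.elim (gramResolvent S z u * _ * _) 0, norm_zero]; positivity
  rw [gramResolvent, matResolvent_mul (isHermitian_gramCov hS u) hz, mul_comm |z.im|⁻¹]
  have hQ := norm_gramResolvent_le hS hz u
  rw [gramResolvent] at hQ
  refine (norm_mul_le _ _).trans ?_
  rw [l2_opNorm_conjTranspose]
  gcongr
  refine (norm_add_le _ _).trans ?_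
  rw [norm_one, norm_smul]
  gcongr

/-- The directional derivative of `x ↦ tr (A Q(x))` at `u` in the direction `v`. -/
noncomputable def gramTraceDeriv (S A : Matrix ι ι ℂ) (z : ℂ)
    (p : (ι × κ → ℂ) × (ι × κ → ℂ)) : ℂ :=
  (A * -(gramResolvent S z p.1 * (gramCov S p.2 p.1 + gramCov S p.1 p.2) *
    gramResolvent S z p.1)).trace

/-- Cyclicity of the trace splits the derivative into a linear and an antilinear form in v. With u
frozen, the second moment of each is explicit. -/
theorem gramTraceDeriv_eq (A : Matrix ι ι ℂ) (u v : ι × κ → ℂ) :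
    gramTraceDeriv S A z (u, v) = -((Fintype.card κ : ℂ)⁻¹ *
      (((pairMatrix u)ᴴ * (S * gramResolvent S z u * A * gramResolvent S z u * S)
        * pairMatrix v).trace
      + ((pairMatrix v)ᴴ * (S * gramResolvent S z u * A * gramResolvent S z u * S
        * pairMatrix u)).trace)) := by
  set Q := gramResolvent S z u
  have h1 : (A * (Q * (S * pairMatrix v * (pairMatrix u)ᴴ * S) * Q)).trace
      = ((pairMatrix u)ᴴ * (S * Q * A * Q * S) * pairMatrix v).trace := by
    have : A * (Q * (S * pairMatrix v * (pairMatrix u)ᴴ * S) * Q)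
      = (A * Q * S * pairMatrix v) * ((pairMatrix u)ᴴ * S * Q) := by
      simp only [Matrix.mul_assoc]
    rw [this, Matrix.trace_mul_comm]
    simp only [Matrix.mul_assoc]
  have h2 : (A * (Q * (S * pairMatrix u * (pairMatrix v)ᴴ * S) * Q)).trace
      = ((pairMatrix v)ᴴ * (S * Q * A * Q * S * pairMatrix u)).trace := by
    have : A * (Q * (S * pairMatrix u * (pairMatrix v)ᴴ * S) * Q)
      = (A * Q * S * pairMatrix u) * ((pairMatrix v)ᴴ * S * Q) := by
      simp only [Matrix.mul_assoc]
    rw [this, Matrix.trace_mul_comm]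
    simp only [Matrix.mul_assoc]
  rw [← h1, ← h2]
  simp only [gramTraceDeriv, gramCov, Matrix.mul_neg, trace_neg, Matrix.mul_add, Matrix.add_mul,
    trace_add, Matrix.mul_smul, Matrix.smul_mul, trace_smul, smul_eq_mul]
  ring

/-- Of the two factors K⁻¹ in the squared derivative, one completes u uᴴ to the sample covariance,
where it is controlled through the resolvent identity. The other meets a trace of size at most N
times a norm, which gives N / K. -/
theorem lintegral_enorm_sq_gramTraceDeriv_le [DecidableEq κ] [Nonempty κ] (hS : S.IsHermitian)
    (hz : z.im ≠ 0) (A : Matrix ι ι ℂ) (u : ι × κ → ℂ) :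
    ∫⁻ v, ‖gramTraceDeriv S A z (u, v)‖ₑ ^ 2 ∂(complexGaussianPi (ι × κ))
      ≤ ENNReal.ofReal (4 * ((Fintype.card ι : ℝ) / Fintype.card κ) * ‖S‖ ^ 2 * ‖A‖ ^ 2
        * |z.im|⁻¹ ^ 3 * (1 + ‖z‖ * |z.im|⁻¹)) := by
  set Q := gramResolvent S z u with hQdef
  set y := |z.im|⁻¹
  have hy : 0 ≤ y := by positivity
  have hQ : ‖Q‖ ≤ y := norm_gramResolvent_le hS hz u
  set k : ℝ := (Fintype.card κ : ℝ)⁻¹ with hk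
  have hk0 : 0 ≤ k := by positivity
  set W := S * Q * A * Q * S with hW
  set B := (pairMatrix u)ᴴ * W with hB
  set C := W * pairMatrix u with hC
  set V : ℝ := Fintype.card ι * (‖S‖ ^ 2 * ‖A‖ ^ 2 * y ^ 3 * (1 + ‖z‖ * y)) with hV
  have hadd : ∀ a b : ℂ, ‖a + b‖ ^ 2 ≤ 2 * (‖a‖ ^ 2 + ‖b‖ ^ 2) := fun a b =>
    (pow_le_pow_left₀ (norm_nonneg _) (norm_add_le _ _) 2).trans add_sq_le
  have hpt : ∀ v : ι × κ → ℂ, ‖gramTraceDeriv S A z (u, v)‖ₑ ^ 2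
      ≤ ENNReal.ofReal (2 * k ^ 2) * (‖(B * pairMatrix v).trace‖ₑ ^ 2
        + ‖((pairMatrix v)ᴴ * C).trace‖ₑ ^ 2) := by
    intro v
    have h1 : ∀ w : ℂ, ‖w‖ₑ ^ 2 = ENNReal.ofReal (‖w‖ ^ 2) := fun w => by
      rw [← ofReal_norm, ENNReal.ofReal_pow (norm_nonneg _)]
    rw [gramTraceDeriv_eq, h1, h1, h1, ← ENNReal.ofReal_add (by positivity) (by positivity),
      ← ENNReal.ofReal_mul (by positivity)]
    apply ENNReal.ofReal_le_ofReal
    rw [norm_neg, norm_mul, norm_inv, Complex.norm_natCast, mul_pow]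
    refine (mul_le_mul_of_nonneg_left (hadd _ _) (sq_nonneg k)).trans_eq ?_
    rw [← mul_assoc, mul_comm (k ^ 2) 2]
  have hBtr : k * (B * Bᴴ).trace.re ≤ V := by
    -- Rotating the trace puts the sample covariance between two resolvents, where the product is
    -- bounded by |Im z|⁻¹ (1 + |z| |Im z|⁻¹).
    have e : ((k : ℂ) * (B * Bᴴ).trace) = ((A * Q * S)ᴴ * (Qᴴ * gramCov S u u * Q)
        * (A * Q * S)).trace := by
      rw [Matrix.trace_mul_comm, hB, hW, gramCov, hk]
      simp only [conjTranspose_mul, conjTranspose_conjTranspose, hS.eq, Matrix.mul_smul,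
        Matrix.smul_mul, trace_smul, smul_eq_mul, Matrix.mul_assoc]
      push_cast
      rfl
    rw [← Complex.re_ofReal_mul, e]
    refine (trace_re_le_card_mul_norm _).trans (mul_le_mul_of_nonneg_left ?_ (by positivity))
    have hAQS : ‖A * Q * S‖ ≤ ‖A‖ * y * ‖S‖ := by
      refine (norm_mul_le _ _).trans ?_
      gcongr
      refine (norm_mul_le _ _).trans ?_
      gcongr
    calc ‖(A * Q * S)ᴴ * (Qᴴ * gramCov S u u * Q) * (A * Q * S)‖
        ≤ ‖(A * Q * S)ᴴ‖ * ‖Qᴴ * gramCov S u u * Q‖ * ‖A * Q * S‖ :=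
          (norm_mul_le _ _).trans (by gcongr; exact norm_mul_le _ _)
      _ ≤ (‖A‖ * y * ‖S‖) * (y * (1 + ‖z‖ * y)) * (‖A‖ * y * ‖S‖) := by
          rw [l2_opNorm_conjTranspose]
          gcongr
          exact norm_conjTranspose_gramResolvent_mul_le hS hz u
      _ = _ := by ring
  have hCtr : k * (Cᴴ * C).trace.re ≤ V := by
    have e : ((k : ℂ) * (Cᴴ * C).trace) = ((S * Q * A) * (Q * gramCov S u u * Qᴴ)
        * (S * Q * A)ᴴ).trace := by
      rw [Matrix.trace_mul_comm, hC, hW, gramCov, hk]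
      simp only [conjTranspose_mul, hS.eq, Matrix.mul_smul,
        Matrix.smul_mul, trace_smul, smul_eq_mul, Matrix.mul_assoc]
      push_cast
      rfl
    rw [← Complex.re_ofReal_mul, e]
    refine (trace_re_le_card_mul_norm _).trans (mul_le_mul_of_nonneg_left ?_ (by positivity))
    have hAQS : ‖S * Q * A‖ ≤ ‖S‖ * y * ‖A‖ := by
      refine (norm_mul_le _ _).trans ?_
      gcongr
      refine (norm_mul_le _ _).trans ?_
      gcongr
    calc ‖(S * Q * A) * (Q * gramCov S u u * Qᴴ) * (S * Q * A)ᴴ‖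
        ≤ ‖S * Q * A‖ * ‖Q * gramCov S u u * Qᴴ‖ * ‖(S * Q * A)ᴴ‖ :=
          (norm_mul_le _ _).trans (by gcongr; exact norm_mul_le _ _)
      _ ≤ (‖S‖ * y * ‖A‖) * (y * (1 + ‖z‖ * y)) * (‖S‖ * y * ‖A‖) := by
          rw [l2_opNorm_conjTranspose]
          gcongr
          exact norm_gramResolvent_mul_conjTranspose_le hS hz u
      _ = _ := by ring
  have hm : Measurable fun v : ι × κ → ℂ => ‖(B * pairMatrix v).trace‖ₑ ^ 2 :=
    ((continuous_const.matrix_mul continuous_pairMatrix).matrix_trace).enorm.measurable.pow_const 2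
  calc ∫⁻ v, ‖gramTraceDeriv S A z (u, v)‖ₑ ^ 2 ∂(complexGaussianPi (ι × κ))
      ≤ ∫⁻ v, ENNReal.ofReal (2 * k ^ 2) * (‖(B * pairMatrix v).trace‖ₑ ^ 2
        + ‖((pairMatrix v)ᴴ * C).trace‖ₑ ^ 2) ∂(complexGaussianPi (ι × κ)) := lintegral_mono hpt
    _ = ENNReal.ofReal (2 * k ^ 2) * (ENNReal.ofReal (B * Bᴴ).trace.re
        + ENNReal.ofReal (Cᴴ * C).trace.re) := by
      rw [lintegral_const_mul' _ _ ENNReal.ofReal_ne_top, lintegral_add_left hm,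
        lintegral_enorm_sq_trace_mul_pairMatrix, lintegral_enorm_sq_trace_conjTranspose_mul]
    _ = ENNReal.ofReal (2 * k) * (ENNReal.ofReal (k * (B * Bᴴ).trace.re)
        + ENNReal.ofReal (k * (Cᴴ * C).trace.re)) := by
      rw [ENNReal.ofReal_mul hk0, ENNReal.ofReal_mul hk0, ← mul_add, ← mul_assoc,
        ← ENNReal.ofReal_mul (by positivity)]
      congr 2
      ring
    _ ≤ ENNReal.ofReal (2 * k) * (ENNReal.ofReal V + ENNReal.ofReal V) := by
      gcongr
    _ = _ := by
      have hV0 : 0 ≤ V := by positivity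
      rw [← ENNReal.ofReal_add hV0 hV0, ← ENNReal.ofReal_mul (by positivity)]
      congr 1
      rw [hV, hk, div_eq_mul_inv]
      ring

theorem continuous_trace_mul_gramResolvent (hS : S.IsHermitian) (hz : z.im ≠ 0)
    (A : Matrix ι ι ℂ) :
    Continuous fun x : ι × κ → ℂ => (A * gramResolvent S z x).trace := by
  exact (continuous_const.matrix_mul (continuous_gramResolvent hS hz)).matrix_trace

theorem hasDerivAt_trace_mul_gramResolvent_rotation [DecidableEq κ] (hS : S.IsHermitian) (hz : z.im ≠ 0)
    (A : Matrix ι ι ℂ) (p : (ι × κ → ℂ) × (ι × κ → ℂ)) (t : ℝ) :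
    HasDerivAt (fun s => (A * gramResolvent S z (gaussRotation s p).1).trace)
      (gramTraceDeriv S A z (gaussRotation t p)) t :=
  ((hasDerivAt_gramResolvent_rotation hS hz p t).const_mul A).matrix_trace

/-- The variance bound for linear statistics of the resolvent. -/
theorem lintegral_enorm_sq_trace_sub_le [DecidableEq κ] [Nonempty κ] (hS : S.IsHermitian)
    (hz : z.im ≠ 0) (A : Matrix ι ι ℂ) :
    ∫⁻ p : (ι × κ → ℂ) × (ι × κ → ℂ), ‖(A * gramResolvent S z p.2).trace
        - (A * gramResolvent S z p.1).trace‖ₑ ^ 2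
        ∂((complexGaussianPi (ι × κ)).prod (complexGaussianPi (ι × κ)))
      ≤ ENNReal.ofReal (Real.pi ^ 2 * ((Fintype.card ι : ℝ) / Fintype.card κ) * ‖S‖ ^ 2 * ‖A‖ ^ 2
        * |z.im|⁻¹ ^ 3 * (1 + ‖z‖ * |z.im|⁻¹)) := by
  have hQc : Continuous fun p : (ι × κ → ℂ) × (ι × κ → ℂ) => gramResolvent S z p.1 :=
    (continuous_gramResolvent hS hz).comp continuous_fst
  have hc1 : Continuous fun p : (ι × κ → ℂ) × (ι × κ → ℂ) => gramCov S p.1 p.2 :=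
    Continuous.gramCov S continuous_fst continuous_snd
  have hc2 : Continuous fun p : (ι × κ → ℂ) × (ι × κ → ℂ) => gramCov S p.2 p.1 :=
    Continuous.gramCov S continuous_snd continuous_fst
  have hG : Continuous (gramTraceDeriv (κ := κ) S A z) :=
    (continuous_const.matrix_mul
      (((hQc.matrix_mul (hc2.add hc1)).matrix_mul hQc).neg)).matrix_trace
  have hd := hasDerivAt_trace_mul_gramResolvent_rotation (κ := κ) hS hz A
  have h := lintegral_sub_sq_le (μ := complexGaussianPi (ι × κ)) integral_id_complexGaussianPi
    (f := fun x => (A * gramResolvent S z x).trace) (G := gramTraceDeriv S A z) hG hd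
  refine h.trans ?_
  rw [lintegral_prod _ (hG.enorm.measurable.pow_const 2).aemeasurable]
  refine (mul_le_mul_right (lintegral_mono fun u =>
    lintegral_enorm_sq_gramTraceDeriv_le hS hz A u) _).trans ?_
  rw [lintegral_const, measure_univ, mul_one, ← ENNReal.ofReal_mul (by positivity)]
  apply ENNReal.ofReal_le_ofReal
  apply le_of_eq
  ring

end Variance

/-! ### The integration by parts identity for the resolvent. -/

section IntegrationByParts

variable {ι κ : Type*} [Fintype κ] [Fintype ι] [DecidableEq ι]
  {S : Matrix ι ι ℂ} {z : ℂ}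

theorem norm_trace_mul_gramResolvent_le (hS : S.IsHermitian) (hz : z.im ≠ 0) (A : Matrix ι ι ℂ)
    (x : ι × κ → ℂ) :
    ‖(A * gramResolvent S z x).trace‖ ≤ Fintype.card ι * (‖A‖ * |z.im|⁻¹) := by
  refine (norm_trace_le _).trans ?_
  gcongr
  refine (norm_mul_le _ _).trans ?_
  gcongr
  exact norm_gramResolvent_le hS hz x

theorem integrable_trace_mul_gramResolvent (hS : S.IsHermitian) (hz : z.im ≠ 0)
    (A : Matrix ι ι ℂ) :
    Integrable (fun x : ι × κ → ℂ => (A * gramResolvent S z x).trace)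
      (complexGaussianPi (ι × κ)) :=
  Integrable.of_bound (continuous_trace_mul_gramResolvent hS hz A).aestronglyMeasurable _
    (ae_of_all _ (norm_trace_mul_gramResolvent_le hS hz A))

/-- The rotational derivative of `(u, v) ↦ tr (A K⁻¹ S v uᴴ S Q(u))`. -/
noncomputable def gramCovTraceDeriv (S A : Matrix ι ι ℂ) (z : ℂ)
    (p : (ι × κ → ℂ) × (ι × κ → ℂ)) : ℂ :=
  (A * ((gramCov S p.2 p.2 - gramCov S p.1 p.1) * gramResolvent S z p.1 +
    gramCov S p.2 p.1 * -(gramResolvent S z p.1 * (gramCov S p.2 p.1 + gramCov S p.1 p.2) *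
    gramResolvent S z p.1))).trace

theorem hasDerivAt_gramCovTrace_rotation [DecidableEq κ] (hS : S.IsHermitian) (hz : z.im ≠ 0)
    (A : Matrix ι ι ℂ) (p : (ι × κ → ℂ) × (ι × κ → ℂ)) (t : ℝ) :
    HasDerivAt (fun s => (A * (gramCov S (gaussRotation s p).2 (gaussRotation s p).1 *
      gramResolvent S z (gaussRotation s p).1)).trace)
      (gramCovTraceDeriv S A z (gaussRotation t p)) t :=
  (((hasDerivAt_gramCov_rotation_snd_fst S p t).mul
    (hasDerivAt_gramResolvent_rotation hS hz p t)).const_mul A).matrix_trace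

theorem norm_gramCovTrace_le (hS : S.IsHermitian) (hz : z.im ≠ 0) (A : Matrix ι ι ℂ) {C : ℝ}
    (hC : 0 ≤ C) (h : ∀ x y : ι × κ → ℂ, ‖gramCov S x y‖ ≤ C * (‖x‖ * ‖y‖))
    (p : (ι × κ → ℂ) × (ι × κ → ℂ)) :
    ‖(A * (gramCov S p.2 p.1 * gramResolvent S z p.1)).trace‖
      ≤ (Fintype.card ι * (‖A‖ * (C * |z.im|⁻¹))) * (1 + ‖p‖) ^ 4 := by
  have h1 : ‖p.1‖ ≤ 1 + ‖p‖ := (norm_fst_le p).trans (by linarith)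
  have h2 : ‖p.2‖ ≤ 1 + ‖p‖ := (norm_snd_le p).trans (by linarith)
  have h3 : 1 ≤ 1 + ‖p‖ := by linarith [norm_nonneg p]
  refine (norm_trace_le _).trans ?_
  rw [mul_assoc]
  gcongr
  refine (norm_mul_le _ _).trans ?_
  rw [mul_assoc]
  gcongr
  refine (norm_mul_le _ _).trans ?_
  calc ‖gramCov S p.2 p.1‖ * ‖gramResolvent S z p.1‖
      ≤ (C * ((1 + ‖p‖) * (1 + ‖p‖))) * |z.im|⁻¹ := by
        gcongr
        · exact (h _ _).trans (by gcongr)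
        · exact norm_gramResolvent_le hS hz _
    _ = C * |z.im|⁻¹ * (1 + ‖p‖) ^ 2 := by ring
    _ ≤ C * |z.im|⁻¹ * (1 + ‖p‖) ^ 4 := by
        gcongr
        norm_num

theorem norm_gramCovTraceDeriv_le (hS : S.IsHermitian) (hz : z.im ≠ 0) (A : Matrix ι ι ℂ) {C : ℝ}
    (hC : 0 ≤ C) (h : ∀ x y : ι × κ → ℂ, ‖gramCov S x y‖ ≤ C * (‖x‖ * ‖y‖))
    (p : (ι × κ → ℂ) × (ι × κ → ℂ)) :
    ‖gramCovTraceDeriv S A z p‖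
      ≤ (Fintype.card ι * (‖A‖ * (2 * C * |z.im|⁻¹ + 2 * C ^ 2 * |z.im|⁻¹ ^ 2)))
        * (1 + ‖p‖) ^ 4 := by
  have h1 : ‖p.1‖ ≤ 1 + ‖p‖ := (norm_fst_le p).trans (by linarith)
  have h2 : ‖p.2‖ ≤ 1 + ‖p‖ := (norm_snd_le p).trans (by linarith)
  have h3 : 1 ≤ 1 + ‖p‖ := by linarith [norm_nonneg p]
  have hQ := norm_gramResolvent_le hS hz p.1
  have hb : ∀ x y : ι × κ → ℂ, ‖x‖ ≤ 1 + ‖p‖ → ‖y‖ ≤ 1 + ‖p‖ →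
      ‖gramCov S x y‖ ≤ C * (1 + ‖p‖) ^ 2 := fun x y hx hy =>
    (h x y).trans (by rw [sq]; gcongr)
  have e1 : ‖(gramCov S p.2 p.2 - gramCov S p.1 p.1) * gramResolvent S z p.1‖
      ≤ (C * (1 + ‖p‖) ^ 2 + C * (1 + ‖p‖) ^ 2) * |z.im|⁻¹ := by
    refine (norm_mul_le _ _).trans ?_
    gcongr
    exact (norm_sub_le _ _).trans (add_le_add (hb _ _ h2 h2) (hb _ _ h1 h1))
  have e2 : ‖gramCov S p.2 p.1 * -(gramResolvent S z p.1 *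
      (gramCov S p.2 p.1 + gramCov S p.1 p.2) * gramResolvent S z p.1)‖
      ≤ (C * (1 + ‖p‖) ^ 2) * (|z.im|⁻¹ * (C * (1 + ‖p‖) ^ 2 + C * (1 + ‖p‖) ^ 2)
        * |z.im|⁻¹) := by
    refine (norm_mul_le _ _).trans ?_
    rw [norm_neg]
    gcongr
    · exact hb _ _ h2 h1
    refine (norm_mul_le _ _).trans ?_
    gcongr
    refine (norm_mul_le _ _).trans ?_
    gcongr
    exact (norm_add_le _ _).trans (add_le_add (hb _ _ h2 h1) (hb _ _ h1 h2))
  have e3 : (1 + ‖p‖) ^ 2 ≤ (1 + ‖p‖) ^ 4 := pow_le_pow_right₀ h3 (by norm_num)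
  refine (norm_trace_le _).trans ?_
  have e4 := (norm_add_le ((gramCov S p.2 p.2 - gramCov S p.1 p.1) * gramResolvent S z p.1)
    (gramCov S p.2 p.1 * -(gramResolvent S z p.1 *
      (gramCov S p.2 p.1 + gramCov S p.1 p.2) * gramResolvent S z p.1))).trans (add_le_add e1 e2)
  have e5 := (norm_mul_le A _).trans (mul_le_mul_of_nonneg_left e4 (norm_nonneg A))
  refine (mul_le_mul_of_nonneg_left e5 (Nat.cast_nonneg _)).trans ?_
  rw [mul_assoc (Fintype.card ι : ℝ), mul_assoc ‖A‖]
  refine mul_le_mul_of_nonneg_left (mul_le_mul_of_nonneg_left ?_ (norm_nonneg A))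
    (Nat.cast_nonneg _)
  calc _ = 2 * C * |z.im|⁻¹ * (1 + ‖p‖) ^ 2 + 2 * C ^ 2 * |z.im|⁻¹ ^ 2 * (1 + ‖p‖) ^ 4 := by ring
    _ ≤ 2 * C * |z.im|⁻¹ * (1 + ‖p‖) ^ 4 + 2 * C ^ 2 * |z.im|⁻¹ ^ 2 * (1 + ‖p‖) ^ 4 := by gcongr
    _ = _ := by ring

/-- Given u, the derivative is a quadratic polynomial in v. The v vᴴ terms factor into products of
traces, the v·v term vanishes by circular symmetry, and the term in u uᴴ is constant. -/
theorem integral_gramCovTraceDeriv_right [Nonempty κ] (A : Matrix ι ι ℂ) (u : ι × κ → ℂ) :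
    ∫ v, gramCovTraceDeriv S A z (u, v) ∂(complexGaussianPi (ι × κ))
      = (S * gramResolvent S z u * A * S).trace
        * (1 - (Fintype.card κ : ℂ)⁻¹ * (gramResolvent S z u * gramCov S u u).trace)
        - (A * gramCov S u u * gramResolvent S z u).trace := by
  classical
  set Q := gramResolvent S z u
  set k := (Fintype.card κ : ℂ)⁻¹ with hk
  set W := S * Q * A * S with hW
  have hk1 : k * (Fintype.card κ : ℂ) = 1 := inv_mul_cancel₀ (by simp)
  have e : ∀ v : ι × κ → ℂ, gramCovTraceDeriv S A z (u, v)
      = k * (W * pairMatrix v * (1 : Matrix κ κ ℂ) * (pairMatrix v)ᴴ).trace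
        - (A * gramCov S u u * Q).trace
        - (k * k * (((pairMatrix u)ᴴ * W) * pairMatrix v * ((pairMatrix u)ᴴ * S * Q * S)
            * pairMatrix v).trace
        + k * k * (W * pairMatrix v * ((pairMatrix u)ᴴ * S * Q * S * pairMatrix u)
            * (pairMatrix v)ᴴ).trace) := by
    intro v
    have e1 : (A * ((S * pairMatrix v * (pairMatrix v)ᴴ * S) * Q)).trace
        = (W * pairMatrix v * (1 : Matrix κ κ ℂ) * (pairMatrix v)ᴴ).trace := by
      have : A * ((S * pairMatrix v * (pairMatrix v)ᴴ * S) * Q)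
          = (A * S * pairMatrix v * (pairMatrix v)ᴴ) * (S * Q) := by
        simp only [Matrix.mul_assoc]
      rw [this, Matrix.trace_mul_comm, hW]
      simp only [Matrix.mul_assoc, Matrix.one_mul]
    have e2 : (A * ((S * pairMatrix v * (pairMatrix u)ᴴ * S) * (Q *
        (S * pairMatrix v * (pairMatrix u)ᴴ * S) * Q))).trace
        = (((pairMatrix u)ᴴ * W) * pairMatrix v * ((pairMatrix u)ᴴ * S * Q * S)
            * pairMatrix v).trace := by
      have : A * ((S * pairMatrix v * (pairMatrix u)ᴴ * S) * (Q *
          (S * pairMatrix v * (pairMatrix u)ᴴ * S) * Q))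
          = (A * S * pairMatrix v * (pairMatrix u)ᴴ * S * Q * S * pairMatrix v)
            * ((pairMatrix u)ᴴ * S * Q) := by
        simp only [Matrix.mul_assoc]
      rw [this, Matrix.trace_mul_comm, hW]
      simp only [Matrix.mul_assoc]
    have e3 : (A * ((S * pairMatrix v * (pairMatrix u)ᴴ * S) * (Q *
        (S * pairMatrix u * (pairMatrix v)ᴴ * S) * Q))).trace
        = (W * pairMatrix v * ((pairMatrix u)ᴴ * S * Q * S * pairMatrix u)
            * (pairMatrix v)ᴴ).trace := by
      have : A * ((S * pairMatrix v * (pairMatrix u)ᴴ * S) * (Q *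
          (S * pairMatrix u * (pairMatrix v)ᴴ * S) * Q))
          = (A * S * pairMatrix v * (pairMatrix u)ᴴ * S * Q * S * pairMatrix u * (pairMatrix v)ᴴ)
            * (S * Q) := by
        simp only [Matrix.mul_assoc]
      rw [this, Matrix.trace_mul_comm, hW]
      simp only [Matrix.mul_assoc]
    rw [← e1, ← e2, ← e3]
    have e4 : (A * gramCov S u u * Q).trace
        = k * (A * ((S * pairMatrix u * (pairMatrix u)ᴴ * S) * Q)).trace := by
      rw [gramCov, Matrix.mul_smul, Matrix.smul_mul, trace_smul, smul_eq_mul, Matrix.mul_assoc A]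
    rw [e4]
    simp only [gramCovTraceDeriv, gramCov, Matrix.mul_neg, trace_neg, Matrix.mul_add,
      Matrix.add_mul, Matrix.mul_sub, Matrix.sub_mul, trace_sub,
      trace_add, Matrix.mul_smul, Matrix.smul_mul, trace_smul, smul_eq_mul]
    ring
  simp_rw [e]
  have i1 := (integrable_trace_mul_pairMatrix_mul_conjTranspose (κ := κ) W 1).const_mul k
  have i2 := (integrable_trace_mul_pairMatrix_mul_pairMatrix ((pairMatrix u)ᴴ * W)
    ((pairMatrix u)ᴴ * S * Q * S)).const_mul (k * k)
  have i3 := (integrable_trace_mul_pairMatrix_mul_conjTranspose (κ := κ) W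
    ((pairMatrix u)ᴴ * S * Q * S * pairMatrix u)).const_mul (k * k)
  have e5 : ((pairMatrix u)ᴴ * S * Q * S * pairMatrix u).trace
      = (Q * (S * pairMatrix u * (pairMatrix u)ᴴ * S)).trace := by
    have : Q * (S * pairMatrix u * (pairMatrix u)ᴴ * S)
      = (Q * S * pairMatrix u) * ((pairMatrix u)ᴴ * S) := by simp only [Matrix.mul_assoc]
    conv_rhs => rw [this, Matrix.trace_mul_comm]
    simp only [Matrix.mul_assoc]
  have e6 : (Q * gramCov S u u).trace
      = k * (Q * (S * pairMatrix u * (pairMatrix u)ᴴ * S)).trace := by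
    rw [gramCov, Matrix.mul_smul, trace_smul, smul_eq_mul]
  rw [integral_sub (i1.sub' (integrable_const _)) (i2.fun_add i3),
    integral_sub i1 (integrable_const _), integral_add i2 i3, integral_const_mul,
    integral_const_mul, integral_const_mul, integral_trace_mul_pairMatrix_mul_conjTranspose,
    integral_trace_mul_pairMatrix_mul_conjTranspose,
    integral_trace_mul_pairMatrix_mul_pairMatrix, e5, trace_one, e6,
    integral_const, probReal_univ, one_smul]
  linear_combination W.trace * hk1

/-- The integration by parts identity for the expected resolvent. -/
theorem trace_add_mul_integral_trace_mul_gramResolvent [Nonempty κ] (hS : S.IsHermitian)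
    (hz : z.im ≠ 0) (A : Matrix ι ι ℂ) :
    A.trace + z * ∫ x : ι × κ → ℂ, (A * gramResolvent S z x).trace
        ∂(complexGaussianPi (ι × κ))
      = ∫ x : ι × κ → ℂ, (A * (S * S) * gramResolvent S z x).trace
        * (1 - (Fintype.card κ : ℂ)⁻¹ * (Fintype.card ι + z * (gramResolvent S z x).trace))
        ∂(complexGaussianPi (ι × κ)) := by
  classical
  obtain ⟨C, hC, h⟩ := exists_norm_gramCov_le (κ := κ) S
  have hQc : Continuous fun p : (ι × κ → ℂ) × (ι × κ → ℂ) => gramResolvent S z p.1 :=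
    (continuous_gramResolvent hS hz).comp continuous_fst
  have c12 : Continuous fun p : (ι × κ → ℂ) × (ι × κ → ℂ) => gramCov S p.1 p.2 :=
    Continuous.gramCov S continuous_fst continuous_snd
  have c21 : Continuous fun p : (ι × κ → ℂ) × (ι × κ → ℂ) => gramCov S p.2 p.1 :=
    Continuous.gramCov S continuous_snd continuous_fst
  have c11 : Continuous fun p : (ι × κ → ℂ) × (ι × κ → ℂ) => gramCov S p.1 p.1 :=
    Continuous.gramCov S continuous_fst continuous_fst
  have c22 : Continuous fun p : (ι × κ → ℂ) × (ι × κ → ℂ) => gramCov S p.2 p.2 :=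
    Continuous.gramCov S continuous_snd continuous_snd
  have hH : Continuous fun p : (ι × κ → ℂ) × (ι × κ → ℂ) =>
      (A * (gramCov S p.2 p.1 * gramResolvent S z p.1)).trace :=
    (continuous_const.matrix_mul (c21.matrix_mul hQc)).matrix_trace
  have hH' : Continuous (gramCovTraceDeriv (κ := κ) S A z) :=
    (continuous_const.matrix_mul (((c22.sub c11).matrix_mul hQc).add
      (c21.matrix_mul ((hQc.matrix_mul (c21.add c12)).matrix_mul hQc).neg))).matrix_trace
  have iH := integrable_of_norm_le_pow (μ := complexGaussianPi (ι × κ)) hH _ 4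
    (norm_gramCovTrace_le hS hz A hC h)
  have iH' := integrable_of_norm_le_pow (μ := complexGaussianPi (ι × κ)) hH' _ 4
    (norm_gramCovTraceDeriv_le hS hz A hC h)
  have hd := hasDerivAt_gramCovTrace_rotation (κ := κ) hS hz A
  have h0 := integral_rotation_deriv_eq_zero (μ := complexGaussianPi (ι × κ))
    integral_id_complexGaussianPi
    (H := fun p => (A * (gramCov S p.2 p.1 * gramResolvent S z p.1)).trace)
    (H' := gramCovTraceDeriv S A z) iH hH' iH' hd
  rw [integral_prod _ iH'] at h0
  simp_rw [integral_gramCovTraceDeriv_right] at h0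
  have e1 : ∀ u : ι × κ → ℂ, (S * gramResolvent S z u * A * S).trace
      = (A * (S * S) * gramResolvent S z u).trace := by
    intro u
    have : S * gramResolvent S z u * A * S = (S * gramResolvent S z u) * (A * S) := by
      simp only [Matrix.mul_assoc]
    rw [this, Matrix.trace_mul_comm]
    simp only [Matrix.mul_assoc]
  have e2 : ∀ u : ι × κ → ℂ, (gramResolvent S z u * gramCov S u u).trace
      = Fintype.card ι + z * (gramResolvent S z u).trace := by
    intro u
    rw [gramResolvent, matResolvent_mul (isHermitian_gramCov hS u) hz, trace_add, trace_one,
      trace_smul, smul_eq_mul]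
  have e3 : ∀ u : ι × κ → ℂ, (A * gramCov S u u * gramResolvent S z u).trace
      = A.trace + z * (A * gramResolvent S z u).trace := by
    intro u
    rw [Matrix.mul_assoc, gramResolvent, mul_matResolvent (isHermitian_gramCov hS u) hz,
      Matrix.mul_add, Matrix.mul_one, trace_add, Matrix.mul_smul, trace_smul, smul_eq_mul]
  simp_rw [e1, e2, e3] at h0
  have iA := integrable_trace_mul_gramResolvent (κ := κ) hS hz A
  have i1 : Integrable (fun x : ι × κ → ℂ => (A * (S * S) * gramResolvent S z x).trace
      * (1 - (Fintype.card κ : ℂ)⁻¹ * (Fintype.card ι + z * (gramResolvent S z x).trace)))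
      (complexGaussianPi (ι × κ)) := by
    have hc1 := continuous_trace_mul_gramResolvent (κ := κ) hS hz 1
    have hc2 := continuous_trace_mul_gramResolvent (κ := κ) hS hz (A * (S * S))
    simp only [Matrix.one_mul] at hc1
    refine Integrable.mono' (integrable_const
      ((Fintype.card ι * (‖A * (S * S)‖ * |z.im|⁻¹)) * (1 + ‖(Fintype.card κ : ℂ)⁻¹‖
        * (Fintype.card ι + ‖z‖ * (Fintype.card ι * (‖(1 : Matrix ι ι ℂ)‖ * |z.im|⁻¹))))))
      (by fun_prop) (ae_of_all _ fun x => ?_)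
    rw [norm_mul]
    have b1 := norm_trace_mul_gramResolvent_le hS hz (A * (S * S)) x
    have b2 := norm_trace_mul_gramResolvent_le hS hz 1 x
    rw [Matrix.one_mul] at b2
    gcongr
    refine (norm_sub_le _ _).trans ?_
    rw [norm_one, norm_mul]
    gcongr
    refine (norm_add_le _ _).trans ?_
    rw [norm_mul, Complex.norm_natCast]
    gcongr
  rw [integral_sub i1 ((integrable_const _).fun_add (iA.const_mul z)),
    integral_add (integrable_const _) (iA.const_mul z), integral_const_mul, integral_const,
    probReal_univ, one_smul] at h0
  exact (sub_eq_zero.1 h0).symm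

end IntegrationByParts

/-! ### Covariances through two independent copies. -/

section Covariance

variable {E : Type*} [MeasurableSpace E] {μ : Measure E} [IsProbabilityMeasure μ]

theorem integral_prod_sub_mul_sub {f g : E → ℂ} (hf : Integrable f μ) (hg : Integrable g μ)
    (hfg : Integrable (fun x => f x * g x) μ) :
    ∫ p : E × E, (f p.2 - f p.1) * (g p.2 - g p.1) ∂(μ.prod μ)
      = 2 * (∫ x, f x * g x ∂μ - (∫ x, f x ∂μ) * ∫ x, g x ∂μ) := by
  have e : ∀ p : E × E, (f p.2 - f p.1) * (g p.2 - g p.1)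
      = (f p.2 * g p.2 + f p.1 * g p.1) - (f p.1 * g p.2 + g p.1 * f p.2) := fun p => by ring
  simp_rw [e]
  rw [integral_sub ((hfg.comp_snd μ).fun_add (hfg.comp_fst μ))
      ((hf.mul_prod hg).fun_add (hg.mul_prod hf)),
    integral_add (hfg.comp_snd μ) (hfg.comp_fst μ),
    integral_add (hf.mul_prod hg) (hg.mul_prod hf),
    integral_prod_mul f g, integral_prod_mul g f,
    integral_fun_snd (fun x => f x * g x), integral_fun_fst (fun x => f x * g x)]
  simp
  ring

/-- Twice the covariance is the mean of a product of differences of independent copies. Weighted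
AM-GM with weight t, the ratio of the two scales, has the same effect as Cauchy–Schwarz. -/
theorem norm_integral_mul_sub_le {f g : E → ℂ} (hf : Integrable f μ) (hg : Integrable g μ)
    (hfg : Integrable (fun x => f x * g x) μ) {D t : ℝ} (hD : 0 ≤ D) (ht : 0 < t)
    (hVf : ∫⁻ p : E × E, ‖f p.2 - f p.1‖ₑ ^ 2 ∂(μ.prod μ) ≤ ENNReal.ofReal D)
    (hVg : ∫⁻ p : E × E, ‖g p.2 - g p.1‖ₑ ^ 2 ∂(μ.prod μ) ≤ ENNReal.ofReal (D * t ^ 2)) :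
    ‖∫ x, f x * g x ∂μ - (∫ x, f x ∂μ) * ∫ x, g x ∂μ‖ ≤ D * t / 2 := by
  have h := integral_prod_sub_mul_sub hf hg hfg
  have hpt : ∀ p : E × E, ‖(f p.2 - f p.1) * (g p.2 - g p.1)‖ₑ
      ≤ ENNReal.ofReal (t / 2) * ‖f p.2 - f p.1‖ₑ ^ 2
        + ENNReal.ofReal (t⁻¹ / 2) * ‖g p.2 - g p.1‖ₑ ^ 2 := by
    intro p
    rw [← ofReal_norm, ← ofReal_norm, ← ofReal_norm, ← ENNReal.ofReal_pow (norm_nonneg _),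
      ← ENNReal.ofReal_pow (norm_nonneg _), ← ENNReal.ofReal_mul (by positivity),
      ← ENNReal.ofReal_mul (by positivity), ← ENNReal.ofReal_add (by positivity) (by positivity)]
    apply ENNReal.ofReal_le_ofReal
    rw [norm_mul]
    have key : t / 2 * ‖f p.2 - f p.1‖ ^ 2 + t⁻¹ / 2 * ‖g p.2 - g p.1‖ ^ 2
        - ‖f p.2 - f p.1‖ * ‖g p.2 - g p.1‖
        = t⁻¹ / 2 * (t * ‖f p.2 - f p.1‖ - ‖g p.2 - g p.1‖) ^ 2 := by
      field_simp
      ring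
    have : 0 ≤ t⁻¹ / 2 * (t * ‖f p.2 - f p.1‖ - ‖g p.2 - g p.1‖) ^ 2 := by positivity
    linarith
  have hm : AEMeasurable (fun p : E × E =>
      ENNReal.ofReal (t / 2) * ‖f p.2 - f p.1‖ₑ ^ 2) (μ.prod μ) := by
    refine AEMeasurable.const_mul (AEMeasurable.pow_const (AEMeasurable.enorm ?_) 2) _
    exact (hf.comp_snd μ).aemeasurable.sub (hf.comp_fst μ).aemeasurable
  have h1 : ‖∫ p : E × E, (f p.2 - f p.1) * (g p.2 - g p.1) ∂(μ.prod μ)‖ₑ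
      ≤ ENNReal.ofReal (D * t) := by
    calc _ ≤ ∫⁻ p : E × E, ‖(f p.2 - f p.1) * (g p.2 - g p.1)‖ₑ ∂(μ.prod μ) :=
          enorm_integral_le_lintegral_enorm _
      _ ≤ _ := lintegral_mono hpt
      _ ≤ ENNReal.ofReal (t / 2) * ENNReal.ofReal D
          + ENNReal.ofReal (t⁻¹ / 2) * ENNReal.ofReal (D * t ^ 2) := by
        rw [lintegral_add_left' hm, lintegral_const_mul' _ _ ENNReal.ofReal_ne_top,
          lintegral_const_mul' _ _ ENNReal.ofReal_ne_top]
        gcongr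
      _ = _ := by
        rw [← ENNReal.ofReal_mul (by positivity), ← ENNReal.ofReal_mul (by positivity),
          ← ENNReal.ofReal_add (by positivity) (by positivity)]
        congr 1
        field_simp
        ring
  rw [h, ← ofReal_norm, ENNReal.ofReal_le_ofReal_iff (by positivity), norm_mul] at h1
  simp only [Complex.norm_ofNat] at h1
  linarith

end Covariance

/-! ### The approximate equation for the expected Stieltjes transform. -/

section MeanStieltjes

variable {ι : Type*} (κ : Type*) [Fintype κ] [Fintype ι] [DecidableEq ι]

/-- The expected Stieltjes transform of the sample covariance matrix. -/
noncomputable def meanStieltjes (S : Matrix ι ι ℂ) (z : ℂ) : ℂ :=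
  (Fintype.card ι : ℂ)⁻¹ * ∫ x : ι × κ → ℂ, (gramResolvent S z x).trace
    ∂(complexGaussianPi (ι × κ))

/-- The right hand side of the Marchenko–Pastur type equation. -/
noncomputable def mpMap {ι : Type*} [Fintype ι] (a : ι → ℝ) (c : ℝ) (z b : ℂ) : ℂ :=
  (Fintype.card ι : ℂ)⁻¹ * ∑ i, ((a i : ℂ) * (1 - c - c * z * b) - z)⁻¹

variable {κ} {S : Matrix ι ι ℂ} {z : ℂ}

theorem integrable_trace_gramResolvent (hS : S.IsHermitian) (hz : z.im ≠ 0) :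
    Integrable (fun x : ι × κ → ℂ => (gramResolvent S z x).trace)
      (complexGaussianPi (ι × κ)) := by
  simpa using integrable_trace_mul_gramResolvent (κ := κ) hS hz 1

omit [DecidableEq ι] in
open scoped ComplexOrder in
theorem posSemidef_gramCov (hS : S.IsHermitian) (x : ι × κ → ℂ) :
    (gramCov S x x).PosSemidef := by
  have h : gramCov S x x
      = ((Fintype.card κ : ℝ)⁻¹) • ((S * pairMatrix x) * (S * pairMatrix x)ᴴ) := by
    rw [gramCov, conjTranspose_mul, hS.eq, ← Complex.coe_smul, ← Matrix.mul_assoc]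
    push_cast
    rfl
  rw [h]
  exact (posSemidef_self_mul_conjTranspose _).smul (by positivity)

theorem norm_trace_gramResolvent_le (hS : S.IsHermitian) (hz : z.im ≠ 0) (x : ι × κ → ℂ) :
    ‖(gramResolvent S z x).trace‖ ≤ Fintype.card ι * |z.im|⁻¹ := by
  rw [gramResolvent, trace_matResolvent (isHermitian_gramCov hS x) hz]
  refine (norm_sum_le _ _).trans ?_
  refine (Finset.sum_le_sum fun i _ => norm_inv_ofReal_sub_le hz _).trans ?_
  simp

theorem im_inv_ofReal_sub (a : ℝ) (z : ℂ) :
    (((a : ℂ) - z)⁻¹).im = z.im * (Complex.normSq ((a : ℂ) - z))⁻¹ := by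
  simp [Complex.inv_im, div_eq_mul_inv]

theorem im_mul_inv_ofReal_sub (a : ℝ) (z : ℂ) :
    (z * ((a : ℂ) - z)⁻¹).im = a * z.im * (Complex.normSq ((a : ℂ) - z))⁻¹ := by
  simp [Complex.inv_im, Complex.inv_re, Complex.mul_im, div_eq_mul_inv]
  ring

/-- Each eigenvalue s contributes s Im z / |s − z|², nonnegative because the sample covariance is
positive semidefinite. This sign keeps the denominators of the equation away from zero. -/
theorem im_mul_trace_gramResolvent_nonneg (hS : S.IsHermitian) (hz : 0 < z.im) (x : ι × κ → ℂ) :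
    0 ≤ (z * (gramResolvent S z x).trace).im := by
  rw [gramResolvent, trace_matResolvent (isHermitian_gramCov hS x) hz.ne', Finset.mul_sum,
    Complex.im_sum]
  refine Finset.sum_nonneg fun i _ => ?_
  rw [im_mul_inv_ofReal_sub]
  have h1 := Complex.normSq_nonneg (((isHermitian_gramCov hS x).eigenvalues i : ℂ) - z)
  have h2 : 0 ≤ (isHermitian_gramCov hS x).eigenvalues i :=
    (posSemidef_gramCov hS x).eigenvalues_nonneg i
  positivity

theorem im_mul_meanStieltjes_nonneg (hS : S.IsHermitian) (hz : 0 < z.im) :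
    0 ≤ (z * meanStieltjes κ S z).im := by
  have h := Complex.imCLM.integral_comp_comm
    ((integrable_trace_gramResolvent (κ := κ) hS hz.ne').const_mul z)
  simp only [Complex.imCLM_apply] at h
  have e : (Fintype.card ι : ℂ)⁻¹ = (((Fintype.card ι : ℝ)⁻¹ : ℝ) : ℂ) := by push_cast; rfl
  rw [meanStieltjes, e, mul_left_comm, Complex.im_ofReal_mul, ← integral_const_mul, ← h]
  exact mul_nonneg (by positivity)
    (integral_nonneg fun x => im_mul_trace_gramResolvent_nonneg hS hz x)

/-- The imaginary part of the denominators of the Marchenko–Pastur type equation stays away from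
zero. -/
theorem le_norm_mpDenominator {a c : ℝ} (ha : 0 ≤ a) (hc : 0 ≤ c) {b : ℂ}
    (hb : 0 ≤ (z * b).im) : z.im ≤ ‖(a : ℂ) * (1 - c - c * z * b) - z‖ := by
  have h : ((a : ℂ) * (1 - c - c * z * b) - z).im = -(a * (c * (z * b).im) + z.im) := by
    have : (1 - c - c * z * b : ℂ).im = - (c * (z * b).im) := by
      rw [mul_assoc, Complex.sub_im, Complex.sub_im, Complex.im_ofReal_mul]
      simp
    rw [Complex.sub_im, Complex.im_ofReal_mul, this]
    ring
  have h2 := Complex.abs_im_le_norm ((a : ℂ) * (1 - c - c * z * b) - z)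
  rw [h, abs_neg] at h2
  have h3 : 0 ≤ a * (c * (z * b).im) := by positivity
  exact le_trans (by linarith [le_abs_self (a * (c * (z * b).im) + z.im)]) h2

/-- The expected Stieltjes transform solves the Marchenko–Pastur type equation up to an error of
order `K⁻²`. -/
theorem norm_meanStieltjes_sub_mpMap_le [Nonempty κ] [Nonempty ι] (U : Matrix.unitaryGroup ι ℂ)
    {a : ι → ℝ} {Λ : ℝ} (hΛ : 0 < Λ) (ha : ∀ i, 0 ≤ a i ∧ a i ≤ Λ)
    (hS : S = unitaryDiagonal U (fun i => (Real.sqrt (a i) : ℂ))) (hz : 0 < z.im) :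
    ‖meanStieltjes κ S z
        - mpMap a ((Fintype.card ι : ℝ) / Fintype.card κ) z (meanStieltjes κ S z)‖
      ≤ 5 * Λ ^ 2 * ‖z‖ * z.im⁻¹ ^ 4 * (1 + ‖z‖ * z.im⁻¹) / (Fintype.card κ : ℝ) ^ 2 := by
  classical
  have hz' := hz.ne'
  have hy : |z.im| = z.im := abs_of_pos hz
  have hN : (0 : ℝ) < Fintype.card ι := by exact_mod_cast Fintype.card_pos
  have hK : (0 : ℝ) < Fintype.card κ := by exact_mod_cast Fintype.card_pos
  have hNc : (Fintype.card ι : ℂ) ≠ 0 := by exact_mod_cast hN.ne'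
  have hKc : (Fintype.card κ : ℂ) ≠ 0 := by exact_mod_cast hK.ne'
  have hSh : S.IsHermitian := by
    rw [hS, Matrix.IsHermitian, conjTranspose_unitaryDiagonal]
    simp
  have hSS : S * S = unitaryDiagonal U (fun i => (a i : ℂ)) := by
    rw [hS, unitaryDiagonal_mul]
    congr 1
    funext i
    rw [← Complex.ofReal_mul, Real.mul_self_sqrt (ha i).1]
  set c : ℝ := (Fintype.card ι : ℝ) / Fintype.card κ with hc
  have hc0 : 0 ≤ c := by positivity
  set β := meanStieltjes κ S z with hβ
  set w : ℂ := 1 - c - c * z * β with hw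
  have hden : ∀ i, z.im ≤ ‖(a i : ℂ) * w - z‖ := fun i =>
    le_norm_mpDenominator (ha i).1 hc0 (im_mul_meanStieltjes_nonneg hSh hz)
  have hden0 : ∀ i, (a i : ℂ) * w - z ≠ 0 := fun i => norm_pos_iff.1 (hz.trans_le (hden i))
  have hinv : ∀ i, ‖((a i : ℂ) * w - z)⁻¹‖ ≤ z.im⁻¹ := fun i => by
    rw [norm_inv]; exact inv_anti₀ hz (hden i)
  -- T = (w R − z)⁻¹, whose normalised trace is the right-hand side of the equation at β. Its
  -- defining relation gives tr Q = w tr (T R Q) − z tr (T Q) pointwise, and integration by parts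
  -- evaluates the mean of the last term.
  set T := unitaryDiagonal U (fun i => ((a i : ℂ) * w - z)⁻¹) with hT
  set f : (ι × κ → ℂ) → ℂ := fun x => (gramResolvent S z x).trace with hf
  set g : (ι × κ → ℂ) → ℂ := fun x => (T * (S * S) * gramResolvent S z x).trace with hg
  have iF : Integrable f (complexGaussianPi (ι × κ)) := integrable_trace_gramResolvent hSh hz'
  have iG : Integrable g (complexGaussianPi (ι × κ)) :=
    integrable_trace_mul_gramResolvent hSh hz' _
  have iFG : Integrable (fun x => f x * g x) (complexGaussianPi (ι × κ)) :=
    iG.bdd_mul iF.aestronglyMeasurable (ae_of_all _ (norm_trace_gramResolvent_le hSh hz'))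
  have hTR : w • (T * (S * S)) - z • T = 1 := by
    rw [hSS, hT, unitaryDiagonal_mul, smul_unitaryDiagonal, smul_unitaryDiagonal,
      unitaryDiagonal_sub, ← unitaryDiagonal_one U]
    congr 1
    funext i
    linear_combination mul_inv_cancel₀ (hden0 i)
  have hTRnorm : ‖T * (S * S)‖ ≤ Λ * z.im⁻¹ := by
    rw [hSS, hT, unitaryDiagonal_mul]
    refine norm_unitaryDiagonal_le _ _ (by positivity) fun i => ?_
    rw [norm_mul, mul_comm, Complex.norm_real, Real.norm_of_nonneg (ha i).1]
    exact mul_le_mul (ha i).2 (hinv i) (norm_nonneg _) hΛ.le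
  have hSnorm : ‖S‖ ^ 2 ≤ Λ := by
    have : ‖S‖ ≤ Real.sqrt Λ := by
      rw [hS]
      refine norm_unitaryDiagonal_le _ _ (Real.sqrt_nonneg _) fun i => ?_
      rw [Complex.norm_real, Real.norm_of_nonneg (Real.sqrt_nonneg _)]
      exact Real.sqrt_le_sqrt (ha i).2
    calc ‖S‖ ^ 2 ≤ Real.sqrt Λ ^ 2 := by gcongr
      _ = Λ := Real.sq_sqrt hΛ.le
  have hfw : ∀ x, f x = w * g x - z * (T * gramResolvent S z x).trace := by
    intro x
    rw [hf, hg]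
    simp only
    rw [← smul_eq_mul w, ← smul_eq_mul z, ← trace_smul, ← trace_smul, ← trace_sub,
      ← Matrix.smul_mul w, ← Matrix.smul_mul z, ← Matrix.sub_mul, hTR, Matrix.one_mul]
  have iT := integrable_trace_mul_gramResolvent (κ := κ) hSh hz' T
  have hfint : ∫ x, f x ∂(complexGaussianPi (ι × κ)) = w * ∫ x, g x ∂(complexGaussianPi (ι × κ))
      - z * ∫ x, (T * gramResolvent S z x).trace ∂(complexGaussianPi (ι × κ)) := by
    rw [← integral_const_mul, ← integral_const_mul,
      ← integral_sub (iG.const_mul w) (iT.const_mul z)]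
    exact integral_congr_ae (ae_of_all _ hfw)
  have hibp := trace_add_mul_integral_trace_mul_gramResolvent (κ := κ) hSh hz' T
  have e : ∀ x : ι × κ → ℂ, (T * (S * S) * gramResolvent S z x).trace
        * (1 - (Fintype.card κ : ℂ)⁻¹ * (Fintype.card ι + z * (gramResolvent S z x).trace))
      = (1 - c) * g x - ((Fintype.card κ : ℂ)⁻¹ * z) * (f x * g x) := by
    intro x
    rw [hf, hg, hc]
    push_cast
    ring
  simp_rw [e] at hibp
  rw [integral_sub (iG.const_mul _) (iFG.const_mul _), integral_const_mul,
    integral_const_mul] at hibp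
  have hβf : (Fintype.card ι : ℂ) * β = ∫ x, f x ∂(complexGaussianPi (ι × κ)) := by
    rw [hβ, meanStieltjes, ← mul_assoc, mul_inv_cancel₀ hNc, one_mul]
  have hcβ : (c : ℂ) * z * β = (Fintype.card κ : ℂ)⁻¹ * z
      * ∫ x, f x ∂(complexGaussianPi (ι × κ)) := by
    rw [← hβf, hc]
    push_cast
    ring
  have hmp : mpMap a c z β = (Fintype.card ι : ℂ)⁻¹ * T.trace := by
    rw [hT, trace_unitaryDiagonal, mpMap]
  -- Integration by parts produces E[f g], whereas w, which contains β, produces E[f] E[g].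
  -- Everything except their difference cancels.
  have hdiff : β - mpMap a c z β = (Fintype.card ι : ℂ)⁻¹ * ((Fintype.card κ : ℂ)⁻¹ * z *
      (∫ x, f x * g x ∂(complexGaussianPi (ι × κ)) - (∫ x, f x ∂(complexGaussianPi (ι × κ)))
        * ∫ x, g x ∂(complexGaussianPi (ι × κ)))) := by
    have h1 : β = (Fintype.card ι : ℂ)⁻¹ * ∫ x, f x ∂(complexGaussianPi (ι × κ)) := by
      rw [← hβf, ← mul_assoc, inv_mul_cancel₀ hNc, one_mul]
    rw [hmp]
    nth_rewrite 1 [h1]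
    rw [← mul_sub]
    congr 1
    rw [hw, hcβ] at hfint
    linear_combination hfint - hibp
  have hD := lintegral_enorm_sq_trace_sub_le (κ := κ) hSh hz' 1
  simp only [Matrix.one_mul, norm_one, one_pow, mul_one, hy] at hD
  have hG := lintegral_enorm_sq_trace_sub_le (κ := κ) hSh hz' (T * (S * S))
  rw [hy] at hG
  set D : ℝ := Real.pi ^ 2 * c * Λ * z.im⁻¹ ^ 3 * (1 + ‖z‖ * z.im⁻¹) with hDdef
  -- The weight t is the bound on the norm of T R, so D t² is the variance bound for g.
  have hcov := norm_integral_mul_sub_le iF iG iFG (D := D) (t := Λ * z.im⁻¹) (by positivity)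
    (by positivity) (hD.trans (ENNReal.ofReal_le_ofReal (by rw [hDdef]; gcongr)))
    (hG.trans (ENNReal.ofReal_le_ofReal (by
      calc _ ≤ Real.pi ^ 2 * c * Λ * (Λ * z.im⁻¹) ^ 2 * z.im⁻¹ ^ 3 * (1 + ‖z‖ * z.im⁻¹) := by
            gcongr
        _ = _ := by rw [hDdef]; ring)))
  rw [hdiff, norm_mul, norm_mul, norm_mul, norm_inv, norm_inv, Complex.norm_natCast,
    Complex.norm_natCast]
  calc _ ≤ (Fintype.card ι : ℝ)⁻¹ * ((Fintype.card κ : ℝ)⁻¹ * ‖z‖ * (D * (Λ * z.im⁻¹) / 2)) := by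
        gcongr
    _ = (Real.pi ^ 2 / 2) * (Λ ^ 2 * ‖z‖ * z.im⁻¹ ^ 4 * (1 + ‖z‖ * z.im⁻¹)
          / (Fintype.card κ : ℝ) ^ 2) := by
        rw [hDdef, hc]
        field_simp
    _ ≤ 5 * (Λ ^ 2 * ‖z‖ * z.im⁻¹ ^ 4 * (1 + ‖z‖ * z.im⁻¹)
          / (Fintype.card κ : ℝ) ^ 2) := by
        gcongr
        nlinarith [Real.pi_lt_d2, Real.pi_pos]
    _ = _ := by ring

end MeanStieltjes

/-! ### Stability and uniqueness via the companion transform. -/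

section Stability

variable {ι : Type*} [Fintype ι] {a : ι → ℝ}

/-- The functional inverse `m ↦ -m⁻¹ + k ∑ᵢ aᵢ / (1 + aᵢ m)` of the companion Stieltjes
transform. -/
noncomputable def companionInv (a : ι → ℝ) (k : ℝ) (m : ℂ) : ℂ :=
  k * ∑ i, (a i : ℂ) * (1 + a i * m)⁻¹ - m⁻¹

/-- The contraction factor of the Marchenko–Pastur type equation at `m`. -/
noncomputable def companionFactor (a : ι → ℝ) (k : ℝ) (m : ℂ) : ℝ :=
  Complex.normSq m * (k * ∑ i, a i ^ 2 * (Complex.normSq (1 + a i * m))⁻¹)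

theorem one_add_ofReal_mul_ne_zero {m : ℂ} (hm : 0 < m.im) (t : ℝ) : 1 + (t : ℂ) * m ≠ 0 := by
  intro h
  have him := congrArg Complex.im h
  have hre := congrArg Complex.re h
  simp at him hre
  rcases him with h0 | h0
  · simp [h0] at hre
  · exact hm.ne' h0

theorem ne_zero_of_im_pos {m : ℂ} (hm : 0 < m.im) : m ≠ 0 := by
  rintro rfl
  simp at hm

/-- If the value of `companionInv` at m has nonnegative imaginary part, the factor at m is at most
1. If that imaginary part is positive, the gap below 1 is quantified. -/
theorem im_companionInv {m : ℂ} (hm : 0 < m.im) (k : ℝ) :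
    (companionInv a k m).im * Complex.normSq m = m.im * (1 - companionFactor a k m) := by
  have hn : Complex.normSq m ≠ 0 := Complex.normSq_eq_zero.not.2 (ne_zero_of_im_pos hm)
  have h1 : ∀ i, ((a i : ℂ) * (1 + a i * m)⁻¹).im
      = -(m.im * (a i ^ 2 * (Complex.normSq (1 + a i * m))⁻¹)) := fun i => by
    rw [Complex.im_ofReal_mul, Complex.inv_im]
    simp [div_eq_mul_inv]
    ring
  rw [companionInv, Complex.sub_im, Complex.im_ofReal_mul, Complex.im_sum, companionFactor,
    Complex.inv_im]
  simp_rw [h1]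
  rw [Finset.sum_neg_distrib, ← Finset.mul_sum]
  generalize ∑ i, a i ^ 2 * (Complex.normSq (1 + a i * m))⁻¹ = s
  field_simp
  ring

theorem companionInv_sub_mul {m₁ m₂ : ℂ} (h₁ : 0 < m₁.im) (h₂ : 0 < m₂.im) (k : ℝ) :
    (companionInv a k m₁ - companionInv a k m₂) * (m₁ * m₂) = (m₁ - m₂) *
      (1 - m₁ * m₂ * (k * ∑ i, (a i : ℂ) ^ 2 * ((1 + a i * m₁)⁻¹ * (1 + a i * m₂)⁻¹))) := by
  have n₁ := ne_zero_of_im_pos h₁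
  have n₂ := ne_zero_of_im_pos h₂
  have e : ∀ i, (a i : ℂ) * (1 + a i * m₁)⁻¹ = (a i : ℂ) * (1 + a i * m₂)⁻¹
      + (m₂ - m₁) * ((a i : ℂ) ^ 2 * ((1 + a i * m₁)⁻¹ * (1 + a i * m₂)⁻¹)) := fun i => by
    have d₁ := one_add_ofReal_mul_ne_zero h₁ (a i)
    have d₂ := one_add_ofReal_mul_ne_zero h₂ (a i)
    field_simp
    ring
  have hs : ∑ i, (a i : ℂ) * (1 + a i * m₁)⁻¹ = ∑ i, (a i : ℂ) * (1 + a i * m₂)⁻¹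
      + (m₂ - m₁) * ∑ i, (a i : ℂ) ^ 2 * ((1 + a i * m₁)⁻¹ * (1 + a i * m₂)⁻¹) := by
    rw [Finset.mul_sum, ← Finset.sum_add_distrib]
    exact Finset.sum_congr rfl fun i _ => e i
  rw [companionInv, companionInv, hs]
  field_simp
  ring_nf

/-- AM-GM term by term replaces the mixed sum of the divided difference by the diagonal sums at m₁
and m₂, which the imaginary parts control. -/
theorem norm_companion_cross_le {k : ℝ} (hk : 0 ≤ k) (m₁ m₂ : ℂ) :
    ‖m₁ * m₂ * (k * ∑ i, (a i : ℂ) ^ 2 * ((1 + a i * m₁)⁻¹ * (1 + a i * m₂)⁻¹))‖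
      ≤ (companionFactor a k m₁ + companionFactor a k m₂) / 2 := by
  have h : ∀ i, ‖m₁ * m₂ * ((a i : ℂ) ^ 2 * ((1 + a i * m₁)⁻¹ * (1 + a i * m₂)⁻¹))‖
      ≤ (Complex.normSq m₁ * (a i ^ 2 * (Complex.normSq (1 + a i * m₁))⁻¹)
        + Complex.normSq m₂ * (a i ^ 2 * (Complex.normSq (1 + a i * m₂))⁻¹)) / 2 := fun i => by
    simp only [norm_mul, norm_pow, norm_inv, Complex.normSq_eq_norm_sq, Complex.norm_real,
      Real.norm_eq_abs, sq_abs, ← inv_pow]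
    nlinarith [mul_nonneg (sq_nonneg (a i))
      (sq_nonneg (‖m₁‖ * ‖1 + (a i : ℂ) * m₁‖⁻¹ - ‖m₂‖ * ‖1 + (a i : ℂ) * m₂‖⁻¹))]
  have e : m₁ * m₂ * (k * ∑ i, (a i : ℂ) ^ 2 * ((1 + a i * m₁)⁻¹ * (1 + a i * m₂)⁻¹))
      = k * ∑ i, m₁ * m₂ * ((a i : ℂ) ^ 2 * ((1 + a i * m₁)⁻¹ * (1 + a i * m₂)⁻¹)) := by
    rw [← Finset.mul_sum]
    ring
  rw [e, norm_mul, Complex.norm_real, Real.norm_of_nonneg hk]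
  calc _ ≤ k * ∑ i, (Complex.normSq m₁ * (a i ^ 2 * (Complex.normSq (1 + a i * m₁))⁻¹)
        + Complex.normSq m₂ * (a i ^ 2 * (Complex.normSq (1 + a i * m₂))⁻¹)) / 2 :=
        mul_le_mul_of_nonneg_left ((norm_sum_le _ _).trans (Finset.sum_le_sum fun i _ => h i)) hk
    _ = _ := by
        rw [← Finset.sum_div, Finset.sum_add_distrib, ← Finset.mul_sum, ← Finset.mul_sum,
          companionFactor, companionFactor]
        ring

/-- Stability of the companion equation. -/
theorem norm_sub_mul_le_of_companionInv {k : ℝ} (hk : 0 ≤ k) {z η m₁ m₂ : ℂ} (hz : 0 < z.im)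
    (h₁ : 0 < m₁.im) (h₂ : 0 < m₂.im) (e₁ : companionInv a k m₁ = z + η)
    (e₂ : companionInv a k m₂ = z) (hη : ‖η‖ ≤ z.im) :
    ‖m₁ - m₂‖ * z.im ≤ 2 * ‖η * m₁‖ := by
  have i₁ := im_companionInv (a := a) h₁ k
  have i₂ := im_companionInv (a := a) h₂ k
  rw [e₁] at i₁
  rw [e₂] at i₂
  have hη' : 0 ≤ (z + η).im := by
    rw [Complex.add_im]
    linarith [neg_abs_le η.im, Complex.abs_im_le_norm η]
  -- At the perturbed point the trivial bound 1 is enough, and it needs only Im (z + η) ≥ 0. The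
  -- whole gap comes from the exact solution m₂, and averaging costs a factor 2.
  have t₁ : companionFactor a k m₁ ≤ 1 := by
    have : 0 ≤ m₁.im * (1 - companionFactor a k m₁) := by
      rw [← i₁]; exact mul_nonneg hη' (Complex.normSq_nonneg _)
    linarith [nonneg_of_mul_nonneg_right this h₁]
  have hs := companionInv_sub_mul (a := a) h₁ h₂ k
  rw [e₁, e₂, add_sub_cancel_left] at hs
  set Θ := m₁ * m₂ * (k * ∑ i, (a i : ℂ) ^ 2 * ((1 + a i * m₁)⁻¹ * (1 + a i * m₂)⁻¹)) with hΘ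
  have hΘn : ‖Θ‖ ≤ (companionFactor a k m₁ + companionFactor a k m₂) / 2 :=
    norm_companion_cross_le hk m₁ m₂
  have hm₂ : 0 < ‖m₂‖ := norm_pos_iff.2 (ne_zero_of_im_pos h₂)
  have him : m₂.im ≤ ‖m₂‖ := (le_abs_self _).trans (Complex.abs_im_le_norm _)
  rw [Complex.normSq_eq_norm_sq] at i₂
  have h3 : z.im * ‖m₂‖ ≤ 1 - companionFactor a k m₂ := by
    have hpos : 0 ≤ 1 - companionFactor a k m₂ := by
      have : 0 ≤ m₂.im * (1 - companionFactor a k m₂) := by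
        rw [← i₂]; positivity
      exact nonneg_of_mul_nonneg_right this h₂
    have : z.im * ‖m₂‖ ^ 2 ≤ ‖m₂‖ * (1 - companionFactor a k m₂) := by
      rw [i₂]; gcongr
    nlinarith
  have h4 : z.im * ‖m₂‖ / 2 ≤ ‖1 - Θ‖ := by
    have := norm_sub_norm_le (1 : ℂ) Θ
    rw [norm_one] at this
    linarith
  have h5 := congrArg norm hs
  rw [← mul_assoc, norm_mul, norm_mul (m₁ - m₂)] at h5
  have h6 : ‖m₁ - m₂‖ * (z.im * ‖m₂‖ / 2) ≤ ‖η * m₁‖ * ‖m₂‖ := by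
    rw [h5]; gcongr
  have h7 : (‖m₁ - m₂‖ * z.im) * ‖m₂‖ ≤ (2 * ‖η * m₁‖) * ‖m₂‖ := by linarith
  exact le_of_mul_le_mul_right h7 hm₂

/-- The companion of `b`. -/
noncomputable def companion (c : ℝ) (z b : ℂ) : ℂ := c * b - (1 - c) / z

/-- For c < 1 the pole at the origin alone gives the companion an imaginary part bounded below. -/
theorem le_im_companion {c : ℝ} (hc : 0 ≤ c) {z b : ℂ} (hb : 0 ≤ b.im) :
    (1 - c) * z.im / Complex.normSq z ≤ (companion c z b).im := by
  have h : (companion c z b).im = c * b.im + (1 - c) * z.im / Complex.normSq z := by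
    rw [companion, Complex.sub_im, Complex.im_ofReal_mul, div_eq_mul_inv,
      ← Complex.ofReal_one, ← Complex.ofReal_sub, Complex.im_ofReal_mul, Complex.inv_im]
    ring
  rw [h]
  linarith [mul_nonneg hc hb]

theorem im_companion_pos {c : ℝ} (hc : 0 ≤ c) (hc1 : c < 1) {z b : ℂ} (hz : 0 < z.im)
    (hb : 0 ≤ b.im) : 0 < (companion c z b).im := by
  have hn := Complex.normSq_pos.2 (ne_zero_of_im_pos hz)
  have : 0 < (1 - c) * z.im / Complex.normSq z := by
    have : 0 < 1 - c := by linarith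
    positivity
  exact this.trans_le (le_im_companion hc hb)

/-- Since 1 − c − c z b = −z m, each denominator is −z (1 + aᵢ m). The equation for b thus becomes
the equation for m, and the residual turns into a perturbation of the spectral parameter z. -/
theorem companionInv_companion [Nonempty ι] {c : ℝ} {z b : ℂ} (hz : 0 < z.im)
    (hm : 0 < (companion c z b).im) :
    companionInv a (c / Fintype.card ι) (companion c z b)
      = z + -(z * c * (b - mpMap a c z b)) / companion c z b := by
  have hz0 := ne_zero_of_im_pos hz
  set m := companion c z b with hmdef
  have hm0 := ne_zero_of_im_pos hm
  have hN : (Fintype.card ι : ℂ) ≠ 0 := by exact_mod_cast Fintype.card_ne_zero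
  have hw : 1 - c - c * z * b = -(z * m) := by
    rw [hmdef, companion]
    field_simp
    ring
  have e : ∀ i, ((a i : ℂ) * (1 - c - c * z * b) - z)⁻¹
      = -z⁻¹ * (1 - m * ((a i : ℂ) * (1 + a i * m)⁻¹)) := fun i => by
    have d := one_add_ofReal_mul_ne_zero hm (a i)
    have : (a i : ℂ) * (1 - c - c * z * b) - z = -(z * (1 + a i * m)) := by rw [hw]; ring
    rw [this, inv_neg, mul_inv]
    field_simp
    ring
  have hmap : z * c * mpMap a c z b = -c + m * ((c / Fintype.card ι : ℝ) *
      ∑ i, (a i : ℂ) * (1 + a i * m)⁻¹) := by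
    rw [mpMap]
    simp_rw [e]
    rw [← Finset.mul_sum, Finset.sum_sub_distrib, ← Finset.mul_sum]
    simp only [Finset.sum_const, Finset.card_univ, nsmul_eq_mul, mul_one]
    push_cast
    field_simp
    ring
  have hb : z * c * b = z * m + 1 - c := by linear_combination -hw
  rw [companionInv, mul_sub, hmap, hb]
  field_simp
  ring_nf

/-- Stability of the Marchenko–Pastur type equation. -/
theorem norm_sub_mul_im_le_of_mpMap [Nonempty ι] {c : ℝ} (hc : 0 < c) (hc1 : c < 1) {z b β : ℂ}
    (hz : 0 < z.im) (hb : 0 ≤ b.im) (hβ : 0 ≤ β.im) (e : mpMap a c z b = b)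
    (h : c * ‖z‖ * ‖β - mpMap a c z β‖ ≤ z.im * ‖companion c z β‖) :
    ‖β - b‖ * z.im ≤ 2 * (‖z‖ * ‖β - mpMap a c z β‖) := by
  have h₁ := im_companion_pos hc.le hc1 hz hβ
  have h₂ := im_companion_pos hc.le hc1 hz hb
  have hm := norm_pos_iff.2 (ne_zero_of_im_pos h₁)
  have e₁ := companionInv_companion (a := a) hz h₁
  have e₂ := companionInv_companion (a := a) hz h₂
  rw [e, sub_self, mul_zero, neg_zero, zero_div, add_zero] at e₂
  have hη : ‖-(z * c * (β - mpMap a c z β)) / companion c z β‖ ≤ z.im := by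
    rw [norm_div, norm_neg, norm_mul, norm_mul, Complex.norm_real, Real.norm_of_nonneg hc.le,
      div_le_iff₀ hm, mul_comm ‖z‖]
    exact h
  have hs := norm_sub_mul_le_of_companionInv (by positivity) hz h₁ h₂ e₁ e₂ hη
  rw [div_mul_cancel₀ _ (ne_zero_of_im_pos h₁), norm_neg, norm_mul, norm_mul, Complex.norm_real,
    Real.norm_of_nonneg hc.le] at hs
  have hd : companion c z β - companion c z b = c * (β - b) := by
    rw [companion, companion]; ring
  rw [hd, norm_mul, Complex.norm_real, Real.norm_of_nonneg hc.le] at hs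
  have : c * (‖β - b‖ * z.im) ≤ c * (2 * (‖z‖ * ‖β - mpMap a c z β‖)) := by linarith
  exact le_of_mul_le_mul_left this hc

theorem eq_of_mpMap_eq [Nonempty ι] {c : ℝ} (hc : 0 < c) (hc1 : c < 1) {z b β : ℂ}
    (hz : 0 < z.im) (hb : 0 ≤ b.im) (hβ : 0 ≤ β.im) (e : mpMap a c z b = b)
    (e' : mpMap a c z β = β) : β = b := by
  have h := norm_sub_mul_im_le_of_mpMap hc hc1 hz hb hβ e (by
    rw [e', sub_self, norm_zero, mul_zero]; positivity)
  rw [e', sub_self, norm_zero, mul_zero, mul_zero] at h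
  have h2 : ‖β - b‖ ≤ 0 := nonpos_of_mul_nonpos_left h hz
  exact sub_eq_zero.1 (norm_le_zero_iff.1 h2)

/-- The smallness condition on the residual is removed by a dichotomy: when it fails, the lower
bound on the companion forces the residual ε to satisfy |z|³ ε ≥ (1 − c) (Im z)², and the trivial
bound 2 / Im z is already of the claimed size. -/
theorem norm_sub_le_of_mpMap [Nonempty ι] {c : ℝ} (hc : 0 < c) (hc1 : c < 1) {z b β : ℂ}
    (hz : 0 < z.im) (hb : 0 ≤ b.im) (hβ : 0 ≤ β.im) (e : mpMap a c z b = b)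
    (nb : ‖b‖ ≤ z.im⁻¹) (nβ : ‖β‖ ≤ z.im⁻¹) :
    ‖β - b‖ ≤ 2 * ‖β - mpMap a c z β‖
      * (‖z‖ * z.im⁻¹ + ‖z‖ ^ 3 * z.im⁻¹ ^ 3 / (1 - c)) := by
  have hc' : 0 < 1 - c := by linarith
  set ε := ‖β - mpMap a c z β‖
  have hε : 0 ≤ ε := norm_nonneg _
  by_cases h : c * ‖z‖ * ε ≤ z.im * ‖companion c z β‖
  · have h1 := norm_sub_mul_im_le_of_mpMap hc hc1 hz hb hβ e h
    rw [← le_div_iff₀ hz] at h1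
    have h2 : 0 ≤ 2 * ε * (‖z‖ ^ 3 * z.im⁻¹ ^ 3 / (1 - c)) := by positivity
    calc _ ≤ _ := h1
      _ = 2 * ε * (‖z‖ * z.im⁻¹) := by rw [div_eq_mul_inv]; ring
      _ ≤ _ := by linarith
  · push Not at h
    have hz0 : 0 < ‖z‖ := norm_pos_iff.2 (ne_zero_of_im_pos hz)
    have h1 := (le_im_companion hc.le hβ (z := z)).trans
      ((le_abs_self _).trans (Complex.abs_im_le_norm _))
    rw [Complex.normSq_eq_norm_sq, div_le_iff₀ (by positivity)] at h1
    have h2 : (1 - c) * z.im ^ 2 ≤ ‖z‖ ^ 3 * ε := by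
      calc (1 - c) * z.im ^ 2 = z.im * ((1 - c) * z.im) := by ring
        _ ≤ z.im * (‖companion c z β‖ * ‖z‖ ^ 2) := by gcongr
        _ = (z.im * ‖companion c z β‖) * ‖z‖ ^ 2 := by ring
        _ ≤ (c * ‖z‖ * ε) * ‖z‖ ^ 2 := by gcongr
        _ ≤ (1 * ‖z‖ * ε) * ‖z‖ ^ 2 := by gcongr
        _ = _ := by ring
    have h3 : z.im⁻¹ ≤ ε * (‖z‖ ^ 3 * z.im⁻¹ ^ 3 / (1 - c)) := by
      rw [inv_pow, ← div_eq_mul_inv, div_div, ← mul_div_assoc, inv_eq_one_div,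
        div_le_div_iff₀ hz (by positivity)]
      nlinarith
    have h4 : 0 ≤ 2 * ε * (‖z‖ * z.im⁻¹) := by positivity
    calc ‖β - b‖ ≤ ‖β‖ + ‖b‖ := norm_sub_le _ _
      _ ≤ 2 * z.im⁻¹ := by linarith
      _ ≤ _ := by linarith

end Stability

/-! ### Empirical spectral measures and their measurability. -/

section SpectralMeasure

variable {ι : Type*} [Fintype ι] [DecidableEq ι]

/-- The empirical eigenvalue distribution of a Hermitian matrix. -/
noncomputable def empiricalSpectralMeasure {A : Matrix ι ι ℂ} (hA : A.IsHermitian) : Measure ℝ :=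
  (Fintype.card ι : ℝ≥0∞)⁻¹ • ∑ i, Measure.dirac (hA.eigenvalues i)

instance [Nonempty ι] {A : Matrix ι ι ℂ} (hA : A.IsHermitian) :
    IsProbabilityMeasure (empiricalSpectralMeasure hA) := by
  constructor
  rw [empiricalSpectralMeasure, Measure.smul_apply, Measure.finsetSum_apply]
  simp only [measure_univ, Finset.sum_const, Finset.card_univ, nsmul_eq_mul, mul_one, smul_eq_mul]
  exact ENNReal.inv_mul_cancel (by simp) (ENNReal.natCast_ne_top _)

theorem lintegral_empiricalSpectralMeasure {A : Matrix ι ι ℂ} (hA : A.IsHermitian)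
    (f : ℝ → ℝ≥0∞) : ∫⁻ x, f x ∂(empiricalSpectralMeasure hA)
      = (Fintype.card ι : ℝ≥0∞)⁻¹ * ∑ i, f (hA.eigenvalues i) := by
  rw [empiricalSpectralMeasure, lintegral_smul_measure, lintegral_finsetSum_measure]
  simp [lintegral_dirac]

theorem integral_empiricalSpectralMeasure {A : Matrix ι ι ℂ} (hA : A.IsHermitian)
    (f : ℝ → ℂ) : ∫ x, f x ∂(empiricalSpectralMeasure hA)
      = (Fintype.card ι : ℂ)⁻¹ * ∑ i, f (hA.eigenvalues i) := by
  rw [empiricalSpectralMeasure, integral_smul_measure, integral_finsetSum_measure]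
  · simp [integral_dirac, ENNReal.toReal_inv]
  · intro i _
    exact integrable_dirac (by simp)

/-- The sum is tr f(A), and the functional calculus is continuous in A. Continuity of individual
eigenvalues is not needed. -/
theorem continuous_sum_eigenvalues {X : Type*} [TopologicalSpace X] {A : X → Matrix ι ι ℂ}
    (hA : ∀ x, (A x).IsHermitian) (hc : Continuous A) {f : ℝ → ℝ} (hf : Continuous f) :
    Continuous fun x => ∑ i, f ((hA x).eigenvalues i) := by
  have h1 : Continuous fun x => cfc f (A x) :=
    hc.cfc_of_mem_nhdsSet f (s := Set.univ) Filter.univ_mem (fun x => hA x) hf.continuousOn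
  have h2 : Continuous fun x => ((cfc f (A x)).trace).re :=
    Complex.continuous_re.comp h1.matrix_trace
  refine h2.congr fun x => ?_
  rw [(hA x).cfc_eq_unitaryDiagonal, trace_unitaryDiagonal, Complex.re_sum]
  simp

/-- Closed sets form a generating π-system, and their indicators are limits of continuous functions,
whose spectral sums are continuous in the matrix. -/
theorem measurable_empiricalSpectralMeasure [Nonempty ι] {X : Type*} [TopologicalSpace X]
    [MeasurableSpace X] [OpensMeasurableSpace X] {A : X → Matrix ι ι ℂ}
    (hA : ∀ x, (A x).IsHermitian) (hc : Continuous A) :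
    Measurable fun x => empiricalSpectralMeasure (hA x) := by
  refine Measurable.measure_of_isPiSystem_of_isProbabilityMeasure
    (S := {s : Set ℝ | IsClosed s}) ?_ isPiSystem_isClosed ?_
  · rw [← borel_eq_generateFrom_isClosed]
    exact BorelSpace.measurable_eq
  · intro s hs
    have hs' : IsClosed s := hs
    refine measurable_of_tendsto_metrizable (f := fun (n : ℕ) x =>
      ∫⁻ t, (hs'.apprSeq n t : ℝ≥0∞) ∂(empiricalSpectralMeasure (hA x))) (fun n => ?_) ?_
    · simp_rw [lintegral_empiricalSpectralMeasure]
      refine Measurable.const_mul ?_ _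
      have e : ∀ x, ∑ i, (hs'.apprSeq n ((hA x).eigenvalues i) : ℝ≥0∞)
          = ENNReal.ofReal (∑ i, (hs'.apprSeq n ((hA x).eigenvalues i) : ℝ)) := by
        intro x
        rw [ENNReal.ofReal_sum_of_nonneg (fun i _ => NNReal.coe_nonneg _)]
        simp
      simp_rw [e]
      exact (ENNReal.continuous_ofReal.comp (continuous_sum_eigenvalues hA hc
        (f := fun t => (hs'.apprSeq n t : ℝ))
        (NNReal.continuous_coe.comp (hs'.apprSeq n).continuous))).measurable
    · rw [tendsto_pi_nhds]
      intro x
      exact HasOuterApproxClosed.tendsto_lintegral_apprSeq hs' _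

end SpectralMeasure

/-! ### The expected spectral measure. -/

section MeanSpectralMeasure

variable {ι : Type*} (κ : Type*) [Fintype κ] [Fintype ι] [DecidableEq ι] {S : Matrix ι ι ℂ}

/-- The expected empirical eigenvalue distribution of the sample covariance matrix. -/
noncomputable def meanSpectralMeasure (hS : S.IsHermitian) : Measure ℝ :=
  (complexGaussianPi (ι × κ)).bind fun x => empiricalSpectralMeasure (isHermitian_gramCov hS x)

variable [Nonempty ι] {κ}

theorem measurable_empiricalSpectralMeasure_gramCov (hS : S.IsHermitian) :
    Measurable fun x : ι × κ → ℂ => empiricalSpectralMeasure (isHermitian_gramCov hS x) :=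
  measurable_empiricalSpectralMeasure (fun x => isHermitian_gramCov hS x)
    (Continuous.gramCov S continuous_id continuous_id)

instance (hS : S.IsHermitian) : IsProbabilityMeasure (meanSpectralMeasure κ hS) := by
  constructor
  rw [meanSpectralMeasure, Measure.bind_apply MeasurableSet.univ
    (measurable_empiricalSpectralMeasure_gramCov hS).aemeasurable]
  simp

theorem continuous_one_div_ofReal_sub {z : ℂ} (hz : z.im ≠ 0) :
    Continuous fun x : ℝ => 1 / ((x : ℂ) - z) :=
  continuous_const.div (Complex.continuous_ofReal.sub continuous_const)
    (ofReal_sub_ne_zero_of_im_ne_zero hz)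

theorem norm_one_div_ofReal_sub_le {z : ℂ} (hz : z.im ≠ 0) (x : ℝ) :
    ‖1 / ((x : ℂ) - z)‖ ≤ |z.im|⁻¹ := by
  rw [one_div]
  exact norm_inv_ofReal_sub_le hz x

theorem integrable_one_div_ofReal_sub (F : Measure ℝ) [IsFiniteMeasure F] {z : ℂ}
    (hz : z.im ≠ 0) : Integrable (fun x : ℝ => 1 / ((x : ℂ) - z)) F :=
  (integrable_const |z.im|⁻¹).mono' (continuous_one_div_ofReal_sub hz).aestronglyMeasurable
    (ae_of_all _ (norm_one_div_ofReal_sub_le hz))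

theorem integrable_and_integral_meanSpectralMeasure (hS : S.IsHermitian) {f : ℝ → ℂ}
    (hf : Integrable f (meanSpectralMeasure κ hS)) :
    Integrable (fun x : ι × κ → ℂ =>
        ∫ t, f t ∂(empiricalSpectralMeasure (isHermitian_gramCov hS x)))
      (complexGaussianPi (ι × κ)) ∧
    ∫ x : ι × κ → ℂ, ∫ t, f t ∂(empiricalSpectralMeasure (isHermitian_gramCov hS x))
      ∂(complexGaussianPi (ι × κ)) = ∫ t, f t ∂(meanSpectralMeasure κ hS) := by
  let η : Kernel (ι × κ → ℂ) ℝ := ⟨_, measurable_empiricalSpectralMeasure_gramCov hS⟩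
  have e : meanSpectralMeasure κ hS
      = (η ∘ₖ Kernel.const Unit (complexGaussianPi (ι × κ))) () := by
    rw [← Measure.comp_eq_comp_const_apply]
    rfl
  rw [e] at hf ⊢
  refine ⟨?_, ?_⟩
  · have h := hf.integral_comp
    rwa [Kernel.const_apply] at h
  · rw [Kernel.integral_comp hf, Kernel.const_apply]
    rfl

theorem stieltjesTransform_meanSpectralMeasure (hS : S.IsHermitian) {z : ℂ} (hz : z.im ≠ 0) :
    stieltjesTransform (meanSpectralMeasure κ hS) z = meanStieltjes κ S z := by
  rw [stieltjesTransform_eq, ← (integrable_and_integral_meanSpectralMeasure hS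
    (integrable_one_div_ofReal_sub _ hz)).2, meanStieltjes, ← integral_const_mul]
  refine integral_congr_ae (ae_of_all _ fun x => ?_)
  change ∫ t, 1 / ((t : ℂ) - z) ∂(empiricalSpectralMeasure (isHermitian_gramCov hS x))
    = (Fintype.card ι : ℂ)⁻¹ * (matResolvent (gramCov S x x) z).trace
  rw [integral_empiricalSpectralMeasure, trace_matResolvent (isHermitian_gramCov hS x) hz]
  simp

omit [DecidableEq ι] [Nonempty ι] in
theorem integrable_trace_gramCov [DecidableEq κ] (S : Matrix ι ι ℂ) :
    Integrable (fun x : ι × κ → ℂ => (gramCov S x x).trace) (complexGaussianPi (ι × κ)) := by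
  have h := (integrable_trace_mul_pairMatrix_mul_conjTranspose (S * S)
    (1 : Matrix κ κ ℂ)).const_mul ((Fintype.card κ : ℂ)⁻¹)
  refine h.congr (ae_of_all _ fun x => ?_)
  simp only [gramCov, trace_smul, smul_eq_mul, Matrix.mul_one]
  congr 1
  rw [Matrix.trace_mul_comm _ S]
  simp only [Matrix.mul_assoc]

omit [DecidableEq ι] [Nonempty ι] in
theorem integral_trace_gramCov [DecidableEq κ] [Nonempty κ] (S : Matrix ι ι ℂ) :
    ∫ x : ι × κ → ℂ, (gramCov S x x).trace ∂(complexGaussianPi (ι × κ)) = (S * S).trace := by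
  have e : ∀ x : ι × κ → ℂ, (gramCov S x x).trace = (Fintype.card κ : ℂ)⁻¹
      * (S * S * pairMatrix x * (1 : Matrix κ κ ℂ) * (pairMatrix x)ᴴ).trace := by
    intro x
    simp only [gramCov, trace_smul, smul_eq_mul, Matrix.mul_one]
    congr 1
    rw [Matrix.trace_mul_comm _ S]
    simp only [Matrix.mul_assoc]
  have hK : (Fintype.card κ : ℂ) ≠ 0 := by exact_mod_cast Fintype.card_ne_zero
  simp_rw [e]
  rw [integral_const_mul, integral_trace_mul_pairMatrix_mul_conjTranspose, trace_one]
  field_simp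

/-- The eigenvalues are nonnegative, so the first absolute moment is an expected normalised trace.
Through Markov's inequality it yields tightness. -/
theorem lintegral_enorm_meanSpectralMeasure [Nonempty κ] (hS : S.IsHermitian) :
    ∫⁻ t, ‖t‖ₑ ∂(meanSpectralMeasure κ hS)
      = (Fintype.card ι : ℝ≥0∞)⁻¹ * ENNReal.ofReal ((S * S).trace).re := by
  classical
  rw [meanSpectralMeasure, Measure.lintegral_bind
    (measurable_empiricalSpectralMeasure_gramCov hS).aemeasurable (by fun_prop)]
  simp_rw [lintegral_empiricalSpectralMeasure]
  have e : ∀ x : ι × κ → ℂ, ∑ i, ‖(isHermitian_gramCov hS x).eigenvalues i‖ₑ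
      = ENNReal.ofReal ((gramCov S x x).trace).re := by
    intro x
    have h0 := (posSemidef_gramCov hS x).eigenvalues_nonneg
    rw [(isHermitian_gramCov hS x).trace_eq_sum_eigenvalues, Complex.re_sum,
      ENNReal.ofReal_sum_of_nonneg (fun i _ => by simpa using h0 i)]
    refine Finset.sum_congr rfl fun i _ => ?_
    rw [Real.enorm_of_nonneg (h0 i)]
    simp
  simp_rw [e]
  have hi : Integrable (fun x : ι × κ → ℂ => ((gramCov S x x).trace).re)
      (complexGaussianPi (ι × κ)) := (integrable_trace_gramCov S).re
  rw [lintegral_const_mul' _ _ (by simp), ← ofReal_integral_eq_lintegral_ofReal hi]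
  · have h := Complex.reCLM.integral_comp_comm (integrable_trace_gramCov (κ := κ) S)
    simp only [Complex.reCLM_apply] at h
    have h' : ∫ x : ι × κ → ℂ, ((gramCov S x x).trace).re ∂(complexGaussianPi (ι × κ))
        = ((S * S).trace).re := by rw [h, integral_trace_gramCov]
    rw [h']
  · refine ae_of_all _ fun x => ?_
    have h0 := (posSemidef_gramCov hS x).eigenvalues_nonneg
    change 0 ≤ ((gramCov S x x).trace).re
    rw [(isHermitian_gramCov hS x).trace_eq_sum_eigenvalues, Complex.re_sum]
    exact Finset.sum_nonneg fun i _ => by simpa using h0 i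

theorem meanSpectralMeasure_norm_gt_le [Nonempty κ] (hS : S.IsHermitian) {Λ r : ℝ}
    (hΛ : ((S * S).trace).re ≤ Fintype.card ι * Λ) (hr : 0 < r) :
    meanSpectralMeasure κ hS {x | r < ‖x‖} ≤ ENNReal.ofReal (Λ / r) := by
  have hN : (0 : ℝ) < Fintype.card ι := by exact_mod_cast Fintype.card_pos
  have h := mul_meas_ge_le_lintegral₀ (μ := meanSpectralMeasure κ hS)
    (f := fun t : ℝ => ‖t‖ₑ) (by fun_prop) (ENNReal.ofReal r)
  rw [lintegral_enorm_meanSpectralMeasure] at h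
  have h1 : (Fintype.card ι : ℝ≥0∞)⁻¹ * ENNReal.ofReal ((S * S).trace).re
      ≤ ENNReal.ofReal Λ := by
    rw [mul_comm, ← div_eq_mul_inv]
    refine ENNReal.div_le_of_le_mul ?_
    rw [← ENNReal.ofReal_natCast, ← ENNReal.ofReal_mul' hN.le, mul_comm]
    exact ENNReal.ofReal_le_ofReal hΛ
  rw [ENNReal.ofReal_div_of_pos hr, ENNReal.le_div_iff_mul_le (by simp [hr]) (by simp), mul_comm]
  refine le_trans ?_ (h.trans h1)
  gcongr
  intro hx
  rw [← ofReal_norm]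
  exact ENNReal.ofReal_le_ofReal (le_of_lt hx)

end MeanSpectralMeasure

/-! ### Existence of the deterministic equivalent by replication. -/

section Existence

theorem stieltjesTransform_tendsto {α : Type*} {l : Filter α} {μ : α → ProbabilityMeasure ℝ}
    {ν : ProbabilityMeasure ℝ} (h : Tendsto μ l (𝓝 ν)) {z : ℂ} (hz : z.im ≠ 0) :
    Tendsto (fun i => stieltjesTransform (μ i) z) l (𝓝 (stieltjesTransform ν z)) := by
  rw [ProbabilityMeasure.tendsto_iff_forall_integral_rclike_tendsto ℂ] at h
  simp_rw [stieltjesTransform_eq]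
  exact h (BoundedContinuousFunction.ofNormedAddCommGroup _ (continuous_one_div_ofReal_sub hz) _
    (norm_one_div_ofReal_sub_le hz))

variable {ι κ : Type*} [Fintype ι] [Fintype κ]

/-- The map depends only on the distribution of the eigenvalues, so the dimension can grow while the
equation stays fixed. -/
theorem mpMap_prod_fst {n : Type*} [Fintype n] [Nonempty n] (a : ι → ℝ) (c : ℝ) (z b : ℂ) :
    mpMap (fun p : ι × n => a p.1) c z b = mpMap a c z b := by
  have hn : (Fintype.card n : ℂ) ≠ 0 := by exact_mod_cast Fintype.card_ne_zero
  rw [mpMap, mpMap, Fintype.sum_prod_type]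
  simp only [Finset.sum_const, Finset.card_univ, nsmul_eq_mul, Fintype.card_prod, Nat.cast_mul]
  rw [← Finset.mul_sum, mul_inv, mul_assoc, ← mul_assoc _ (Fintype.card n : ℂ) _,
    inv_mul_cancel₀ hn, one_mul]

theorem continuousAt_mpMap {a : ι → ℝ} (ha : ∀ i, 0 ≤ a i) {c : ℝ} (hc : 0 ≤ c) {z b : ℂ}
    (hz : 0 < z.im) (hb : 0 ≤ (z * b).im) : ContinuousAt (mpMap a c z) b := by
  unfold mpMap
  refine continuousAt_const.mul (tendsto_finsetSum _ fun i _ => ?_)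
  refine ContinuousAt.inv₀ (by fun_prop) ?_
  exact norm_pos_iff.1 (hz.trans_le (le_norm_mpDenominator (ha i) hc hb))

/-- The Marchenko–Pastur type equation is solved by the Stieltjes transform of a probability
measure. -/
theorem exists_isProbabilityMeasure_mpMap_eq [Nonempty ι] [Nonempty κ] {a : ι → ℝ} {Λ : ℝ}
    (hΛ : 0 < Λ) (ha : ∀ i, 0 ≤ a i ∧ a i ≤ Λ) :
    ∃ F : Measure ℝ, IsProbabilityMeasure F ∧ ∀ z : ℂ, 0 < z.im →
      mpMap a ((Fintype.card ι : ℝ) / Fintype.card κ) z (stieltjesTransform F z)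
        = stieltjesTransform F z := by
  classical
  have hK : (0 : ℝ) < Fintype.card κ := by exact_mod_cast Fintype.card_pos
  set c : ℝ := (Fintype.card ι : ℝ) / Fintype.card κ with hc
  have hc0 : 0 ≤ c := by positivity
  let S : ∀ m : ℕ, Matrix (ι × Fin (m + 1)) (ι × Fin (m + 1)) ℂ := fun m =>
    unitaryDiagonal 1 (fun p => (Real.sqrt (a p.1) : ℂ))
  have hS : ∀ m, (S m).IsHermitian := fun m => by
    rw [Matrix.IsHermitian, conjTranspose_unitaryDiagonal]
    simp [S]
  have hSS : ∀ m, ((S m * S m).trace).re ≤ Fintype.card (ι × Fin (m + 1)) * Λ := fun m => by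
    rw [unitaryDiagonal_mul, trace_unitaryDiagonal, Complex.re_sum]
    refine (Finset.sum_le_card_nsmul _ _ Λ fun p _ => ?_).trans (by simp)
    rw [← Complex.ofReal_mul, Real.mul_self_sqrt (ha p.1).1]
    exact (ha p.1).2
  let ν : ℕ → ProbabilityMeasure ℝ := fun m =>
    ⟨meanSpectralMeasure (κ × Fin (m + 1)) (hS m), inferInstance⟩
  have htight : IsTightMeasureSet
      {((μ : ProbabilityMeasure ℝ) : Measure ℝ) | μ ∈ Set.range ν} := by
    refine isTightMeasureSet_of_tendsto_measure_norm_gt ?_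
    have h0 : Tendsto (fun r : ℝ => ENNReal.ofReal (Λ / r)) atTop (𝓝 0) := by
      rw [← ENNReal.ofReal_zero]
      exact (ENNReal.continuous_ofReal.tendsto 0).comp (tendsto_const_nhds.div_atTop tendsto_id)
    refine tendsto_of_tendsto_of_tendsto_of_le_of_le' tendsto_const_nhds h0
      (Eventually.of_forall fun _ => bot_le) ?_
    filter_upwards [eventually_gt_atTop 0] with r hr
    refine iSup₂_le fun μ hμ => ?_
    obtain ⟨_, ⟨m, rfl⟩, rfl⟩ := hμ
    exact meanSpectralMeasure_norm_gt_le (hS m) (hSS m) hr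
  -- Prokhorov's theorem. The limit is taken along one ultrafilter before z is chosen, so the same
  -- measure serves every z.
  obtain ⟨F, -, hF⟩ := (isCompact_closure_of_isTightMeasureSet htight).ultrafilter_le_nhds
    ((Ultrafilter.of atTop).map ν) (by
      rw [le_principal_iff]
      exact Filter.mem_map.2 (Filter.Eventually.of_forall fun m => subset_closure ⟨m, rfl⟩))
  have hF' : Tendsto ν ((Ultrafilter.of atTop : Ultrafilter ℕ) : Filter ℕ) (𝓝 F) := hF
  refine ⟨F, inferInstance, fun z hz => ?_⟩
  have hlim := stieltjesTransform_tendsto hF' hz.ne'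
  have hβ : ∀ m, stieltjesTransform (ν m) z = meanStieltjes (κ × Fin (m + 1)) (S m) z :=
    fun m => stieltjesTransform_meanSpectralMeasure (hS m) hz.ne'
  -- This closed condition survives the limit and is what makes `mpMap` continuous at the limiting
  -- value.
  have him : 0 ≤ (z * stieltjesTransform F z).im := by
    refine ge_of_tendsto' ((Complex.continuous_im.tendsto _).comp (hlim.const_mul z)) fun m => ?_
    change 0 ≤ (z * stieltjesTransform (ν m) z).im
    rw [hβ]
    exact im_mul_meanStieltjes_nonneg (hS m) hz
  have hmap := ((continuousAt_mpMap (fun i => (ha i).1) hc0 hz him).tendsto).comp hlim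
  set C : ℝ := 5 * Λ ^ 2 * ‖z‖ * z.im⁻¹ ^ 4 * (1 + ‖z‖ * z.im⁻¹) with hC
  have hbound : ∀ m, ‖stieltjesTransform (ν m) z - mpMap a c z (stieltjesTransform (ν m) z)‖
      ≤ C / (Fintype.card κ * ((m : ℝ) + 1)) ^ 2 := by
    intro m
    have h := norm_meanStieltjes_sub_mpMap_le (κ := κ × Fin (m + 1)) (S := S m) 1
      (a := fun p : ι × Fin (m + 1) => a p.1) hΛ (fun p => ha p.1) rfl hz
    have ec : (Fintype.card (ι × Fin (m + 1)) : ℝ) / Fintype.card (κ × Fin (m + 1)) = c := by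
      rw [hc, Fintype.card_prod, Fintype.card_prod]
      push_cast
      rw [mul_div_mul_right]
      simp
      positivity
    rw [ec, mpMap_prod_fst, ← hβ] at h
    simpa only [Fintype.card_prod, Fintype.card_fin, Nat.cast_mul, Nat.cast_add, Nat.cast_one]
      using h
  have hzero : Tendsto (fun m => stieltjesTransform (ν m) z
      - mpMap a c z (stieltjesTransform (ν m) z)) atTop (𝓝 0) := by
    refine squeeze_zero_norm hbound (tendsto_const_nhds.div_atTop ?_)
    refine (tendsto_pow_atTop two_ne_zero).comp (Tendsto.const_mul_atTop hK ?_)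
    exact tendsto_atTop_add_const_right _ _ tendsto_natCast_atTop_atTop
  have := tendsto_nhds_unique (hlim.sub hmap) (hzero.mono_left (Ultrafilter.of_le atTop))
  exact (sub_eq_zero.1 this).symm

end Existence

/-! ### Elementary properties of Stieltjes transforms. -/

section StieltjesTransform

variable (F : Measure ℝ)

theorem stieltjesTransform_conj (z : ℂ) :
    stieltjesTransform F (conj z) = conj (stieltjesTransform F z) := by
  rw [stieltjesTransform_eq, stieltjesTransform_eq, ← integral_conj]
  simp

theorem norm_stieltjesTransform_le [IsProbabilityMeasure F] {z : ℂ} (hz : z.im ≠ 0) :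
    ‖stieltjesTransform F z‖ ≤ |z.im|⁻¹ := by
  rw [stieltjesTransform_eq]
  simpa using norm_integral_le_of_norm_le_const (μ := F)
    (ae_of_all _ (norm_one_div_ofReal_sub_le hz))

theorem im_stieltjesTransform_nonneg [IsFiniteMeasure F] {z : ℂ} (hz : 0 < z.im) :
    0 ≤ (stieltjesTransform F z).im := by
  have h := Complex.imCLM.integral_comp_comm (integrable_one_div_ofReal_sub F hz.ne')
  simp only [Complex.imCLM_apply] at h
  rw [stieltjesTransform_eq, ← h]
  refine integral_nonneg fun x => ?_
  change 0 ≤ (1 / ((x : ℂ) - z)).im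
  rw [one_div, im_inv_ofReal_sub]
  have := Complex.normSq_nonneg ((x : ℂ) - z)
  positivity

theorem hasDerivAt_stieltjesTransform [IsFiniteMeasure F] {z : ℂ} (hz : z.im ≠ 0) :
    HasDerivAt (stieltjesTransform F) (∫ x : ℝ, (1 / ((x : ℂ) - z)) ^ 2 ∂F) z := by
  have h := hasDerivAt_resolventTransform (μ := F) z (by
    rintro ⟨x, -, rfl⟩
    simp at hz)
  simp only [resolvent, Ring.inverse_eq_inv', Complex.coe_algebraMap, ← one_div] at h
  exact h

theorem integrable_sq_one_div_ofReal_sub [IsFiniteMeasure F] {z : ℂ} (hz : z.im ≠ 0) :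
    Integrable (fun x : ℝ => (1 / ((x : ℂ) - z)) ^ 2) F := by
  refine (integrable_const (|z.im|⁻¹ ^ 2)).mono'
    ((continuous_one_div_ofReal_sub hz).pow 2).aestronglyMeasurable (ae_of_all _ fun x => ?_)
  rw [norm_pow]
  have := norm_one_div_ofReal_sub_le hz x
  gcongr

end StieltjesTransform

/-! ### Transfer from the random data to the Gaussian product measure. -/

section SampleStieltjes

theorem empiricalSpectralMeasure_congr {ι : Type*} [Fintype ι] [DecidableEq ι]
    {A B : Matrix ι ι ℂ} (h : A = B) (hA : A.IsHermitian) (hB : B.IsHermitian) :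
    empiricalSpectralMeasure hA = empiricalSpectralMeasure hB := by
  subst h
  rfl

variable {N K : ℕ}

theorem isHermitian_cfc_sqrt (R : Matrix (Fin N) (Fin N) ℂ) : (cfc Real.sqrt R).IsHermitian :=
  cfc_predicate Real.sqrt R

theorem sampleCov_eq_gramCov (R : Matrix (Fin N) (Fin N) ℂ) (X : Matrix (Fin N) (Fin K) ℂ) :
    sampleCov R X = gramCov (cfc Real.sqrt R) (fun p : Fin N × Fin K => X p.1 p.2)
      (fun p => X p.1 p.2) := by
  have hX : pairMatrix (fun p : Fin N × Fin K => X p.1 p.2) = X := rfl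
  have hK : (1 / Real.sqrt (K : ℝ)) * (1 / Real.sqrt (K : ℝ)) = (K : ℝ)⁻¹ := by
    rw [div_mul_div_comm, Real.mul_self_sqrt (Nat.cast_nonneg K), one_mul, one_div]
  rw [sampleCov, observationMatrix, gramCov, hX, conjTranspose_smul, conjTranspose_mul,
    (isHermitian_cfc_sqrt R).eq, Matrix.smul_mul, Matrix.mul_smul, smul_smul]
  congr 1
  · rw [Complex.star_def, Complex.conj_ofReal, ← Complex.ofReal_mul, hK]
    simp
  · simp only [Matrix.mul_assoc]

theorem sampleStieltjes_eq (R : Matrix (Fin N) (Fin N) ℂ) (X : Matrix (Fin N) (Fin K) ℂ) :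
    sampleStieltjes R X = stieltjesTransform (empiricalSpectralMeasure
      (isHermitian_gramCov (isHermitian_cfc_sqrt R)
        (fun p : Fin N × Fin K => X p.1 p.2))) := by
  funext z
  rw [empiricalSpectralMeasure_congr (sampleCov_eq_gramCov R X).symm _ (sampleCov_isHermitian R X),
    stieltjesTransform_eq, integral_empiricalSpectralMeasure, sampleStieltjes]
  simp

variable {Ω : Type*} [MeasurableSpace Ω] {P : Measure Ω} [IsProbabilityMeasure P]
  {X : Ω → Matrix (Fin N) (Fin K) ℂ}

theorem hasLaw_complexGaussianPi (hXlaw : ∀ i j, HasLaw (fun ω => X ω i j) stdComplexGaussian P)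
    (hXindep : iIndepFun (fun (p : Fin N × Fin K) ω => X ω p.1 p.2) P) :
    HasLaw (fun ω (p : Fin N × Fin K) => X ω p.1 p.2) (complexGaussianPi (Fin N × Fin K)) P where
  aemeasurable := aemeasurable_pi_lambda _ fun p => (hXlaw p.1 p.2).aemeasurable
  map_eq := by
    refine ((iIndepFun_iff_map_fun_eq_pi_map fun p : Fin N × Fin K =>
      (hXlaw p.1 p.2).aemeasurable).1 hXindep).trans ?_
    unfold complexGaussianPi
    congr 1
    funext p
    exact (hXlaw p.1 p.2).map_eq

omit [IsProbabilityMeasure P] in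
theorem integrable_and_integral_comp {E : Type*} [MeasurableSpace E] {μ : Measure E} {Y : Ω → E}
    (hY : HasLaw Y μ P) {f : E → ℂ} (hf : Integrable f μ) :
    Integrable (fun ω => f (Y ω)) P ∧ ∫ ω, f (Y ω) ∂P = ∫ x, f x ∂μ := by
  refine ⟨?_, hY.integral_comp hf.aestronglyMeasurable⟩
  rw [← hY.map_eq] at hf
  exact (integrable_map_measure hf.aestronglyMeasurable hY.aemeasurable).1 hf

variable [NeZero N]

theorem sampleStieltjes_integrable_and_integral
    (hXlaw : ∀ i j, HasLaw (fun ω => X ω i j) stdComplexGaussian P)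
    (hXindep : iIndepFun (fun (p : Fin N × Fin K) ω => X ω p.1 p.2) P)
    (R : Matrix (Fin N) (Fin N) ℂ) {z : ℂ} (hz : z.im ≠ 0) :
    Integrable (fun ω => sampleStieltjes R (X ω) z) P ∧
      ∫ ω, sampleStieltjes R (X ω) z ∂P
        = stieltjesTransform (meanSpectralMeasure (Fin K) (isHermitian_cfc_sqrt R)) z := by
  obtain ⟨h1, h2⟩ := integrable_and_integral_meanSpectralMeasure (κ := Fin K)
    (isHermitian_cfc_sqrt R) (integrable_one_div_ofReal_sub _ hz)
  obtain ⟨h3, h4⟩ := integrable_and_integral_comp (hasLaw_complexGaussianPi hXlaw hXindep) h1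
  simp_rw [sampleStieltjes_eq, stieltjesTransform_eq]
  exact ⟨h3, h4.trans h2⟩

theorem deriv_sampleStieltjes_integrable_and_integral
    (hXlaw : ∀ i j, HasLaw (fun ω => X ω i j) stdComplexGaussian P)
    (hXindep : iIndepFun (fun (p : Fin N × Fin K) ω => X ω p.1 p.2) P)
    (R : Matrix (Fin N) (Fin N) ℂ) {z : ℂ} (hz : z.im ≠ 0) :
    Integrable (fun ω => deriv (sampleStieltjes R (X ω)) z) P ∧
      ∫ ω, deriv (sampleStieltjes R (X ω)) z ∂P
        = deriv (stieltjesTransform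
          (meanSpectralMeasure (Fin K) (isHermitian_cfc_sqrt R))) z := by
  obtain ⟨h1, h2⟩ := integrable_and_integral_meanSpectralMeasure (κ := Fin K)
    (isHermitian_cfc_sqrt R) (integrable_sq_one_div_ofReal_sub _ hz)
  obtain ⟨h3, h4⟩ := integrable_and_integral_comp (hasLaw_complexGaussianPi hXlaw hXindep) h1
  simp_rw [sampleStieltjes_eq, (hasDerivAt_stieltjesTransform _ hz).deriv]
  exact ⟨h3, h4.trans h2⟩

end SampleStieltjes

/-! ### Eigenvalues with multiplicity. -/

section DistinctEigenvalues

variable {N L : ℕ} {R : Matrix (Fin N) (Fin N) ℂ} {ev : Fin L → ℝ} {mult : Fin L → ℕ}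

theorem HasDistinctEigenvalues.exists_eigenvalues_eq (h : HasDistinctEigenvalues R ev mult)
    (hR : R.IsHermitian) :
    (∀ j, ∃ i, hR.eigenvalues j = ev i) ∧
      ∀ f : ℝ → ℂ, ∑ i, (mult i : ℂ) * f (ev i) = ∑ j, f (hR.eigenvalues j) := by
  classical
  obtain ⟨hev, -, hsum, _, hcard⟩ := h
  have hdisj : (Set.univ : Set (Fin L)).PairwiseDisjoint
      (fun i => Finset.univ.filter (fun j : Fin N => hR.eigenvalues j = ev i)) := by
    intro i _ i' _ hii
    rw [Function.onFun, Finset.disjoint_left]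
    intro j hj hj'
    rw [Finset.mem_filter] at hj hj'
    exact hii (hev.injective (hj.2.symm.trans hj'.2))
  have hdisj' : Set.PairwiseDisjoint (↑(Finset.univ : Finset (Fin L)))
      (fun i => Finset.univ.filter (fun j : Fin N => hR.eigenvalues j = ev i)) := by
    simpa using hdisj
  have huniv : Finset.univ.biUnion
      (fun i => Finset.univ.filter (fun j : Fin N => hR.eigenvalues j = ev i))
      = Finset.univ := by
    -- The level sets are disjoint and their sizes add up to N, so they exhaust the indices: R has
    -- no eigenvalue outside the list.
    rw [← Finset.card_eq_iff_eq_univ, Finset.card_biUnion hdisj', Fintype.card_fin]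
    exact (Finset.sum_congr rfl fun i _ => hcard i).trans hsum
  refine ⟨fun j => ?_, fun f => ?_⟩
  · have := Finset.mem_univ j
    rw [← huniv] at this
    simpa using this
  · rw [← huniv, Finset.sum_biUnion hdisj']
    refine Finset.sum_congr rfl fun i _ => ?_
    rw [Finset.sum_congr rfl (g := fun _ => f (ev i)) fun j hj => by
      rw [(Finset.mem_filter.1 hj).2], Finset.sum_const, hcard i, nsmul_eq_mul]

theorem HasDistinctEigenvalues.mpEquation_iff (h : HasDistinctEigenvalues R ev mult)
    (hR : R.IsHermitian) (K : ℕ) (z b : ℂ) :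
    MPEquation N K ev mult z b ↔ mpMap hR.eigenvalues ((N : ℝ) / K) z b = b := by
  have := (h.exists_eigenvalues_eq hR).2
    (fun t => 1 / ((t : ℂ) * (1 - (N : ℂ) / (K : ℂ) - (N : ℂ) / (K : ℂ) * z * b) - z))
  rw [MPEquation, this, mpMap, eq_comm]
  simp

end DistinctEigenvalues

/-- The coefficients are real. This carries all results from the upper to the lower half-plane. -/
theorem MPEquation.conj {L N K : ℕ} {ev : Fin L → ℝ} {mult : Fin L → ℕ} {z b : ℂ}
    (h : MPEquation N K ev mult z b) : MPEquation N K ev mult (conj z) (conj b) := by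
  rw [MPEquation] at h ⊢
  nth_rewrite 1 [h]
  simp

/-! ### Quantitative comparison with the deterministic equivalent. -/

section DeterministicEquivalent

variable {N K L : ℕ} [NeZero N] [NeZero K] {R : Matrix (Fin N) (Fin N) ℂ} {ev : Fin L → ℝ}
  {mult : Fin L → ℕ} {Λ : ℝ}

omit [NeZero N] in
theorem HasDistinctEigenvalues.eigenvalues_mem (h : HasDistinctEigenvalues R ev mult)
    (hev : ∀ i, 0 < ev i ∧ ev i < Λ) (hR : R.IsHermitian) (j : Fin N) :
    0 ≤ hR.eigenvalues j ∧ hR.eigenvalues j ≤ Λ := by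
  obtain ⟨i, hi⟩ := (h.exists_eigenvalues_eq hR).1 j
  rw [hi]
  exact ⟨(hev i).1.le, (hev i).2.le⟩

theorem isMPMeasure_mpMeasure (h : HasDistinctEigenvalues R ev mult)
    (hev : ∀ i, 0 < ev i ∧ ev i < Λ) : IsMPMeasure N K ev mult (mpMeasure N K ev mult) := by
  have hR : R.IsHermitian := h.2.2.2.choose
  have hex : ∃ F : Measure ℝ, IsMPMeasure N K ev mult F := by
    have ha := h.eigenvalues_mem hev hR
    have hΛ : 0 < Λ := by
      obtain ⟨i, -⟩ := (h.exists_eigenvalues_eq hR).1 0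
      exact (hev i).1.trans (hev i).2
    obtain ⟨F, hF, hmp⟩ := exists_isProbabilityMeasure_mpMap_eq (κ := Fin K) hΛ ha
    rw [Fintype.card_fin, Fintype.card_fin] at hmp
    refine ⟨F, hF, fun z hz => ?_⟩
    rcases hz.lt_or_gt with hz | hz
    · have h1 := (h.mpEquation_iff hR K (conj z) _).2 (hmp (conj z) (by simpa using hz))
      have h2 := h1.conj
      rwa [stieltjesTransform_conj, Complex.conj_conj, Complex.conj_conj] at h2
    · exact (h.mpEquation_iff hR K z _).2 (hmp z hz)
  rw [mpMeasure, dif_pos hex]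
  exact hex.choose_spec

omit [NeZero N] [NeZero K] in
theorem mpStieltjes_conj (ev : Fin L → ℝ) (mult : Fin L → ℕ) (z : ℂ) :
    mpStieltjes N K ev mult (conj z) = conj (mpStieltjes N K ev mult z) :=
  stieltjesTransform_conj _ z

theorem MPEquation.eq_mpStieltjes (h : HasDistinctEigenvalues R ev mult)
    (hev : ∀ i, 0 < ev i ∧ ev i < Λ) (hc : (N : ℝ) / K < 1) {z b : ℂ} (hb : 0 < b.im * z.im)
    (e : MPEquation N K ev mult z b) : b = mpStieltjes N K ev mult z := by
  have hR : R.IsHermitian := h.2.2.2.choose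
  have hN : (0 : ℝ) < N := by exact_mod_cast NeZero.pos N
  have hK : (0 : ℝ) < K := by exact_mod_cast NeZero.pos K
  obtain ⟨hF, hmp⟩ := isMPMeasure_mpMeasure (K := K) h hev
  have key : ∀ {z b : ℂ}, 0 < z.im → 0 ≤ b.im → MPEquation N K ev mult z b →
      b = mpStieltjes N K ev mult z := fun hz hb e =>
    eq_of_mpMap_eq (div_pos hN hK) hc hz (im_stieltjesTransform_nonneg _ hz) hb
      ((h.mpEquation_iff hR K _ _).1 (hmp _ hz.ne')) ((h.mpEquation_iff hR K _ _).1 e)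
  rcases lt_trichotomy z.im 0 with hz | hz | hz
  · have hb' : b.im < 0 := by nlinarith
    have := key (z := conj z) (b := conj b) (by simpa using hz) (by simpa using hb'.le) e.conj
    rw [mpStieltjes_conj] at this
    exact (starRingEnd ℂ).injective this
  · simp [hz] at hb
  · exact key hz (pos_of_mul_pos_left hb hz.le).le e

theorem differentiableAt_mpStieltjes (h : HasDistinctEigenvalues R ev mult)
    (hev : ∀ i, 0 < ev i ∧ ev i < Λ) {z : ℂ} (hz : z.im ≠ 0) :
    DifferentiableAt ℂ (mpStieltjes N K ev mult) z := by
  have := (isMPMeasure_mpMeasure (K := K) h hev).1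
  exact (hasDerivAt_stieltjesTransform (mpMeasure N K ev mult) hz).differentiableAt

theorem norm_meanSpectralMeasure_sub_mpStieltjes_le (h : HasDistinctEigenvalues R ev mult)
    (hev : ∀ i, 0 < ev i ∧ ev i < Λ) {D : ℝ} (hc : (N : ℝ) / K < 1)
    (hD : (1 - (N : ℝ) / K)⁻¹ ≤ D) {z : ℂ} (hz : z.im ≠ 0) :
    ‖stieltjesTransform (meanSpectralMeasure (Fin K) (isHermitian_cfc_sqrt R)) z
        - mpStieltjes N K ev mult z‖
      ≤ 10 * Λ ^ 2 * (1 + D) / K ^ 2 * (1 + ‖z‖) ^ 5 * (1 + |z.im|⁻¹) ^ 8 := by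
  have hR : R.IsHermitian := h.2.2.2.choose
  have hN : (0 : ℝ) < N := by exact_mod_cast NeZero.pos N
  have hK : (0 : ℝ) < K := by exact_mod_cast NeZero.pos K
  obtain ⟨hF, hmp⟩ := isMPMeasure_mpMeasure (K := K) h hev
  have hΛ : 0 < Λ := by
    obtain ⟨i, -⟩ := (h.exists_eigenvalues_eq hR).1 0
    exact (hev i).1.trans (hev i).2
  have hD0 : 0 ≤ D := le_trans (inv_nonneg.2 (by linarith)) hD
  wlog hz' : 0 < z.im generalizing z
  · have hzc : 0 < (conj z).im := by
      simpa using lt_of_le_of_ne (not_lt.1 hz') hz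
    have := this hzc.ne' hzc
    rwa [mpStieltjes_conj, stieltjesTransform_conj, ← map_sub, Complex.norm_conj,
      Complex.norm_conj, Complex.conj_im, abs_neg] at this
  set y := z.im with hy
  set β := stieltjesTransform (meanSpectralMeasure (Fin K) (isHermitian_cfc_sqrt R)) z with hβ
  have hβm : β = meanStieltjes (Fin K) (cfc Real.sqrt R) z :=
    stieltjesTransform_meanSpectralMeasure _ hz
  have hyabs : |y| = y := abs_of_pos hz'
  have h1 := norm_meanStieltjes_sub_mpMap_le (κ := Fin K) hR.eigenvectorUnitary hΛ
    (h.eigenvalues_mem hev hR) (hR.cfc_eq_unitaryDiagonal Real.sqrt) hz'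
  rw [← hβm, Fintype.card_fin, Fintype.card_fin] at h1
  have nβ : ‖β‖ ≤ y⁻¹ := hyabs ▸ norm_stieltjesTransform_le _ hz
  have nb : ‖mpStieltjes N K ev mult z‖ ≤ y⁻¹ := hyabs ▸ norm_stieltjesTransform_le _ hz
  have h2 := norm_sub_le_of_mpMap (div_pos hN hK) hc hz' (im_stieltjesTransform_nonneg _ hz')
    (im_stieltjesTransform_nonneg _ hz') ((h.mpEquation_iff hR K _ _).1 (hmp _ hz)) nb nβ
  rw [hyabs]
  set u := 1 + ‖z‖ with hu
  set v := 1 + y⁻¹ with hv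
  have hy0 : 0 < y⁻¹ := inv_pos.2 hz'
  have hz0 := norm_nonneg z
  have hu1 : 1 ≤ u := by linarith
  have hv1 : 1 ≤ v := by linarith
  have hzu : ‖z‖ ≤ u := by linarith
  have hyv : y⁻¹ ≤ v := by linarith
  have hzy : 1 + ‖z‖ * y⁻¹ ≤ u * v := by rw [hu, hv]; nlinarith
  have hdiv : (1 - (N : ℝ) / K)⁻¹ ≤ D := hD
  have huv : 1 ≤ u * v := one_le_mul_of_one_le_of_one_le hu1 hv1
  have h3 : ‖z‖ * y⁻¹ + ‖z‖ ^ 3 * y⁻¹ ^ 3 / (1 - (N : ℝ) / K) ≤ (1 + D) * (u * v) ^ 3 := by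
    have e1 : ‖z‖ * y⁻¹ ≤ (u * v) ^ 3 := by
      calc ‖z‖ * y⁻¹ ≤ u * v := by gcongr
        _ = (u * v) ^ 1 := (pow_one _).symm
        _ ≤ (u * v) ^ 3 := pow_le_pow_right₀ huv (by norm_num)
    have e2 : ‖z‖ ^ 3 * y⁻¹ ^ 3 / (1 - (N : ℝ) / K) ≤ (u * v) ^ 3 * D := by
      rw [div_eq_mul_inv, ← mul_pow]
      have : 0 ≤ (1 - (N : ℝ) / K)⁻¹ := inv_nonneg.2 (by linarith)
      gcongr
    linarith
  have h4 : 5 * Λ ^ 2 * ‖z‖ * y⁻¹ ^ 4 * (1 + ‖z‖ * y⁻¹) / (K : ℝ) ^ 2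
      ≤ 5 * Λ ^ 2 * u * v ^ 4 * (u * v) / (K : ℝ) ^ 2 := by
    gcongr
  refine h2.trans ?_
  -- The residual carries u² v⁵ and the stability factor (u v)³, whence the exponents 5 and 8.
  calc _ ≤ 2 * (5 * Λ ^ 2 * u * v ^ 4 * (u * v) / (K : ℝ) ^ 2) * ((1 + D) * (u * v) ^ 3) := by
        have := h1.trans h4
        gcongr
    _ = _ := by ring

/-- Cauchy's estimate for the holomorphic difference on the circle of radius |Im z| / 2, which stays
off the real axis. -/
theorem norm_deriv_meanSpectralMeasure_sub_mpStieltjes_le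
    (h : HasDistinctEigenvalues R ev mult)
    (hev : ∀ i, 0 < ev i ∧ ev i < Λ) {D : ℝ} (hc : (N : ℝ) / K < 1)
    (hD : (1 - (N : ℝ) / K)⁻¹ ≤ D) {z : ℂ} (hz : z.im ≠ 0) :
    ‖deriv (stieltjesTransform (meanSpectralMeasure (Fin K) (isHermitian_cfc_sqrt R))) z
        - deriv (mpStieltjes N K ev mult) z‖
      ≤ 2 ^ 14 * (10 * Λ ^ 2 * (1 + D)) / K ^ 2 * (1 + ‖z‖) ^ 5 * (1 + |z.im|⁻¹) ^ 9 := by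
  have hD0 : 0 ≤ D := le_trans (inv_nonneg.2 (by linarith)) hD
  set G := stieltjesTransform (meanSpectralMeasure (Fin K) (isHermitian_cfc_sqrt R)) with hG
  have hdG : ∀ w : ℂ, w.im ≠ 0 → DifferentiableAt ℂ G w := fun w hw =>
    (hasDerivAt_stieltjesTransform _ hw).differentiableAt
  have hdF : ∀ w : ℂ, w.im ≠ 0 → DifferentiableAt ℂ (mpStieltjes N K ev mult) w := fun w hw =>
    differentiableAt_mpStieltjes h hev hw
  have hy : 0 < |z.im| := abs_pos.2 hz
  have him : ∀ w ∈ Metric.closedBall z (|z.im| / 2), |z.im| / 2 ≤ |w.im| := by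
    intro w hw
    have h1 : |w.im - z.im| ≤ |z.im| / 2 := by
      rw [← Complex.sub_im]
      exact (Complex.abs_im_le_norm _).trans (mem_closedBall_iff_norm.1 hw)
    have h2 := abs_sub_abs_le_abs_sub z.im w.im
    rw [abs_sub_comm] at h2
    linarith
  have him0 : ∀ w ∈ Metric.closedBall z (|z.im| / 2), w.im ≠ 0 := fun w hw =>
    abs_pos.1 ((half_pos hy).trans_le (him w hw))
  have hdiff : DifferentiableOn ℂ (G - mpStieltjes N K ev mult)
      (Metric.closedBall z (|z.im| / 2)) := fun w hw =>
    ((hdG w (him0 w hw)).sub (hdF w (him0 w hw))).differentiableWithinAt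
  have hcont : DiffContOnCl ℂ (G - mpStieltjes N K ev mult) (Metric.ball z (|z.im| / 2)) :=
    hdiff.diffContOnCl_ball le_rfl
  have hzn : |z.im| ≤ ‖z‖ := Complex.abs_im_le_norm z
  have hsphere : ∀ w ∈ Metric.sphere z (|z.im| / 2),
      ‖(G - mpStieltjes N K ev mult) w‖ ≤ 10 * Λ ^ 2 * (1 + D) / K ^ 2 * (2 * (1 + ‖z‖)) ^ 5
        * (2 * (1 + |z.im|⁻¹)) ^ 8 := by
    intro w hw
    have hw' := Metric.sphere_subset_closedBall hw
    refine (norm_meanSpectralMeasure_sub_mpStieltjes_le h hev hc hD (him0 w hw')).trans ?_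
    have e1 : ‖w‖ ≤ ‖z‖ + |z.im| / 2 := by
      have := norm_le_norm_add_norm_sub' w z
      rw [mem_sphere_iff_norm] at hw
      linarith
    have e2 : |w.im|⁻¹ ≤ 2 * |z.im|⁻¹ := by
      have := inv_anti₀ (half_pos hy) (him w hw')
      rwa [inv_div, div_eq_mul_inv] at this
    have e3 : 1 + ‖w‖ ≤ 2 * (1 + ‖z‖) := by linarith
    have e4 : 1 + |w.im|⁻¹ ≤ 2 * (1 + |z.im|⁻¹) := by linarith
    gcongr
  have hfin := Complex.norm_deriv_le_of_forall_mem_sphere_norm_le (half_pos hy) hcont hsphere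
  rw [deriv_sub (hdG z hz) (hdF z hz)] at hfin
  refine hfin.trans ?_
  have hyi : |z.im|⁻¹ ≤ 1 + |z.im|⁻¹ := by linarith
  -- On the circle 1 + |w| and 1 + |Im w|⁻¹ at most double, costing 2⁵ · 2⁸. Division by the radius
  -- gives the remaining 2 and one more power of |Im z|⁻¹.
  calc _ = 2 ^ 14 * (10 * Λ ^ 2 * (1 + D)) / K ^ 2 * (1 + ‖z‖) ^ 5 * (1 + |z.im|⁻¹) ^ 8
        * |z.im|⁻¹ := by
        rw [div_div_eq_mul_div, div_eq_mul_inv _ |z.im|]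
        ring
    _ ≤ 2 ^ 14 * (10 * Λ ^ 2 * (1 + D)) / K ^ 2 * (1 + ‖z‖) ^ 5 * (1 + |z.im|⁻¹) ^ 8
        * (1 + |z.im|⁻¹) := by
        gcongr
    _ = _ := by ring

end DeterministicEquivalent

/-! ### Choice of the polynomials and conclusion. -/

theorem isNonnegPoly_C_mul_X_add_one_pow {C : ℝ} (hC : 0 < C) (m : ℕ) :
    IsNonnegPoly m (Polynomial.C C * (X + 1) ^ m) := by
  refine ⟨?_, fun k => ?_⟩
  · rw [natDegree_C_mul hC.ne', natDegree_pow, ← C_1, natDegree_X_add_C, mul_one]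
  · rw [coeff_C_mul, coeff_X_add_one_pow]
    positivity

theorem theorem3
    -- dimensions, population covariance matrices and their spectra, indexed by the sample size `K`
    (L : ℕ) (N : ℕ → ℕ)
    (R : ∀ K : ℕ, Matrix (Fin (N K)) (Fin (N K)) ℂ)
    (ev : ℕ → Fin L → ℝ) (mult : ℕ → Fin L → ℕ)
    (evMin evMax : ℝ) (c : ℝ) (cs : Fin L → ℝ)
    -- the spectral assumption on the population covariance matrix
    (hR : ∀ᶠ K in atTop, HasDistinctEigenvalues (R K) (ev K) (mult K))
    (hmin : 0 < evMin)
    (hev : ∀ᶠ K in atTop, ∀ i, evMin < ev K i ∧ ev K i < evMax)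
    -- the asymptotic regime
    (hc : c ∈ Set.Ioo (0 : ℝ) 1)
    (hN : Tendsto (fun K : ℕ => (N K : ℝ) / (K : ℝ)) atTop (𝓝 c))
    (hcs : ∀ i, cs i ∈ Set.Ioo (0 : ℝ) 1)
    (hmult : ∀ i, Tendsto (fun K : ℕ => (mult K i : ℝ) / (K : ℝ)) atTop (𝓝 (cs i)))
    -- the data: i.i.d. standard complex Gaussian entries
    (Ω : ℕ → Type*) [∀ K, MeasurableSpace (Ω K)]
    (P : ∀ K, Measure (Ω K)) [∀ K, IsProbabilityMeasure (P K)]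
    (X : ∀ K, Ω K → Matrix (Fin (N K)) (Fin K) ℂ)
    (hXlaw : ∀ K i j, HasLaw (fun ω => X K ω i j) stdComplexGaussian (P K))
    (hXindep : ∀ K, iIndepFun (fun (p : Fin (N K) × Fin K) ω => X K ω p.1 p.2) (P K)) :
    ∃ P₉ P₁₂ P₁₅ P₂₀ : ℝ[X],
      IsNonnegPoly 9 P₉ ∧ IsNonnegPoly 12 P₁₂ ∧ IsNonnegPoly 15 P₁₅ ∧ IsNonnegPoly 20 P₂₀ ∧
      ∀ᶠ K in atTop,
        -- the deterministic equivalent is well defined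
        IsMPMeasure (N K) K (ev K) (mult K) (mpMeasure (N K) K (ev K) (mult K)) ∧
        ∀ z : ℂ, z.im ≠ 0 →
          (∀ b : ℂ, 0 < b.im * z.im → MPEquation (N K) K (ev K) (mult K) z b →
            b = mpStieltjes (N K) K (ev K) (mult K) z) ∧
          DifferentiableAt ℂ (mpStieltjes (N K) K (ev K) (mult K)) z ∧
          Integrable (fun ω => sampleStieltjes (R K) (X K ω) z) (P K) ∧
          Integrable (fun ω => deriv (sampleStieltjes (R K) (X K ω)) z) (P K) ∧
          -- the two bounds
          ‖(∫ ω, sampleStieltjes (R K) (X K ω) z ∂(P K))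
              - mpStieltjes (N K) K (ev K) (mult K) z‖
            ≤ 1 / (K : ℝ) ^ 2 * P₉.eval ‖z‖ * P₁₂.eval (|z.im|⁻¹) ∧
          ‖(∫ ω, deriv (sampleStieltjes (R K) (X K ω)) z ∂(P K))
              - deriv (mpStieltjes (N K) K (ev K) (mult K)) z‖
            ≤ 1 / (K : ℝ) ^ 2 * P₁₅.eval ‖z‖ * P₂₀.eval (|z.im|⁻¹) := by
  obtain ⟨hc0, hc1⟩ := hc
  -- Once c_K < (1 + c) / 2, the quantity 1 / (1 − c_K) is at most D, uniformly in K.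
  set D : ℝ := 2 / (1 - c) with hD
  have hD0 : 0 < D := div_pos two_pos (by linarith)
  -- The added 1 makes the leading coefficient positive, as the exact degrees require, with no
  -- discussion of `evMax`.
  set A : ℝ := 10 * evMax ^ 2 * (1 + D) + 1 with hA
  have hA1 : 10 * evMax ^ 2 * (1 + D) ≤ A := by linarith
  have hA0 : 0 < A := by positivity
  refine ⟨_, _, _, _, isNonnegPoly_C_mul_X_add_one_pow hA0 9,
    isNonnegPoly_C_mul_X_add_one_pow one_pos 12,
    isNonnegPoly_C_mul_X_add_one_pow (mul_pos (by norm_num : (0 : ℝ) < 2 ^ 14) hA0) 15,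
    isNonnegPoly_C_mul_X_add_one_pow one_pos 20, ?_⟩
  have hlt := hN.eventually_lt_const (show c < (1 + c) / 2 by linarith)
  have hpos := hN.eventually_const_lt hc0
  filter_upwards [hR, hev, hlt, hpos, eventually_gt_atTop 0] with K hRK hevK hltK hposK hK
  have hK' : (0 : ℝ) < K := by exact_mod_cast hK
  have hN0 : N K ≠ 0 := by
    intro h0
    simp [h0] at hposK
  have : NeZero (N K) := ⟨hN0⟩
  have : NeZero K := ⟨hK.ne'⟩
  have hev' : ∀ i, 0 < ev K i ∧ ev K i < evMax := fun i =>
    ⟨hmin.trans (hevK i).1, (hevK i).2⟩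
  have hcK : (N K : ℝ) / K < 1 := by linarith
  have hDK : (1 - (N K : ℝ) / K)⁻¹ ≤ D := by
    rw [hD, ← inv_div (1 - c) 2]
    exact inv_anti₀ (by linarith) (by linarith)
  refine ⟨isMPMeasure_mpMeasure hRK hev', fun z hz => ?_⟩
  obtain ⟨i1, e1⟩ := sampleStieltjes_integrable_and_integral (hXlaw K) (hXindep K) (R K) hz
  obtain ⟨i2, e2⟩ := deriv_sampleStieltjes_integrable_and_integral (hXlaw K) (hXindep K) (R K) hz
  have hu : 1 ≤ 1 + ‖z‖ := by linarith [norm_nonneg z]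
  have hv : 1 ≤ 1 + |z.im|⁻¹ := by linarith [inv_nonneg.2 (abs_nonneg z.im)]
  refine ⟨fun b hb e => e.eq_mpStieltjes hRK hev' hcK hb, differentiableAt_mpStieltjes hRK hev' hz,
    i1, i2, ?_, ?_⟩
  · rw [e1]
    refine (norm_meanSpectralMeasure_sub_mpStieltjes_le hRK hev' hcK hDK hz).trans ?_
    simp only [eval_mul, eval_C, eval_pow, eval_add, eval_X, eval_one, one_mul]
    rw [add_comm ‖z‖, add_comm |z.im|⁻¹]
    -- Powers of 1 + x increase with the exponent for x ≥ 0, so the exponents 5 and 8 may be raised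
    -- to 9 and 12.
    calc _ ≤ A / K ^ 2 * (1 + ‖z‖) ^ 9 * (1 + |z.im|⁻¹) ^ 12 := by
          gcongr ?_ / _ * ?_ * ?_
          · exact pow_le_pow_right₀ hu (by norm_num)
          · exact pow_le_pow_right₀ hv (by norm_num)
      _ = _ := by ring
  · rw [e2]
    refine (norm_deriv_meanSpectralMeasure_sub_mpStieltjes_le hRK hev' hcK hDK hz).trans ?_
    simp only [eval_mul, eval_C, eval_pow, eval_add, eval_X, eval_one, one_mul]
    rw [add_comm ‖z‖, add_comm |z.im|⁻¹]
    calc _ ≤ 2 ^ 14 * A / K ^ 2 * (1 + ‖z‖) ^ 15 * (1 + |z.im|⁻¹) ^ 20 := by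
          gcongr ?_ / _ * ?_ * ?_
          · gcongr
          · exact pow_le_pow_right₀ hu (by norm_num)
          · exact pow_le_pow_right₀ hv (by norm_num)
      _ = _ := by ring
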